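/- **Setting.** Let $\mathbb B$ be an infinite set of visible actions, $\mathbb B_\tau=\mathbb B\cup\{\tau\}$ (actions $\alpha$), and let each $\alpha$ also have an urgent copy $\underline\alpha$; $\mu,\nu$ range over $\mathbb B_\tau\cup\underline{\mathbb B}_\tau$. Let $\mathcal X$ be a set of process variables. A general relabelling function is a map $\Phi:\mathbb B_\tau\to\mathbb B_\tau$ with $\Phi(\tau)=\tau$ such that $\{\alpha\mid\emptyset\ne\Phi^{-1}(\alpha)\ne\{\alpha\}\}$ is finite. *Terms.* The initial terms $P$ and the general terms $Q$ of PAFAS$_r$ are given by $$P::=\mathsf{nil}\mid x\mid\alpha.P\mid\alpha\triangleright P\mid P+P\mid P\,\|_A\,P\mid P[\Phi]\mid\mathsf{rec}\,x.P,$$ $$Q::=P\mid\underline\alpha.P\mid\mu\triangleright Q\mid Q+Q\mid Q\,\|_A\,Q\mid Q[\Phi]\mid\mathsf{rec}\,x.Q,$$ with $x\in\mathcal X$ and $A\subseteq\mathbb B$ arbitrary. The terms of PAFAS$_s$ are given by the same grammar with read-set prefixes in place of the read prefixes: $\{\alpha_1,\dots,\alpha_n\}\triangleright P$ for initial terms and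 $\{\mu_1,\dots,\mu_n\}\triangleright Q$ for general terms, where the set is finite and nonempty and contains no action together with its urgent copy. A variable $x$ is guarded in a term if each of its free occurrences is in the scope of an action prefix $\mu.(\,)$; for every $\mathsf{rec}\,x.Q$ it is required that $x$ is guarded in $Q$. A process is a closed term. The rules below are applied to all expressions built by the operators, even where unfolding a recursion whose body contains urgent actions leads outside the grammar. *Behaviour of PAFAS$_r$.* Ordinary transitions $\xrightarrow{\alpha}_o$ and read transitions $\xrightarrow{\alpha}_r$ are the least relations such that (with the symmetric rules for $+$ and $\|_A$; $\xrightarrow{\alpha}$ is the union of both relations) - $\mu.P\xrightarrow{\alpha}_oP$ and $\mu\triangleright Q\xrightarrow{\alpha}_r\mu\triangleright Q$ if $\mu\in\{\alpha,\underline\alpha\}$; - if $Q\xrightarrow{\alpha}_oQ'$ then $\mu\triangleright Q\xrightarrow{\alpha}_oQ'$ and $Q+R\xrightarrow{\alpha}_oQ'$; if $Q\xrightarrow{\alpha}_rQ'$ then $\mu\triangleright Q\xrightarrow{\alpha}_r\mu\triangleright Q'$ and $Q+R\xrightarrow{\alpha}_rQ'+R$; - for $\alpha\notin A$, if $Q\xrightarrow{\alpha}_{i}Q'$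 then $Q\|_AR\xrightarrow{\alpha}_{i}Q'\|_AR$ ($i\in\{o,r\}$); for $\alpha\in A$, if $Q\xrightarrow{\alpha}_oQ'$ and $R\xrightarrow{\alpha}R'$ then $Q\|_AR\xrightarrow{\alpha}_oQ'\|_AR'$, and if $Q\xrightarrow{\alpha}_rQ'$ and $R\xrightarrow{\alpha}_rR'$ then $Q\|_AR\xrightarrow{\alpha}_rQ'\|_AR'$; - if $Q\xrightarrow{\alpha}_iQ'$ then $Q[\Phi]\xrightarrow{\Phi(\alpha)}_iQ'[\Phi]$; if $Q\{\mathsf{rec}\,x.Q/x\}\xrightarrow{\alpha}_iQ'$ then $\mathsf{rec}\,x.Q\xrightarrow{\alpha}_iQ'$. Time steps $Q\xrightarrow{X}_tQ'$ with refusal set $X\subseteq\mathbb B$ are the least relations such that - $\mathsf{nil}\xrightarrow{X}_t\mathsf{nil}$; $\alpha.P\xrightarrow{X}_t\underline\alpha.P$; $\underline\alpha.P\xrightarrow{X}_t\underline\alpha.P$ if $\alpha\notin X\cup\{\tau\}$; - if $Q\xrightarrow{X}_tQ'$ then $\alpha\triangleright Q\xrightarrow{X}_t\underline\alpha\triangleright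 Q'$ and, if $\alpha\notin X\cup\{\tau\}$, $\underline\alpha\triangleright Q\xrightarrow{X}_t\underline\alpha\triangleright Q'$; - if $Q_i\xrightarrow{X}_tQ_i'$ for $i=1,2$ then $Q_1+Q_2\xrightarrow{X}_tQ_1'+Q_2'$; - if $Q_i\xrightarrow{X_i}_tQ_i'$ for $i=1,2$ and $X\subseteq(A\cap(X_1\cup X_2))\cup((X_1\cap X_2)\setminus A)$ then $Q_1\|_AQ_2\xrightarrow{X}_tQ_1'\|_AQ_2'$; - if $Q\xrightarrow{\Phi^{-1}(X\cup\{\tau\})\setminus\{\tau\}}_tQ'$ then $Q[\Phi]\xrightarrow{X}_tQ'[\Phi]$; if $Q\{\mathsf{rec}\,x.Q/x\}\xrightarrow{X}_tQ'$ then $\mathsf{rec}\,x.Q\xrightarrow{X}_tQ'$. *Behaviour of PAFAS$_s$.* There is one kind of action transition $\xrightarrow{\alpha}$, given by the rules for $\xrightarrow{\alpha}_o$ with $\xrightarrow{\alpha}$ in place of all arrows, where the rules for read prefixes are replaced by: $M\triangleright Q\xrightarrow{\alpha}M\triangleright Q$ if $\alpha\in M$ or $\underline\alpha\in M$; and $M\triangleright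 Q\xrightarrow{\alpha}Q'$ if $Q\xrightarrow{\alpha}Q'$. Time steps are as above, where the rules for read prefixes are replaced by: if $Q\xrightarrow{X}_tQ'$ and no $\alpha\in X\cup\{\tau\}$ has $\underline\alpha\in M$, then $M\triangleright Q\xrightarrow{X}_t\underline M\triangleright Q'$, where $\underline M$ results from $M$ by making all actions urgent. *Normal forms.* A term is read-guarded if each of its subterms that is a read-prefixed (in PAFAS$_s$: read-set-prefixed) term is in the scope of an action prefix. It is $x$-proper if the free occurrences of $x$ in it are guarded in each of its subterms that is a choice, a read(-set)-prefixed term or a recursion. It is rec-proper if for each subterm $\mathsf{rec}\,x.Q_1$ the body $Q_1$ is read-guarded or $x$-proper. A PAFAS$_r$ term is in read normal form if it is rec-proper, each choice subterm $Q_1+Q_2$ is read-guarded, and for each subterm $\mu\triangleright Q'$ either $Q'$ is read-guarded or $Q'$ has the form $\nu\triangleright Q''$. A PAFAS$_s$ term is proper if it is rec-proper, each choice subterm is read-guarded, and for each subterm $M\triangleright Q'$ the term $Q'$ is read-guarded. **Theorem.** Let $Q$ be a PAFAS$_r$ process such that every subterm of $Q$ (including $Q$ itself) of the form $Q_1+Q_2$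 or $\mathsf{rec}\,x.Q_1$ is in read normal form. Then there is a proper PAFAS$_s$ process $R$ that is timed bisimilar to $Q$: there is a relation $\mathcal S$ with $(Q,R)\in\mathcal S$ such that, for all $(Q_0,R_0)\in\mathcal S$, all $\alpha\in\mathbb B_\tau$ and all $X\subseteq\mathbb B$, each transition $Q_0\xrightarrow{\alpha}Q_0'$ (resp. $Q_0\xrightarrow{X}_tQ_0'$) is matched by some $R_0\xrightarrow{\alpha}R_0'$ (resp. $R_0\xrightarrow{X}_tR_0'$) with $(Q_0',R_0')\in\mathcal S$, and vice versa. -/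

import Mathlib

namespace PAFAS

universe u v w

/-! Actions -/

/-- Actions over the visible actions `B`: `some a` is the visible action `a`,
`none` is the internal action. -/
abbrev Act (B : Type u) : Type u := Option B

/-- The internal action. -/
abbrev tau {B : Type u} : Act B := none

/-- Timed actions: an action is either lazy (maximal delay 1) or urgent (maximal delay 0). -/
inductive TAct (B : Type u) : Type u
  | lazy (α : Act B) : TAct B
  | urgent (α : Act B) : TAct B

/-- The action underlying a timed action. -/
def TAct.act {B : Type u} : TAct B → Act B
  | .lazy α => α
  | .urgent α => α

/-- The timed action is lazy. -/
def TAct.IsLazy {B : Type u} : TAct B → Prop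
  | .lazy _ => True
  | .urgent _ => False

/-- A set of visible actions, regarded as a set of actions. -/
def visible {B : Type u} (X : Set B) : Set (Act B) := {α | ∃ a ∈ X, α = some a}

/-- The set `X ∪ {τ}`. -/
def withTau {B : Type u} (X : Set B) : Set (Act B) := visible X ∪ {tau}

/-- General relabelling functions: `Φ(τ) = τ`, and only finitely many actions `α` satisfy
`∅ ≠ Φ⁻¹(α) ≠ {α}`. -/
structure Relabelling (B : Type u) : Type u where
  toFun : Act B → Act B
  map_tau : toFun tau = tau
  finite_base : {α : Act B | (toFun ⁻¹' {α}).Nonempty ∧ toFun ⁻¹' {α} ≠ {α}}.Finite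

/-- The refusal set `Φ⁻¹(X ∪ {τ}) \ {τ}`, a set of visible actions. -/
def Relabelling.refusal {B : Type u} (Φ : Relabelling B) (X : Set B) : Set B :=
  {a | Φ.toFun (some a) ∈ withTau X}

/-! Timed labelled transition systems and timed bisimilarity -/

/-- A transition system with action transitions and with (partial) time steps, the latter
labelled by refusal sets. -/
structure TimedLTS (B : Type u) (S : Type v) where
  act : Act B → S → S → Prop
  time : Set B → S → S → Prop

/-- `ρ` is a timed bisimulation between two transition systems. -/
structure IsTimedBisimulation {B : Type u} {S : Type v} {T : Type w}
    (L : TimedLTS B S) (M : TimedLTS B T) (ρ : S → T → Prop) : Prop where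
  act_forth : ∀ s t, ρ s t → ∀ α s₁, L.act α s s₁ → ∃ t₁, M.act α t t₁ ∧ ρ s₁ t₁
  act_back : ∀ s t, ρ s t → ∀ α t₁, M.act α t t₁ → ∃ s₁, L.act α s s₁ ∧ ρ s₁ t₁
  time_forth : ∀ s t, ρ s t → ∀ X s₁, L.time X s s₁ → ∃ t₁, M.time X t t₁ ∧ ρ s₁ t₁
  time_back : ∀ s t, ρ s t → ∀ X t₁, M.time X t t₁ → ∃ s₁, L.time X s s₁ ∧ ρ s₁ t₁

/-- Timed bisimilarity of a state of `L` and a state of `M`. -/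
def TimedBisimilar {B : Type u} {S : Type v} {T : Type w}
    (L : TimedLTS B S) (M : TimedLTS B T) (s : S) (t : T) : Prop :=
  ∃ ρ : S → T → Prop, IsTimedBisimulation L M ρ ∧ ρ s t

/-! The language with read-action prefixes -/

/-- Preterms of PAFAS_r over the visible actions `B` and the process variables `V`;
the well-formed terms are singled out by `RTerm.IsTerm` and `RTerm.GuardedRec`. The recursion
`rec x. Q` is written `fix x Q`. -/
inductive RTerm (B : Type u) (V : Type v) : Type (max u v)
  | nil : RTerm B V
  | var (x : V) : RTerm B V
  | pref (μ : TAct B) (P : RTerm B V) : RTerm B V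
  | read (μ : TAct B) (Q : RTerm B V) : RTerm B V
  | sum (Q₁ Q₂ : RTerm B V) : RTerm B V
  | par (A : Set B) (Q₁ Q₂ : RTerm B V) : RTerm B V
  | rel (Q : RTerm B V) (Φ : Relabelling B) : RTerm B V
  | fix (x : V) (Q : RTerm B V) : RTerm B V

namespace RTerm

variable {B : Type u} {V : Type v}

/-- The grammar of initial terms: all actions are lazy. -/
def IsInitial : RTerm B V → Prop
  | nil => True
  | var _ => True
  | pref μ P => μ.IsLazy ∧ P.IsInitial
  | read μ P => μ.IsLazy ∧ P.IsInitial
  | sum P₁ P₂ => P₁.IsInitial ∧ P₂.IsInitial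
  | par _ P₁ P₂ => P₁.IsInitial ∧ P₂.IsInitial
  | rel P _ => P.IsInitial
  | fix _ P => P.IsInitial

/-- The grammar of general terms: the body of an action prefix is initial. -/
def IsTerm : RTerm B V → Prop
  | nil => True
  | var _ => True
  | pref _ P => P.IsInitial
  | read _ Q => Q.IsTerm
  | sum Q₁ Q₂ => Q₁.IsTerm ∧ Q₂.IsTerm
  | par _ Q₁ Q₂ => Q₁.IsTerm ∧ Q₂.IsTerm
  | rel Q _ => Q.IsTerm
  | fix _ Q => Q.IsTerm

/-- The free variables. -/
def freeVars : RTerm B V → Set V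
  | nil => ∅
  | var x => {x}
  | pref _ P => P.freeVars
  | read _ Q => Q.freeVars
  | sum Q₁ Q₂ => Q₁.freeVars ∪ Q₂.freeVars
  | par _ Q₁ Q₂ => Q₁.freeVars ∪ Q₂.freeVars
  | rel Q _ => Q.freeVars
  | fix x Q => Q.freeVars \ {x}

/-- Every free occurrence of `x` is in the scope of an action prefix `μ.( )`. -/
def Guarded (x : V) : RTerm B V → Prop
  | nil => True
  | var y => y ≠ x
  | pref _ _ => True
  | read _ Q => Q.Guarded x
  | sum Q₁ Q₂ => Q₁.Guarded x ∧ Q₂.Guarded x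
  | par _ Q₁ Q₂ => Q₁.Guarded x ∧ Q₂.Guarded x
  | rel Q _ => Q.Guarded x
  | fix y Q => y = x ∨ Q.Guarded x

/-- The subterms of a term, including the term itself. -/
def subterms : RTerm B V → Set (RTerm B V)
  | nil => {nil}
  | var x => {var x}
  | pref μ P => {pref μ P} ∪ P.subterms
  | read μ Q => {read μ Q} ∪ Q.subterms
  | sum Q₁ Q₂ => {sum Q₁ Q₂} ∪ Q₁.subterms ∪ Q₂.subterms
  | par A Q₁ Q₂ => {par A Q₁ Q₂} ∪ Q₁.subterms ∪ Q₂.subterms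
  | rel Q Φ => {rel Q Φ} ∪ Q.subterms
  | fix x Q => {fix x Q} ∪ Q.subterms

/-- All recursions in the term are guarded. -/
def GuardedRec (Q : RTerm B V) : Prop :=
  ∀ x Q₁, fix x Q₁ ∈ Q.subterms → Q₁.Guarded x

/-- PAFAS_r processes: closed terms with guarded recursion. -/
def IsProc (Q : RTerm B V) : Prop :=
  Q.IsTerm ∧ Q.GuardedRec ∧ Q.freeVars = ∅

/-- Substitution of `R` for the free occurrences of `x`. It is used for closed `R` only
(transitions of closed terms unfold closed recursions only), so no variable is captured. -/
def subst [DecidableEq V] (x : V) (R : RTerm B V) : RTerm B V → RTerm B V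
  | nil => nil
  | var y => if y = x then R else var y
  | pref μ P => pref μ (subst x R P)
  | read μ Q => read μ (subst x R Q)
  | sum Q₁ Q₂ => sum (subst x R Q₁) (subst x R Q₂)
  | par A Q₁ Q₂ => par A (subst x R Q₁) (subst x R Q₂)
  | rel Q Φ => rel (subst x R Q) Φ
  | fix y Q => if y = x then fix y Q else fix y (subst x R Q)

/-- Read action transitions. -/
inductive ReadStep [DecidableEq V] : Act B → RTerm B V → RTerm B V → Prop
  | read₁ {α : Act B} {μ : TAct B} (Q : RTerm B V) :
      μ.act = α → ReadStep α (read μ Q) (read μ Q)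
  | read₂ {α : Act B} (μ : TAct B) {Q Q' : RTerm B V} :
      ReadStep α Q Q' → ReadStep α (read μ Q) (read μ Q')
  | sumL {α : Act B} {Q₁ Q₁' : RTerm B V} (Q₂ : RTerm B V) :
      ReadStep α Q₁ Q₁' → ReadStep α (sum Q₁ Q₂) (sum Q₁' Q₂)
  | sumR {α : Act B} (Q₁ : RTerm B V) {Q₂ Q₂' : RTerm B V} :
      ReadStep α Q₂ Q₂' → ReadStep α (sum Q₁ Q₂) (sum Q₁ Q₂')
  | parL {α : Act B} {A : Set B} {Q₁ Q₁' : RTerm B V} (Q₂ : RTerm B V) :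
      α ∉ visible A → ReadStep α Q₁ Q₁' → ReadStep α (par A Q₁ Q₂) (par A Q₁' Q₂)
  | parR {α : Act B} {A : Set B} (Q₁ : RTerm B V) {Q₂ Q₂' : RTerm B V} :
      α ∉ visible A → ReadStep α Q₂ Q₂' → ReadStep α (par A Q₁ Q₂) (par A Q₁ Q₂')
  | sync {α : Act B} {A : Set B} {Q₁ Q₁' Q₂ Q₂' : RTerm B V} :
      α ∈ visible A → ReadStep α Q₁ Q₁' → ReadStep α Q₂ Q₂' →
      ReadStep α (par A Q₁ Q₂) (par A Q₁' Q₂')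
  | rel {α β : Act B} {Φ : Relabelling B} {Q Q' : RTerm B V} :
      ReadStep α Q Q' → Φ.toFun α = β → ReadStep β (rel Q Φ) (rel Q' Φ)
  | fix {α : Act B} {x : V} {Q Q' : RTerm B V} :
      ReadStep α (subst x (fix x Q) Q) Q' → ReadStep α (fix x Q) Q'

/-- Ordinary action transitions. -/
inductive OrdStep [DecidableEq V] : Act B → RTerm B V → RTerm B V → Prop
  | pref {α : Act B} {μ : TAct B} (P : RTerm B V) : μ.act = α → OrdStep α (pref μ P) P
  | read {α : Act B} (μ : TAct B) {Q Q' : RTerm B V} :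
      OrdStep α Q Q' → OrdStep α (read μ Q) Q'
  | sumL {α : Act B} {Q₁ Q' : RTerm B V} (Q₂ : RTerm B V) :
      OrdStep α Q₁ Q' → OrdStep α (sum Q₁ Q₂) Q'
  | sumR {α : Act B} (Q₁ : RTerm B V) {Q₂ Q' : RTerm B V} :
      OrdStep α Q₂ Q' → OrdStep α (sum Q₁ Q₂) Q'
  | parL {α : Act B} {A : Set B} {Q₁ Q₁' : RTerm B V} (Q₂ : RTerm B V) :
      α ∉ visible A → OrdStep α Q₁ Q₁' → OrdStep α (par A Q₁ Q₂) (par A Q₁' Q₂)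
  | parR {α : Act B} {A : Set B} (Q₁ : RTerm B V) {Q₂ Q₂' : RTerm B V} :
      α ∉ visible A → OrdStep α Q₂ Q₂' → OrdStep α (par A Q₁ Q₂) (par A Q₁ Q₂')
  | sync {α : Act B} {A : Set B} {Q₁ Q₁' Q₂ Q₂' : RTerm B V} :
      α ∈ visible A → OrdStep α Q₁ Q₁' → OrdStep α Q₂ Q₂' →
      OrdStep α (par A Q₁ Q₂) (par A Q₁' Q₂')
  | syncL {α : Act B} {A : Set B} {Q₁ Q₁' Q₂ Q₂' : RTerm B V} :
      α ∈ visible A → OrdStep α Q₁ Q₁' → ReadStep α Q₂ Q₂' →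
      OrdStep α (par A Q₁ Q₂) (par A Q₁' Q₂')
  | syncR {α : Act B} {A : Set B} {Q₁ Q₁' Q₂ Q₂' : RTerm B V} :
      α ∈ visible A → ReadStep α Q₁ Q₁' → OrdStep α Q₂ Q₂' →
      OrdStep α (par A Q₁ Q₂) (par A Q₁' Q₂')
  | rel {α β : Act B} {Φ : Relabelling B} {Q Q' : RTerm B V} :
      OrdStep α Q Q' → Φ.toFun α = β → OrdStep β (rel Q Φ) (rel Q' Φ)
  | fix {α : Act B} {x : V} {Q Q' : RTerm B V} :
      OrdStep α (subst x (fix x Q) Q) Q' → OrdStep α (fix x Q) Q'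

/-- Action transitions: ordinary or reading. -/
def Step [DecidableEq V] (α : Act B) (Q Q' : RTerm B V) : Prop :=
  OrdStep α Q Q' ∨ ReadStep α Q Q'

/-- (Partial) time steps with a refusal set. -/
inductive TimeStep [DecidableEq V] : Set B → RTerm B V → RTerm B V → Prop
  | nil (X : Set B) : TimeStep X nil nil
  | prefLazy (X : Set B) (α : Act B) (P : RTerm B V) :
      TimeStep X (pref (.lazy α) P) (pref (.urgent α) P)
  | prefUrgent {X : Set B} {α : Act B} (P : RTerm B V) :
      α ∉ withTau X → TimeStep X (pref (.urgent α) P) (pref (.urgent α) P)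
  | readLazy {X : Set B} (α : Act B) {Q Q' : RTerm B V} :
      TimeStep X Q Q' → TimeStep X (read (.lazy α) Q) (read (.urgent α) Q')
  | readUrgent {X : Set B} {α : Act B} {Q Q' : RTerm B V} :
      TimeStep X Q Q' → α ∉ withTau X →
      TimeStep X (read (.urgent α) Q) (read (.urgent α) Q')
  | sum {X : Set B} {Q₁ Q₁' Q₂ Q₂' : RTerm B V} :
      TimeStep X Q₁ Q₁' → TimeStep X Q₂ Q₂' → TimeStep X (sum Q₁ Q₂) (sum Q₁' Q₂')
  | rel {X : Set B} {Φ : Relabelling B} {Q Q' : RTerm B V} :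
      TimeStep (Φ.refusal X) Q Q' → TimeStep X (rel Q Φ) (rel Q' Φ)
  | fix {X : Set B} {x : V} {Q Q' : RTerm B V} :
      TimeStep X (subst x (fix x Q) Q) Q' → TimeStep X (fix x Q) Q'
  | par {X X₁ X₂ A : Set B} {Q₁ Q₁' Q₂ Q₂' : RTerm B V} :
      TimeStep X₁ Q₁ Q₁' → TimeStep X₂ Q₂ Q₂' →
      X ⊆ (A ∩ (X₁ ∪ X₂)) ∪ ((X₁ ∩ X₂) \ A) →
      TimeStep X (par A Q₁ Q₂) (par A Q₁' Q₂')

/-- The timed behaviour of PAFAS_r; ordinary and reading transitions are not distinguished. -/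
def lts (B : Type u) (V : Type v) [DecidableEq V] : TimedLTS B (RTerm B V) where
  act := Step
  time := TimeStep

/-- Every subterm `μ ▷ Q'` is in the scope of an action prefix. -/
def ReadGuarded : RTerm B V → Prop
  | nil => True
  | var _ => True
  | pref _ _ => True
  | read _ _ => False
  | sum Q₁ Q₂ => Q₁.ReadGuarded ∧ Q₂.ReadGuarded
  | par _ Q₁ Q₂ => Q₁.ReadGuarded ∧ Q₂.ReadGuarded
  | rel Q _ => Q.ReadGuarded
  | fix _ Q => Q.ReadGuarded

/-- The free occurrences of `x` in the term are guarded in each subterm that is a choice,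
a read prefix or a recursion. -/
def XProper (x : V) : RTerm B V → Prop
  | nil => True
  | var _ => True
  | pref _ P => P.XProper x
  | read _ Q => Q.Guarded x ∧ Q.XProper x
  | sum Q₁ Q₂ => (Q₁.Guarded x ∧ Q₂.Guarded x) ∧ Q₁.XProper x ∧ Q₂.XProper x
  | par _ Q₁ Q₂ => Q₁.XProper x ∧ Q₂.XProper x
  | rel Q _ => Q.XProper x
  | fix y Q => y = x ∨ (Q.Guarded x ∧ Q.XProper x)

/-- For each subterm `fix x Q₁`, the body is read-guarded or `x`-proper. -/
def RecProper (Q : RTerm B V) : Prop :=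
  ∀ x Q₁, fix x Q₁ ∈ Q.subterms → Q₁.ReadGuarded ∨ Q₁.XProper x

/-- Choices are read-guarded, and the body of a read prefix is read-guarded or is itself a
read-prefixed term. -/
def RaProper (Q : RTerm B V) : Prop :=
  (∀ Q₁ Q₂, sum Q₁ Q₂ ∈ Q.subterms → (sum Q₁ Q₂).ReadGuarded) ∧
  (∀ μ Q₁, read μ Q₁ ∈ Q.subterms → Q₁.ReadGuarded ∨ ∃ ν Q₂, Q₁ = read ν Q₂)

/-- Read normal form. -/
def RNF (Q : RTerm B V) : Prop := Q.RecProper ∧ Q.RaProper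

/-- The term is a choice. -/
def IsChoice (Q : RTerm B V) : Prop := ∃ Q₁ Q₂, Q = sum Q₁ Q₂

/-- The term is a recursion. -/
def IsRecursion (Q : RTerm B V) : Prop := ∃ x Q₁, Q = fix x Q₁

end RTerm

/-! The language with read-set prefixes -/

/-- The urgent actions of a set of timed actions. -/
def urgentActs {B : Type u} (M : Set (TAct B)) : Set (Act B) := {α | .urgent α ∈ M}

/-- The set obtained by making all members urgent. -/
def makeUrgent {B : Type u} (M : Set (TAct B)) : Set (TAct B) :=
  (fun μ : TAct B => .urgent μ.act) '' M

/-- Read sets: nonempty finite sets of timed actions without two copies (a lazy and an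
urgent one) of the same action. -/
def IsReadSet {B : Type u} (M : Set (TAct B)) : Prop :=
  M.Finite ∧ M.Nonempty ∧ ∀ α : Act B, ¬ (.lazy α ∈ M ∧ .urgent α ∈ M)

/-- Preterms of PAFAS_s over the visible actions `B` and the process variables `V`;
the well-formed terms are singled out by `STerm.IsTerm` and `STerm.GuardedRec`. The recursion
`rec x. Q` is written `fix x Q`. -/
inductive STerm (B : Type u) (V : Type v) : Type (max u v)
  | nil : STerm B V
  | var (x : V) : STerm B V
  | pref (μ : TAct B) (P : STerm B V) : STerm B V
  | read (M : Set (TAct B)) (Q : STerm B V) : STerm B V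
  | sum (Q₁ Q₂ : STerm B V) : STerm B V
  | par (A : Set B) (Q₁ Q₂ : STerm B V) : STerm B V
  | rel (Q : STerm B V) (Φ : Relabelling B) : STerm B V
  | fix (x : V) (Q : STerm B V) : STerm B V

namespace STerm

variable {B : Type u} {V : Type v}

/-- The grammar of initial terms: all actions are lazy. -/
def IsInitial : STerm B V → Prop
  | nil => True
  | var _ => True
  | pref μ P => μ.IsLazy ∧ P.IsInitial
  | read M P => (IsReadSet M ∧ ∀ μ ∈ M, μ.IsLazy) ∧ P.IsInitial
  | sum P₁ P₂ => P₁.IsInitial ∧ P₂.IsInitial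
  | par _ P₁ P₂ => P₁.IsInitial ∧ P₂.IsInitial
  | rel P _ => P.IsInitial
  | fix _ P => P.IsInitial

/-- The grammar of general terms: the body of an action prefix is initial. -/
def IsTerm : STerm B V → Prop
  | nil => True
  | var _ => True
  | pref _ P => P.IsInitial
  | read M Q => IsReadSet M ∧ Q.IsTerm
  | sum Q₁ Q₂ => Q₁.IsTerm ∧ Q₂.IsTerm
  | par _ Q₁ Q₂ => Q₁.IsTerm ∧ Q₂.IsTerm
  | rel Q _ => Q.IsTerm
  | fix _ Q => Q.IsTerm

/-- The free variables. -/
def freeVars : STerm B V → Set V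
  | nil => ∅
  | var x => {x}
  | pref _ P => P.freeVars
  | read _ Q => Q.freeVars
  | sum Q₁ Q₂ => Q₁.freeVars ∪ Q₂.freeVars
  | par _ Q₁ Q₂ => Q₁.freeVars ∪ Q₂.freeVars
  | rel Q _ => Q.freeVars
  | fix x Q => Q.freeVars \ {x}

/-- Every free occurrence of `x` is in the scope of an action prefix `μ.( )`. -/
def Guarded (x : V) : STerm B V → Prop
  | nil => True
  | var y => y ≠ x
  | pref _ _ => True
  | read _ Q => Q.Guarded x
  | sum Q₁ Q₂ => Q₁.Guarded x ∧ Q₂.Guarded x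
  | par _ Q₁ Q₂ => Q₁.Guarded x ∧ Q₂.Guarded x
  | rel Q _ => Q.Guarded x
  | fix y Q => y = x ∨ Q.Guarded x

/-- The subterms of a term, including the term itself. -/
def subterms : STerm B V → Set (STerm B V)
  | nil => {nil}
  | var x => {var x}
  | pref μ P => {pref μ P} ∪ P.subterms
  | read M Q => {read M Q} ∪ Q.subterms
  | sum Q₁ Q₂ => {sum Q₁ Q₂} ∪ Q₁.subterms ∪ Q₂.subterms
  | par A Q₁ Q₂ => {par A Q₁ Q₂} ∪ Q₁.subterms ∪ Q₂.subterms
  | rel Q Φ => {rel Q Φ} ∪ Q.subterms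
  | fix x Q => {fix x Q} ∪ Q.subterms

/-- All recursions in the term are guarded. -/
def GuardedRec (Q : STerm B V) : Prop :=
  ∀ x Q₁, fix x Q₁ ∈ Q.subterms → Q₁.Guarded x

/-- PAFAS_s processes: closed terms with guarded recursion. -/
def IsProc (Q : STerm B V) : Prop :=
  Q.IsTerm ∧ Q.GuardedRec ∧ Q.freeVars = ∅

/-- Substitution of `R` for the free occurrences of `x`. It is used for closed `R` only
(transitions of closed terms unfold closed recursions only), so no variable is captured. -/
def subst [DecidableEq V] (x : V) (R : STerm B V) : STerm B V → STerm B V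
  | nil => nil
  | var y => if y = x then R else var y
  | pref μ P => pref μ (subst x R P)
  | read M Q => read M (subst x R Q)
  | sum Q₁ Q₂ => sum (subst x R Q₁) (subst x R Q₂)
  | par A Q₁ Q₂ => par A (subst x R Q₁) (subst x R Q₂)
  | rel Q Φ => rel (subst x R Q) Φ
  | fix y Q => if y = x then fix y Q else fix y (subst x R Q)

/-- Action transitions. -/
inductive Step [DecidableEq V] : Act B → STerm B V → STerm B V → Prop
  | pref {α : Act B} {μ : TAct B} (P : STerm B V) : μ.act = α → Step α (pref μ P) P
  | read₁ {α : Act B} {M : Set (TAct B)} {μ : TAct B} (Q : STerm B V) :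
      μ ∈ M → μ.act = α → Step α (read M Q) (read M Q)
  | read₂ {α : Act B} (M : Set (TAct B)) {Q Q' : STerm B V} :
      Step α Q Q' → Step α (read M Q) Q'
  | sumL {α : Act B} {Q₁ Q' : STerm B V} (Q₂ : STerm B V) :
      Step α Q₁ Q' → Step α (sum Q₁ Q₂) Q'
  | sumR {α : Act B} (Q₁ : STerm B V) {Q₂ Q' : STerm B V} :
      Step α Q₂ Q' → Step α (sum Q₁ Q₂) Q'
  | parL {α : Act B} {A : Set B} {Q₁ Q₁' : STerm B V} (Q₂ : STerm B V) :
      α ∉ visible A → Step α Q₁ Q₁' → Step α (par A Q₁ Q₂) (par A Q₁' Q₂)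
  | parR {α : Act B} {A : Set B} (Q₁ : STerm B V) {Q₂ Q₂' : STerm B V} :
      α ∉ visible A → Step α Q₂ Q₂' → Step α (par A Q₁ Q₂) (par A Q₁ Q₂')
  | sync {α : Act B} {A : Set B} {Q₁ Q₁' Q₂ Q₂' : STerm B V} :
      α ∈ visible A → Step α Q₁ Q₁' → Step α Q₂ Q₂' →
      Step α (par A Q₁ Q₂) (par A Q₁' Q₂')
  | rel {α β : Act B} {Φ : Relabelling B} {Q Q' : STerm B V} :
      Step α Q Q' → Φ.toFun α = β → Step β (rel Q Φ) (rel Q' Φ)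
  | fix {α : Act B} {x : V} {Q Q' : STerm B V} :
      Step α (subst x (fix x Q) Q) Q' → Step α (fix x Q) Q'

/-- (Partial) time steps with a refusal set. -/
inductive TimeStep [DecidableEq V] : Set B → STerm B V → STerm B V → Prop
  | nil (X : Set B) : TimeStep X nil nil
  | prefLazy (X : Set B) (α : Act B) (P : STerm B V) :
      TimeStep X (pref (.lazy α) P) (pref (.urgent α) P)
  | prefUrgent {X : Set B} {α : Act B} (P : STerm B V) :
      α ∉ withTau X → TimeStep X (pref (.urgent α) P) (pref (.urgent α) P)
  | read {X : Set B} {M : Set (TAct B)} {Q Q' : STerm B V} :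
      TimeStep X Q Q' → urgentActs M ∩ withTau X = ∅ →
      TimeStep X (read M Q) (read (makeUrgent M) Q')
  | sum {X : Set B} {Q₁ Q₁' Q₂ Q₂' : STerm B V} :
      TimeStep X Q₁ Q₁' → TimeStep X Q₂ Q₂' → TimeStep X (sum Q₁ Q₂) (sum Q₁' Q₂')
  | rel {X : Set B} {Φ : Relabelling B} {Q Q' : STerm B V} :
      TimeStep (Φ.refusal X) Q Q' → TimeStep X (rel Q Φ) (rel Q' Φ)
  | fix {X : Set B} {x : V} {Q Q' : STerm B V} :
      TimeStep X (subst x (fix x Q) Q) Q' → TimeStep X (fix x Q) Q'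
  | par {X X₁ X₂ A : Set B} {Q₁ Q₁' Q₂ Q₂' : STerm B V} :
      TimeStep X₁ Q₁ Q₁' → TimeStep X₂ Q₂ Q₂' →
      X ⊆ (A ∩ (X₁ ∪ X₂)) ∪ ((X₁ ∩ X₂) \ A) →
      TimeStep X (par A Q₁ Q₂) (par A Q₁' Q₂')

/-- The timed behaviour of PAFAS_s. -/
def lts (B : Type u) (V : Type v) [DecidableEq V] : TimedLTS B (STerm B V) where
  act := Step
  time := TimeStep

/-- Every subterm `M ▷ Q'` is in the scope of an action prefix. -/
def ReadGuarded : STerm B V → Prop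
  | nil => True
  | var _ => True
  | pref _ _ => True
  | read _ _ => False
  | sum Q₁ Q₂ => Q₁.ReadGuarded ∧ Q₂.ReadGuarded
  | par _ Q₁ Q₂ => Q₁.ReadGuarded ∧ Q₂.ReadGuarded
  | rel Q _ => Q.ReadGuarded
  | fix _ Q => Q.ReadGuarded

/-- The free occurrences of `x` in the term are guarded in each subterm that is a choice,
a read prefix or a recursion. -/
def XProper (x : V) : STerm B V → Prop
  | nil => True
  | var _ => True
  | pref _ P => P.XProper x
  | read _ Q => Q.Guarded x ∧ Q.XProper x
  | sum Q₁ Q₂ => (Q₁.Guarded x ∧ Q₂.Guarded x) ∧ Q₁.XProper x ∧ Q₂.XProper x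
  | par _ Q₁ Q₂ => Q₁.XProper x ∧ Q₂.XProper x
  | rel Q _ => Q.XProper x
  | fix y Q => y = x ∨ (Q.Guarded x ∧ Q.XProper x)

/-- For each subterm `fix x Q₁`, the body is read-guarded or `x`-proper. -/
def RecProper (Q : STerm B V) : Prop :=
  ∀ x Q₁, fix x Q₁ ∈ Q.subterms → Q₁.ReadGuarded ∨ Q₁.XProper x

/-- Choices and bodies of read prefixes are read-guarded. -/
def ReadProper (Q : STerm B V) : Prop :=
  (∀ Q₁ Q₂, sum Q₁ Q₂ ∈ Q.subterms → (sum Q₁ Q₂).ReadGuarded) ∧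
  (∀ M Q₁, read M Q₁ ∈ Q.subterms → Q₁.ReadGuarded)

/-- Proper terms. -/
def Proper (Q : STerm B V) : Prop := Q.ReadProper ∧ Q.RecProper

end STerm

end PAFAS

/-! The proof has two halves, joined by composing bisimulations.

A closed term in read normal form has a direct translation `toSTerm`, which merges each chain of
consecutive read prefixes into one read set. In such a term a chain ends in a read-guarded body, and
a read-guarded term has no reading transition. Hence a read-prefixed term is unchanged by its own
reading transitions, and an ordinary transition of the body discards the whole chain; this is how a
read-set prefix behaves. Closed read normal forms are stable under all transitions, so the graph of
`toSTerm` is a timed bisimulation (`isTimedBisimulation_toSTerm`).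

It remains to bring the process into read normal form (`exists_rnf`). Choices and recursions are
normal by assumption, so the essential case is a read prefix in front of a normalised body Q. The
body can be a parallel composition, a relabelling or a recursion that is not read-guarded, and then
the prefix has to move inwards. A fresh action c makes this possible: place a read of c at the
leaves of Q, synchronise on c in every parallel composition passed, let every relabelling passed fix
c, and finally rename c to the action of the prefix (`readBisimilar_distribute`). While all leaves
are untouched they can read c jointly. After an ordinary transition of one component, that component
no longer offers c, and synchronisation blocks c for good, just as an ordinary transition discards a
read prefix. For time steps, a parallel composition refuses c as soon as one component does, so c is
urgent exactly when all leaves still offer it urgently. A fresh action exists because there are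
infinitely many actions, while a term excludes only finitely many.

Recursion is the delicate case: unfolding copies the inserted reads of c to the places of the
recursion variable. Below the leaves every variable is therefore placed in a parallel composition
with nil that blocks c (`protect`). The copies are then invisible. `Erases` says that Q arises from
R by deleting such reads and blocks, `Blocked` that R can never perform c, and `Marked` combines the
two with a flag telling whether c is still on offer.

Bisimilarity must distinguish ordinary from reading transitions in this half (`ReadBisimilar`),
since the two kinds have different effects below a read prefix and in a synchronisation. -/

namespace PAFAS

universe u v

variable {B : Type u}

namespace RTerm

variable {V : Type v}

/-! Recursive descriptions of the predicates defined through subterms -/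

theorem guardedRec_nil : (nil : RTerm B V).GuardedRec := by simp [GuardedRec, subterms]

theorem guardedRec_var (x : V) : (var x : RTerm B V).GuardedRec := by simp [GuardedRec, subterms]

theorem guardedRec_pref {μ : TAct B} {P : RTerm B V} :
    (pref μ P).GuardedRec ↔ P.GuardedRec := by simp [GuardedRec, subterms]

theorem guardedRec_read {μ : TAct B} {P : RTerm B V} :
    (read μ P).GuardedRec ↔ P.GuardedRec := by simp [GuardedRec, subterms]

theorem guardedRec_rel {Φ : Relabelling B} {P : RTerm B V} :
    (rel P Φ).GuardedRec ↔ P.GuardedRec := by simp [GuardedRec, subterms]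

theorem guardedRec_sum {P Q : RTerm B V} :
    (sum P Q).GuardedRec ↔ P.GuardedRec ∧ Q.GuardedRec := by
  simp [GuardedRec, subterms, or_imp, forall_and]

theorem guardedRec_par {A : Set B} {P Q : RTerm B V} :
    (par A P Q).GuardedRec ↔ P.GuardedRec ∧ Q.GuardedRec := by
  simp [GuardedRec, subterms, or_imp, forall_and]

theorem guardedRec_fix {x : V} {Q : RTerm B V} :
    (fix x Q).GuardedRec ↔ Q.Guarded x ∧ Q.GuardedRec := by
  simp [GuardedRec, subterms, or_imp, forall_and]

theorem rnf_nil : (nil : RTerm B V).RNF := by simp [RNF, RecProper, RaProper, subterms]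

theorem rnf_var (x : V) : (var x : RTerm B V).RNF := by simp [RNF, RecProper, RaProper, subterms]

theorem rnf_pref {μ : TAct B} {P : RTerm B V} : (pref μ P).RNF ↔ P.RNF := by
  simp [RNF, RecProper, RaProper, subterms]

theorem rnf_rel {Φ : Relabelling B} {P : RTerm B V} : (rel P Φ).RNF ↔ P.RNF := by
  simp [RNF, RecProper, RaProper, subterms]

theorem rnf_read {μ : TAct B} {P : RTerm B V} :
    (read μ P).RNF ↔ (P.ReadGuarded ∨ ∃ ν Q, P = read ν Q) ∧ P.RNF := by
  simp [RNF, RecProper, RaProper, subterms, or_imp, forall_and]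
  tauto

theorem rnf_sum {P Q : RTerm B V} :
    (sum P Q).RNF ↔ (P.ReadGuarded ∧ Q.ReadGuarded) ∧ P.RNF ∧ Q.RNF := by
  simp [RNF, RecProper, RaProper, subterms, or_imp, forall_and, ReadGuarded]
  tauto

theorem rnf_par {A : Set B} {P Q : RTerm B V} : (par A P Q).RNF ↔ P.RNF ∧ Q.RNF := by
  simp [RNF, RecProper, RaProper, subterms, or_imp, forall_and, ReadGuarded]
  tauto

theorem rnf_fix {x : V} {Q : RTerm B V} :
    (fix x Q).RNF ↔ (Q.ReadGuarded ∨ Q.XProper x) ∧ Q.RNF := by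
  simp [RNF, RecProper, RaProper, subterms, or_imp, forall_and]
  tauto

theorem mem_subterms_self (Q : RTerm B V) : Q ∈ Q.subterms := by
  cases Q <;> simp [subterms]

theorem IsInitial.isTerm {Q : RTerm B V} (h : Q.IsInitial) : Q.IsTerm := by
  induction Q <;> simp_all [IsInitial, IsTerm]

theorem guarded_of_notMem_freeVars {x : V} {Q : RTerm B V} (h : x ∉ Q.freeVars) :
    Q.Guarded x := by
  induction Q <;> simp_all [freeVars, Guarded]
  · exact fun h' => h h'.symm
  · tauto

theorem xProper_of_notMem_freeVars {x : V} {Q : RTerm B V} (h : x ∉ Q.freeVars) :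
    Q.XProper x := by
  induction Q with
  | fix y Q ih =>
    by_cases hxy : y = x
    · exact Or.inl hxy
    · have : x ∉ Q.freeVars := fun hx => h ⟨hx, fun e => hxy e.symm⟩
      exact Or.inr ⟨guarded_of_notMem_freeVars this, ih this⟩
  | _ => simp_all [freeVars, XProper, guarded_of_notMem_freeVars]

variable [DecidableEq V]

theorem freeVars_subst (x : V) (S Q : RTerm B V) :
    (subst x S Q).freeVars ⊆ (Q.freeVars \ {x}) ∪ S.freeVars := by
  induction Q with
  | nil => simp [subst, freeVars]
  | var y =>
    by_cases h : y = x
    · simp [subst, h]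
    · simp [subst, h, freeVars]
  | fix y Q ih =>
    by_cases h : y = x
    · subst h; simp [subst, freeVars]
    · simp only [subst, h, if_false, freeVars]
      rintro z ⟨hz, hzy⟩
      rcases ih hz with h | h
      · exact Or.inl ⟨⟨h.1, hzy⟩, h.2⟩
      · exact Or.inr h
  | _ =>
    simp only [subst, freeVars]
    grind

theorem freeVars_unfold (x : V) (Q : RTerm B V) :
    (subst x (fix x Q) Q).freeVars ⊆ (fix x Q).freeVars := by
  simpa [freeVars] using freeVars_subst x (fix x Q) Q

theorem ReadStep.freeVars_subset {α : Act B} {Q Q' : RTerm B V} (h : ReadStep α Q Q') :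
    Q'.freeVars ⊆ Q.freeVars := by
  induction h with
  | fix _ ih => exact ih.trans (freeVars_unfold _ _)
  | _ => simp only [freeVars] at *; grind

theorem OrdStep.freeVars_subset {α : Act B} {Q Q' : RTerm B V} (h : OrdStep α Q Q') :
    Q'.freeVars ⊆ Q.freeVars := by
  induction h with
  | fix _ ih => exact ih.trans (freeVars_unfold _ _)
  | syncL _ _ h ih => have := h.freeVars_subset; simp only [freeVars] at *; grind
  | syncR _ h _ ih => have := h.freeVars_subset; simp only [freeVars] at *; grind
  | _ => simp only [freeVars] at *; grind

theorem TimeStep.freeVars_subset {X : Set B} {Q Q' : RTerm B V} (h : TimeStep X Q Q') :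
    Q'.freeVars ⊆ Q.freeVars := by
  induction h with
  | fix _ ih => exact ih.trans (freeVars_unfold _ _)
  | _ => simp only [freeVars] at *; grind

/-! Preservation of read normal forms -/

theorem readGuarded_subst {x : V} {S Q : RTerm B V} (hQ : Q.ReadGuarded)
    (h : S.ReadGuarded ∨ Q.Guarded x) : (subst x S Q).ReadGuarded := by
  induction Q with
  | var y => by_cases hy : y = x <;> simp_all [subst, Guarded]
  | fix y Q ih => by_cases hy : y = x <;> simp_all [subst, Guarded, ReadGuarded]
  | sum => simp only [subst, ReadGuarded, Guarded] at *; tauto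
  | par => simp only [subst, ReadGuarded, Guarded] at *; tauto
  | _ => simp_all [subst, ReadGuarded, Guarded]

theorem guarded_subst {x y : V} {S Q : RTerm B V} (hQ : Q.Guarded y) (hS : y ∉ S.freeVars) :
    (subst x S Q).Guarded y := by
  induction Q with
  | var z =>
    by_cases hz : z = x <;> simp_all [subst, guarded_of_notMem_freeVars]
  | fix z Q ih => by_cases hz : z = x <;> simp_all [subst, Guarded]; tauto
  | _ => simp_all [subst, Guarded]

theorem xProper_subst {x y : V} {S Q : RTerm B V} (hQ : Q.XProper y) (hS : y ∉ S.freeVars) :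
    (subst x S Q).XProper y := by
  induction Q with
  | var z =>
    by_cases hz : z = x <;> simp_all [subst, xProper_of_notMem_freeVars]
  | fix z Q ih =>
    by_cases hz : z = x
    · simp_all [subst, XProper]
    · simp only [subst, hz, if_false, XProper] at *
      exact hQ.imp id fun h => ⟨guarded_subst h.1 hS, ih h.2⟩
  | _ => simp_all [subst, XProper, guarded_subst]

/-- Only unguarded occurrences can spoil a read-guardedness requirement. Either the inserted term is
itself read-guarded, or x-properness guarantees that x is guarded wherever such a requirement is
imposed. Closedness of `S` keeps the properness conditions of inner recursions intact. -/
theorem rnf_subst {x : V} {S Q : RTerm B V} (hQ : Q.RNF) (hS : S.RNF) (hc : S.freeVars = ∅)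
    (h : S.ReadGuarded ∨ Q.XProper x) : (subst x S Q).RNF := by
  induction Q with
  | nil => exact rnf_nil
  | var y => by_cases hy : y = x <;> simp_all [subst]
  | pref μ P ih => rw [subst, rnf_pref]; exact ih (rnf_pref.1 hQ) h
  | read μ P ih =>
    rw [subst, rnf_read]
    rw [rnf_read] at hQ
    simp only [XProper] at h
    refine ⟨hQ.1.imp (fun hP => readGuarded_subst hP (by tauto)) ?_, ih hQ.2 (by tauto)⟩
    rintro ⟨ν, P', rfl⟩
    exact ⟨ν, _, rfl⟩
  | sum P Q ihP ihQ =>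
    rw [subst, rnf_sum]
    rw [rnf_sum] at hQ
    simp only [XProper] at h
    exact ⟨⟨readGuarded_subst hQ.1.1 (by tauto), readGuarded_subst hQ.1.2 (by tauto)⟩,
      ihP hQ.2.1 (by tauto), ihQ hQ.2.2 (by tauto)⟩
  | par A P Q ihP ihQ =>
    rw [subst, rnf_par]
    rw [rnf_par] at hQ
    simp only [XProper] at h
    exact ⟨ihP hQ.1 (by tauto), ihQ hQ.2 (by tauto)⟩
  | rel P Φ ih => rw [subst, rnf_rel]; exact ih (rnf_rel.1 hQ) h
  | fix y Q ih =>
    by_cases hy : y = x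
    · simpa [subst, hy] using hQ
    · simp only [subst, hy, if_false]
      rw [rnf_fix] at hQ ⊢
      simp only [XProper, hy, false_or] at h
      exact ⟨hQ.1.imp (fun hP => readGuarded_subst hP (by tauto))
        (fun hP => xProper_subst hP (by simp [hc])), ih hQ.2 (by tauto)⟩

/-- Rec-properness is made for this step: its two alternatives are the two alternatives of
`rnf_subst`, because a recursion is read-guarded when its body is. -/
theorem rnf_unfold {x : V} {Q : RTerm B V} (h : (fix x Q).RNF) (hc : (fix x Q).freeVars = ∅) :
    (subst x (fix x Q) Q).RNF :=
  rnf_subst (rnf_fix.1 h).2 h hc (rnf_fix.1 h).1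

theorem freeVars_unfold_eq_empty {x : V} {Q : RTerm B V} (hc : (fix x Q).freeVars = ∅) :
    (subst x (fix x Q) Q).freeVars = ∅ :=
  Set.subset_empty_iff.1 (hc ▸ freeVars_unfold x Q)

theorem ReadStep.not_readGuarded {α : Act B} {Q Q' : RTerm B V} (h : ReadStep α Q Q') :
    ¬ Q.ReadGuarded := by
  induction h with
  | fix _ ih => exact fun hQ => ih (readGuarded_subst hQ (Or.inl hQ))
  | _ => simp_all [ReadGuarded]

theorem TimeStep.readGuarded {X : Set B} {Q Q' : RTerm B V} (h : TimeStep X Q Q')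
    (hQ : Q.ReadGuarded) : Q'.ReadGuarded := by
  induction h with
  | fix _ ih => exact ih (readGuarded_subst hQ (Or.inl hQ))
  | _ => simp_all [ReadGuarded]

/-- A chain of read prefixes in normal form ends in a read-guarded term, which has no reading
transition; so the transition is due to one of the prefixes and changes nothing. -/
theorem ReadStep.eq_of_read {α : Act B} {μ : TAct B} {Q Q' : RTerm B V} (hQ : (read μ Q).RNF)
    (h : ReadStep α (read μ Q) Q') : Q' = read μ Q := by
  induction Q generalizing μ Q' with
  | read ν Q ih =>
    cases h with
    | read₁ => rfl
    | read₂ _ h => rw [ih (rnf_read.1 hQ).2 h]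
  | _ =>
    cases h with
    | read₁ => rfl
    | read₂ _ h =>
      rcases (rnf_read.1 hQ).1 with h' | ⟨_, _, h'⟩
      · exact absurd h' h.not_readGuarded
      · cases h'

theorem ReadStep.rnf {α : Act B} {Q Q' : RTerm B V} (h : ReadStep α Q Q') (hQ : Q.RNF)
    (hc : Q.freeVars = ∅) : Q'.RNF := by
  induction h with
  | read₁ => exact hQ
  | read₂ μ h => rwa [(ReadStep.read₂ μ h).eq_of_read hQ]
  | sumL _ h => exact absurd (rnf_sum.1 hQ).1.1 h.not_readGuarded
  | sumR _ h => exact absurd (rnf_sum.1 hQ).1.2 h.not_readGuarded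
  | fix _ ih => exact ih (rnf_unfold hQ hc) (freeVars_unfold_eq_empty hc)
  | _ => simp_all [rnf_par, rnf_rel, freeVars]

theorem OrdStep.rnf {α : Act B} {Q Q' : RTerm B V} (h : OrdStep α Q Q') (hQ : Q.RNF)
    (hc : Q.freeVars = ∅) : Q'.RNF := by
  induction h with
  | fix _ ih => exact ih (rnf_unfold hQ hc) (freeVars_unfold_eq_empty hc)
  | syncL _ _ h =>
    have := h.rnf (rnf_par.1 hQ).2
    simp_all [rnf_par, freeVars]
  | syncR _ h =>
    have := h.rnf (rnf_par.1 hQ).1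
    simp_all [rnf_par, freeVars]
  | _ => simp_all [rnf_par, rnf_rel, rnf_sum, rnf_read, rnf_pref, freeVars]

theorem TimeStep.exists_eq_read {X : Set B} {μ : TAct B} {Q Q' : RTerm B V}
    (h : TimeStep X (read μ Q) Q') : ∃ ν P, Q' = read ν P := by
  cases h <;> exact ⟨_, _, rfl⟩

theorem TimeStep.rnf {X : Set B} {Q Q' : RTerm B V} (h : TimeStep X Q Q') (hQ : Q.RNF)
    (hc : Q.freeVars = ∅) : Q'.RNF := by
  induction h with
  | nil => exact hQ
  | prefLazy => simpa [rnf_pref] using hQ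
  | prefUrgent => exact hQ
  | readLazy α h ih =>
    rw [rnf_read] at hQ ⊢
    refine ⟨hQ.1.imp h.readGuarded ?_, ih hQ.2 hc⟩
    rintro ⟨ν, P, rfl⟩
    exact h.exists_eq_read
  | readUrgent h _ ih =>
    rw [rnf_read] at hQ ⊢
    refine ⟨hQ.1.imp h.readGuarded ?_, ih hQ.2 hc⟩
    rintro ⟨ν, P, rfl⟩
    exact h.exists_eq_read
  | sum h₁ h₂ =>
    rw [rnf_sum] at hQ ⊢
    have := h₁.readGuarded hQ.1.1
    have := h₂.readGuarded hQ.1.2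
    simp_all [freeVars]
  | rel _ ih => exact rnf_rel.2 (ih (rnf_rel.1 hQ) hc)
  | fix _ ih => exact ih (rnf_unfold hQ hc) (freeVars_unfold_eq_empty hc)
  | par => simp_all [rnf_par, freeVars]

end RTerm
/-! Adding an action to a read set -/

/-- `M ∪ {μ}`, where an urgent action supersedes its lazy copy. -/
def insertAct (μ : TAct B) (M : Set (TAct B)) : Set (TAct B) :=
  {ν | (ν = μ ∨ ν ∈ M) ∧ ∀ α : Act B, ν = .lazy α → .urgent α ≠ μ ∧ .urgent α ∉ M}

/-- Dropping a lazy copy loses no action, since it happens only in the presence of the urgent copy.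
-/
theorem exists_act_eq_insertAct {α : Act B} {μ : TAct B} {M : Set (TAct B)} :
    (∃ ν ∈ insertAct μ M, ν.act = α) ↔ μ.act = α ∨ ∃ ν ∈ M, ν.act = α := by
  constructor
  · rintro ⟨ν, ⟨rfl | h, -⟩, rfl⟩
    · exact Or.inl rfl
    · exact Or.inr ⟨ν, h, rfl⟩
  · intro h
    by_cases hu : .urgent α = μ ∨ .urgent α ∈ M
    · exact ⟨.urgent α, ⟨hu, by simp⟩, rfl⟩
    · push Not at hu
      have : ∃ ν, (ν = μ ∨ ν ∈ M) ∧ ν.act = α := by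
        rcases h with h | ⟨ν, h, h'⟩
        · exact ⟨μ, Or.inl rfl, h⟩
        · exact ⟨ν, Or.inr h, h'⟩
      obtain ⟨ν, hν, rfl⟩ := this
      refine ⟨ν, ⟨hν, ?_⟩, rfl⟩
      rintro α rfl
      exact hu

theorem mem_urgentActs_insertAct {α : Act B} {μ : TAct B} {M : Set (TAct B)} :
    α ∈ urgentActs (insertAct μ M) ↔ .urgent α = μ ∨ α ∈ urgentActs M := by
  simp [urgentActs, insertAct]

theorem mem_makeUrgent {ν : TAct B} {M : Set (TAct B)} :
    ν ∈ makeUrgent M ↔ ∃ μ ∈ M, .urgent μ.act = ν := Iff.rfl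

/-- Merging prefixes commutes with the passage of time: once all actions are urgent, it is
irrelevant whether a superseded lazy copy was dropped before or after. -/
theorem makeUrgent_insertAct (μ : TAct B) (M : Set (TAct B)) :
    makeUrgent (insertAct μ M) = insertAct (.urgent μ.act) (makeUrgent M) := by
  ext ν
  cases ν with
  | lazy α => simp [insertAct, mem_makeUrgent]
  | urgent α =>
    have := exists_act_eq_insertAct (α := α) (μ := μ) (M := M)
    simp only [mem_makeUrgent, TAct.urgent.injEq]
    rw [this]
    simp [insertAct, mem_makeUrgent, eq_comm]

theorem IsReadSet.insertAct {μ : TAct B} {M : Set (TAct B)} (h : IsReadSet M) :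
    IsReadSet (insertAct μ M) := by
  refine ⟨(h.1.insert μ).subset fun ν hν => hν.1, ?_, ?_⟩
  · obtain ⟨ν, hν, -⟩ := (exists_act_eq_insertAct (M := M)).2 (Or.inl (rfl : μ.act = μ.act))
    exact ⟨ν, hν⟩
  · rintro α ⟨h₁, h₂⟩
    have := h₁.2 α rfl
    rcases h₂.1 with h | h
    · exact this.1 h
    · exact this.2 h

theorem isReadSet_singleton (μ : TAct B) : IsReadSet {μ} := by
  refine ⟨Set.finite_singleton μ, ⟨μ, rfl⟩, ?_⟩
  rintro α ⟨h₁, h₂⟩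
  simp only [Set.mem_singleton_iff] at h₁ h₂
  rw [← h₁] at h₂
  cases h₂

/-! ### Terms with read-set prefixes and the merging of prefixes -/

namespace STerm

variable {V : Type v}

theorem guardedRec_nil : (nil : STerm B V).GuardedRec := by simp [GuardedRec, subterms]

theorem guardedRec_var (x : V) : (var x : STerm B V).GuardedRec := by simp [GuardedRec, subterms]

theorem guardedRec_pref {μ : TAct B} {P : STerm B V} :
    (pref μ P).GuardedRec ↔ P.GuardedRec := by simp [GuardedRec, subterms]

theorem guardedRec_read {M : Set (TAct B)} {P : STerm B V} :
    (read M P).GuardedRec ↔ P.GuardedRec := by simp [GuardedRec, subterms]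

theorem guardedRec_rel {Φ : Relabelling B} {P : STerm B V} :
    (rel P Φ).GuardedRec ↔ P.GuardedRec := by simp [GuardedRec, subterms]

theorem guardedRec_sum {P Q : STerm B V} :
    (sum P Q).GuardedRec ↔ P.GuardedRec ∧ Q.GuardedRec := by
  simp [GuardedRec, subterms, or_imp, forall_and]

theorem guardedRec_par {A : Set B} {P Q : STerm B V} :
    (par A P Q).GuardedRec ↔ P.GuardedRec ∧ Q.GuardedRec := by
  simp [GuardedRec, subterms, or_imp, forall_and]

theorem guardedRec_fix {x : V} {Q : STerm B V} :
    (fix x Q).GuardedRec ↔ Q.Guarded x ∧ Q.GuardedRec := by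
  simp [GuardedRec, subterms, or_imp, forall_and]

theorem proper_nil : (nil : STerm B V).Proper := by simp [Proper, RecProper, ReadProper, subterms]

theorem proper_var (x : V) : (var x : STerm B V).Proper := by
  simp [Proper, RecProper, ReadProper, subterms]

theorem proper_pref {μ : TAct B} {P : STerm B V} : (pref μ P).Proper ↔ P.Proper := by
  simp [Proper, RecProper, ReadProper, subterms]

theorem proper_rel {Φ : Relabelling B} {P : STerm B V} : (rel P Φ).Proper ↔ P.Proper := by
  simp [Proper, RecProper, ReadProper, subterms]

theorem proper_read {M : Set (TAct B)} {P : STerm B V} :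
    (read M P).Proper ↔ P.ReadGuarded ∧ P.Proper := by
  simp [Proper, RecProper, ReadProper, subterms, or_imp, forall_and]
  tauto

theorem proper_sum {P Q : STerm B V} :
    (sum P Q).Proper ↔ (P.ReadGuarded ∧ Q.ReadGuarded) ∧ P.Proper ∧ Q.Proper := by
  simp [Proper, RecProper, ReadProper, subterms, or_imp, forall_and, ReadGuarded]
  tauto

theorem proper_par {A : Set B} {P Q : STerm B V} : (par A P Q).Proper ↔ P.Proper ∧ Q.Proper := by
  simp [Proper, RecProper, ReadProper, subterms, or_imp, forall_and, ReadGuarded]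
  tauto

theorem proper_fix {x : V} {Q : STerm B V} :
    (fix x Q).Proper ↔ (Q.ReadGuarded ∨ Q.XProper x) ∧ Q.Proper := by
  simp [Proper, RecProper, ReadProper, subterms, or_imp, forall_and]
  tauto

/-- Reading `μ` in front of a term; consecutive read prefixes are merged. -/
def addRead (μ : TAct B) : STerm B V → STerm B V
  | read M Q => read (insertAct μ M) Q
  | Q => read {μ} Q

theorem addRead_of_readGuarded (μ : TAct B) {Q : STerm B V} (h : Q.ReadGuarded) :
    addRead μ Q = read {μ} Q := by
  cases Q <;> first | rfl | exact h.elim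

theorem exists_addRead_eq (μ : TAct B) (Q : STerm B V) : ∃ M R, addRead μ Q = read M R := by
  cases Q <;> exact ⟨_, _, rfl⟩

/-- Reduces the case distinction on the head of `Q` to two cases. The second is required for every
`Q`, which costs nothing in the applications. -/
theorem addRead_ind {p : STerm B V → Prop} (μ : TAct B) (Q : STerm B V)
    (h₁ : ∀ M R, Q = read M R → p (read (insertAct μ M) R)) (h₂ : p (read {μ} Q)) :
    p (addRead μ Q) := by
  cases Q with
  | read M R => exact h₁ M R rfl
  | _ => exact h₂

end STerm

open STerm in
/-- The translation of read normal forms into terms with read-set prefixes. -/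
def RTerm.toSTerm {V : Type v} : RTerm B V → STerm B V
  | .nil => .nil
  | .var x => .var x
  | .pref μ P => .pref μ P.toSTerm
  | .read μ Q => addRead μ Q.toSTerm
  | .sum Q₁ Q₂ => .sum Q₁.toSTerm Q₂.toSTerm
  | .par A Q₁ Q₂ => .par A Q₁.toSTerm Q₂.toSTerm
  | .rel Q Φ => .rel Q.toSTerm Φ
  | .fix x Q => .fix x Q.toSTerm

/-! ### The translation preserves well-formedness and normal forms -/

namespace RTerm

variable {V : Type v}

theorem freeVars_toSTerm (Q : RTerm B V) : Q.toSTerm.freeVars = Q.freeVars := by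
  induction Q with
  | read μ Q ih =>
    refine STerm.addRead_ind (p := fun R => R.freeVars = Q.freeVars) μ _ (fun M R h => ?_) ih
    rw [h] at ih; exact ih
  | _ => simp_all [toSTerm, STerm.freeVars, freeVars]

theorem guarded_toSTerm {x : V} {Q : RTerm B V} : Q.toSTerm.Guarded x ↔ Q.Guarded x := by
  induction Q with
  | read μ Q ih =>
    refine STerm.addRead_ind (p := fun R => R.Guarded x ↔ Q.Guarded x) μ _ (fun M R h => ?_) ih
    rw [h] at ih; exact ih
  | _ => simp_all [toSTerm, STerm.Guarded, Guarded]

theorem xProper_toSTerm {x : V} {Q : RTerm B V} (h : Q.XProper x) : Q.toSTerm.XProper x := by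
  induction Q with
  | read μ Q ih =>
    have hg := guarded_toSTerm.2 h.1
    have ih := ih h.2
    refine STerm.addRead_ind (p := fun R => R.XProper x) μ _ (fun M R h => ?_) ⟨hg, ih⟩
    rw [h] at ih; exact ih
  | _ => simp_all [toSTerm, STerm.XProper, XProper, guarded_toSTerm]; try tauto

theorem readGuarded_toSTerm {Q : RTerm B V} : Q.toSTerm.ReadGuarded ↔ Q.ReadGuarded := by
  induction Q with
  | read μ Q ih =>
    exact STerm.addRead_ind (p := fun R => R.ReadGuarded ↔ False) μ _ (fun M R h => Iff.rfl) Iff.rfl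
  | _ => simp_all [toSTerm, STerm.ReadGuarded, ReadGuarded]

theorem guardedRec_toSTerm {Q : RTerm B V} (h : Q.GuardedRec) : Q.toSTerm.GuardedRec := by
  induction Q with
  | nil => exact STerm.guardedRec_nil
  | var x => exact STerm.guardedRec_var x
  | pref μ Q ih => exact STerm.guardedRec_pref.2 (ih (guardedRec_pref.1 h))
  | read μ Q ih =>
    have ih := ih (guardedRec_read.1 h)
    refine STerm.addRead_ind (p := fun R => R.GuardedRec) μ _ (fun M R h => ?_)
      (STerm.guardedRec_read.2 ih)
    rw [h, STerm.guardedRec_read] at ih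
    exact STerm.guardedRec_read.2 ih
  | sum P Q ihP ihQ =>
    rw [guardedRec_sum] at h
    exact STerm.guardedRec_sum.2 ⟨ihP h.1, ihQ h.2⟩
  | par A P Q ihP ihQ =>
    rw [guardedRec_par] at h
    exact STerm.guardedRec_par.2 ⟨ihP h.1, ihQ h.2⟩
  | rel Q Φ ih => exact STerm.guardedRec_rel.2 (ih (guardedRec_rel.1 h))
  | fix x Q ih =>
    rw [guardedRec_fix] at h
    exact STerm.guardedRec_fix.2 ⟨guarded_toSTerm.2 h.1, ih h.2⟩

theorem isInitial_toSTerm {Q : RTerm B V} (h : Q.IsInitial) : Q.toSTerm.IsInitial := by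
  induction Q with
  | read μ Q ih =>
    have ih := ih h.2
    refine STerm.addRead_ind (p := fun R => R.IsInitial) μ _ (fun M R h' => ?_)
      ⟨⟨isReadSet_singleton μ, ?_⟩, ih⟩
    · rw [h'] at ih
      refine ⟨⟨ih.1.1.insertAct, ?_⟩, ih.2⟩
      rintro ν ⟨rfl | hν, -⟩
      · exact h.1
      · exact ih.1.2 ν hν
    · rintro ν rfl
      exact h.1
  | _ => simp_all [toSTerm, STerm.IsInitial, IsInitial]

theorem isTerm_toSTerm {Q : RTerm B V} (h : Q.IsTerm) : Q.toSTerm.IsTerm := by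
  induction Q with
  | read μ Q ih =>
    have ih := ih h
    refine STerm.addRead_ind (p := fun R => R.IsTerm) μ _ (fun M R h' => ?_)
      ⟨isReadSet_singleton μ, ih⟩
    rw [h'] at ih
    exact ⟨ih.1.insertAct, ih.2⟩
  | pref μ P => exact isInitial_toSTerm (Q := P) h
  | _ => simp_all [toSTerm, STerm.IsTerm, IsTerm]

theorem proper_toSTerm {Q : RTerm B V} (h : Q.RNF) : Q.toSTerm.Proper := by
  induction Q with
  | nil => exact STerm.proper_nil
  | var x => exact STerm.proper_var x
  | pref μ Q ih => exact STerm.proper_pref.2 (ih (rnf_pref.1 h))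
  | read μ Q ih =>
    rw [rnf_read] at h
    have ih := ih h.2
    rcases h.1 with h | ⟨ν, P, rfl⟩
    · rw [toSTerm, STerm.addRead_of_readGuarded _ (readGuarded_toSTerm.2 h)]
      exact STerm.proper_read.2 ⟨readGuarded_toSTerm.2 h, ih⟩
    -- The inner prefix already translates to a read-set prefix; the outer one only enlarges its set
    -- and leaves the read-guarded body alone.
    · rw [toSTerm] at ih ⊢
      rw [toSTerm]
      obtain ⟨M, R, hM⟩ := STerm.exists_addRead_eq ν P.toSTerm
      rw [hM] at ih ⊢
      exact STerm.proper_read.2 (STerm.proper_read.1 ih)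
  | sum P Q ihP ihQ =>
    rw [rnf_sum] at h
    exact STerm.proper_sum.2 ⟨⟨readGuarded_toSTerm.2 h.1.1, readGuarded_toSTerm.2 h.1.2⟩,
      ihP h.2.1, ihQ h.2.2⟩
  | par A P Q ihP ihQ =>
    rw [rnf_par] at h
    exact STerm.proper_par.2 ⟨ihP h.1, ihQ h.2⟩
  | rel Q Φ ih => exact STerm.proper_rel.2 (ih (rnf_rel.1 h))
  | fix x Q ih =>
    rw [rnf_fix] at h
    exact STerm.proper_fix.2 ⟨h.1.imp readGuarded_toSTerm.2 xProper_toSTerm, ih h.2⟩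

theorem isProc_toSTerm {Q : RTerm B V} (h : Q.IsProc) : Q.toSTerm.IsProc :=
  ⟨isTerm_toSTerm h.1, guardedRec_toSTerm h.2.1, by rw [freeVars_toSTerm, h.2.2]⟩

theorem toSTerm_read_ne {μ : TAct B} {Q : RTerm B V} {R : STerm B V}
    (hR : ∀ M S, R ≠ .read M S) : (read μ Q).toSTerm ≠ R := by
  obtain ⟨M, S, e⟩ := STerm.exists_addRead_eq μ Q.toSTerm
  intro h
  exact hR M S (h.symm.trans e)

/-! ### The translation preserves and reflects transitions -/

variable [DecidableEq V]

/-- Substituting a recursion is essential: `addRead` inspects the head of its argument, and a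
variable replaced by a read-prefixed term would cause a merge that was absent before the
substitution. -/
theorem toSTerm_subst (x y : V) (P Q : RTerm B V) :
    (subst x (fix y P) Q).toSTerm = STerm.subst x (fix y P).toSTerm Q.toSTerm := by
  induction Q with
  | var z => by_cases hz : z = x <;> simp [subst, STerm.subst, toSTerm, hz]
  | fix z Q ih =>
    by_cases hz : z = x
    · simp [subst, STerm.subst, toSTerm, hz]
    · simp only [subst, STerm.subst, toSTerm, hz, if_false] at *
      rw [ih]
  | read μ Q ih =>
    rw [subst, toSTerm, ih, toSTerm]
    cases hQ : Q.toSTerm with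
    | var z =>
      by_cases hz : z = x
      · simp [STerm.addRead, STerm.subst, hz, toSTerm]
      · simp [STerm.addRead, STerm.subst, hz]
    | fix z R =>
      by_cases hz : z = x
      · simp [STerm.addRead, STerm.subst, hz]
      · simp [STerm.addRead, STerm.subst, hz]
    | _ => rfl
  | _ => simp_all [subst, STerm.subst, toSTerm]

theorem toSTerm_unfold (x : V) (Q : RTerm B V) :
    (subst x (fix x Q) Q).toSTerm = STerm.subst x (STerm.fix x Q.toSTerm) Q.toSTerm :=
  toSTerm_subst x x Q Q

theorem readStep_read_self {α : Act B} {μ : TAct B} {Q : RTerm B V} :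
    ReadStep α (read μ Q) (read μ Q) ↔ μ.act = α ∨ ReadStep α Q Q := by
  constructor
  · intro h
    cases h with
    | read₁ _ h => exact Or.inl h
    | read₂ _ h => exact Or.inr h
  · rintro (h | h)
    · exact .read₁ Q h
    · exact .read₂ μ h

theorem timeStep_read {X : Set B} {μ : TAct B} {Q Q₁ : RTerm B V} :
    TimeStep X (read μ Q) Q₁ ↔
      ∃ Q', Q₁ = read (.urgent μ.act) Q' ∧ TimeStep X Q Q' ∧
        ∀ α, μ = .urgent α → α ∉ withTau X := by
  constructor
  · intro h
    cases h with
    | readLazy α h => exact ⟨_, rfl, h, by simp⟩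
    | readUrgent h h' => exact ⟨_, rfl, h, by simpa using h'⟩
  · rintro ⟨Q', rfl, h, hμ⟩
    cases μ with
    | lazy α => exact .readLazy α h
    | urgent α => exact .readUrgent h (hμ α rfl)

/-- Here `Q` is a chain of read prefixes and `Q₀` the term below the last of them. The set `M`
collects the actions of the chain, so it governs the reading loops of `Q` and the refusals of the
chain; `Q₀` supplies the ordinary transitions. -/
theorem exists_of_toSTerm_eq_read {Q : RTerm B V} (hQ : Q.RNF) {M : Set (TAct B)}
    {R : STerm B V} (h : Q.toSTerm = .read M R) :
    ∃ Q₀, Q₀.toSTerm = R ∧ Q₀.RNF ∧ Q₀.freeVars = Q.freeVars ∧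
      (∀ α, ReadStep α Q Q ↔ ∃ ν ∈ M, ν.act = α) ∧
      (∀ α Q', OrdStep α Q₀ Q' → OrdStep α Q Q') ∧ Q₀.ReadGuarded ∧
      ∀ X Q₀', TimeStep X Q₀ Q₀' → urgentActs M ∩ withTau X = ∅ →
        ∃ Q', TimeStep X Q Q' ∧ Q'.toSTerm = .read (makeUrgent M) Q₀'.toSTerm := by
  induction Q generalizing M R with
  | read μ P ih =>
    have hself := fun α => readStep_read_self (α := α) (μ := μ) (Q := P)
    obtain ⟨h₁, h₂⟩ := rnf_read.1 hQ
    -- Either this prefix is the last of its chain, or the body is again read-prefixed and the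
    -- induction hypothesis describes the rest of the chain.
    by_cases hP : P.ReadGuarded
    · rw [toSTerm, STerm.addRead_of_readGuarded _ (readGuarded_toSTerm.2 hP)] at h
      cases h
      refine ⟨P, rfl, h₂, rfl, fun α => ?_, fun α Q' h => .read μ h, hP, ?_⟩
      · rw [hself]
        simp only [Set.mem_singleton_iff, exists_eq_left, or_iff_left_iff_imp]
        exact fun h => absurd hP h.not_readGuarded
      · intro X P' hP' hX
        refine ⟨_, timeStep_read.2 ⟨P', rfl, hP', ?_⟩, ?_⟩
        · rintro α rfl hα
          have : α ∈ urgentActs ({.urgent α} : Set (TAct B)) ∩ withTau X := ⟨rfl, hα⟩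
          simp [hX] at this
        · rw [toSTerm, STerm.addRead_of_readGuarded _
            (readGuarded_toSTerm.2 (hP'.readGuarded hP))]
          simp [makeUrgent]
    · obtain ⟨ν, P₁, hP₁⟩ := h₁.resolve_left hP
      obtain ⟨N, R', hN⟩ : ∃ N R', P.toSTerm = .read N R' := by
        rw [hP₁, toSTerm]
        exact STerm.exists_addRead_eq _ _
      obtain ⟨Q₀, e, hr, hf, hrd, ho, hg, ht⟩ := ih h₂ hN
      rw [toSTerm, hN, STerm.addRead] at h
      cases h
      refine ⟨Q₀, e, hr, hf, fun α => ?_, fun α Q' h => .read μ (ho α Q' h), hg, ?_⟩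
      · rw [hself, hrd, exists_act_eq_insertAct]
      · intro X Q₀' hQ₀ hX
        have hX' : ∀ α, α ∈ withTau X → ¬ (.urgent α = μ ∨ α ∈ urgentActs N) := by
          intro α hα h
          have : α ∈ urgentActs (insertAct μ N) ∩ withTau X :=
            ⟨mem_urgentActs_insertAct.2 h, hα⟩
          simp [hX] at this
        obtain ⟨P', hP', e'⟩ := ht X Q₀' hQ₀ (by
          ext α
          simp only [Set.mem_inter_iff, Set.mem_empty_iff_false, iff_false, not_and]
          exact fun h hα => hX' α hα (Or.inr h))
        refine ⟨_, timeStep_read.2 ⟨P', rfl, hP', ?_⟩, ?_⟩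
        · rintro α rfl hα
          exact hX' α hα (Or.inl rfl)
        · rw [toSTerm, e', STerm.addRead, makeUrgent_insertAct]
  | _ => cases h

theorem step_toSTerm_of_readStep_self {α : Act B} {Q : RTerm B V} {μ : TAct B}
    (hQ : (read μ Q).RNF) (h : ReadStep α (read μ Q) (read μ Q)) :
    STerm.Step α (read μ Q).toSTerm (read μ Q).toSTerm := by
  obtain ⟨M, R, e⟩ := STerm.exists_addRead_eq μ Q.toSTerm
  have e : (read μ Q).toSTerm = .read M R := e
  obtain ⟨Q₀, -, -, -, hr, -⟩ := exists_of_toSTerm_eq_read hQ e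
  obtain ⟨ν, hν, hα⟩ := (hr α).1 h
  rw [e]
  exact .read₁ R hν hα

theorem ReadStep.toSTerm {α : Act B} {Q Q' : RTerm B V} (h : ReadStep α Q Q') (hQ : Q.RNF)
    (hc : Q.freeVars = ∅) : STerm.Step α Q.toSTerm Q'.toSTerm := by
  induction h with
  | read₁ Q h => exact step_toSTerm_of_readStep_self hQ (.read₁ Q h)
  | read₂ μ h =>
    have h := ReadStep.read₂ μ h
    obtain e := h.eq_of_read hQ
    rw [e] at h ⊢
    exact step_toSTerm_of_readStep_self hQ h
  | sumL _ h => exact absurd (rnf_sum.1 hQ).1.1 h.not_readGuarded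
  | sumR _ h => exact absurd (rnf_sum.1 hQ).1.2 h.not_readGuarded
  | parL _ hα _ ih =>
    simp only [freeVars, Set.union_empty_iff] at hc
    exact .parL _ hα (ih (rnf_par.1 hQ).1 hc.1)
  | parR _ hα _ ih =>
    simp only [freeVars, Set.union_empty_iff] at hc
    exact .parR _ hα (ih (rnf_par.1 hQ).2 hc.2)
  | sync hα _ _ ih₁ ih₂ =>
    simp only [freeVars, Set.union_empty_iff] at hc
    exact .sync hα (ih₁ (rnf_par.1 hQ).1 hc.1) (ih₂ (rnf_par.1 hQ).2 hc.2)
  | rel _ hα ih => exact .rel (ih (rnf_rel.1 hQ) hc) hα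
  | fix _ ih =>
    have := ih (rnf_unfold hQ hc) (freeVars_unfold_eq_empty hc)
    rw [toSTerm_unfold] at this
    exact .fix this

/-- The second conjunct strengthens the induction. Below a further read prefix the translation is
merged, and the transition is then needed from the body of the read set rather than from the whole
translated term. -/
theorem OrdStep.toSTerm_aux {α : Act B} {Q Q' : RTerm B V} (h : OrdStep α Q Q') (hQ : Q.RNF)
    (hc : Q.freeVars = ∅) : STerm.Step α Q.toSTerm Q'.toSTerm ∧
      ∀ M R, Q.toSTerm = .read M R → STerm.Step α R Q'.toSTerm := by
  induction h with
  | pref P h => exact ⟨.pref _ h, fun _ _ h => by cases h⟩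
  | @read α μ Q Q' _ ih =>
    obtain ⟨h₁, h₂⟩ := ih (rnf_read.1 hQ).2 hc
    refine STerm.addRead_ind (p := fun S => STerm.Step α S Q'.toSTerm ∧
      ∀ M R, S = .read M R → STerm.Step α R Q'.toSTerm) μ _ ?_ ?_
    · intro M R h
      refine ⟨.read₂ _ (h₂ M R h), ?_⟩
      rintro _ _ ⟨⟩
      exact h₂ M R h
    · refine ⟨.read₂ _ h₁, ?_⟩
      rintro _ _ ⟨⟩
      exact h₁
  | sumL _ _ ih =>
    simp only [freeVars, Set.union_empty_iff] at hc
    exact ⟨.sumL _ (ih (rnf_sum.1 hQ).2.1 hc.1).1, fun _ _ h => by cases h⟩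
  | sumR _ _ ih =>
    simp only [freeVars, Set.union_empty_iff] at hc
    exact ⟨.sumR _ (ih (rnf_sum.1 hQ).2.2 hc.2).1, fun _ _ h => by cases h⟩
  | parL _ hα _ ih =>
    simp only [freeVars, Set.union_empty_iff] at hc
    exact ⟨.parL _ hα (ih (rnf_par.1 hQ).1 hc.1).1, fun _ _ h => by cases h⟩
  | parR _ hα _ ih =>
    simp only [freeVars, Set.union_empty_iff] at hc
    exact ⟨.parR _ hα (ih (rnf_par.1 hQ).2 hc.2).1, fun _ _ h => by cases h⟩
  | sync hα _ _ ih₁ ih₂ =>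
    simp only [freeVars, Set.union_empty_iff] at hc
    exact ⟨.sync hα (ih₁ (rnf_par.1 hQ).1 hc.1).1 (ih₂ (rnf_par.1 hQ).2 hc.2).1,
      fun _ _ h => by cases h⟩
  | syncL hα _ h₂ ih₁ =>
    simp only [freeVars, Set.union_empty_iff] at hc
    exact ⟨.sync hα (ih₁ (rnf_par.1 hQ).1 hc.1).1 (h₂.toSTerm (rnf_par.1 hQ).2 hc.2),
      fun _ _ h => by cases h⟩
  | syncR hα h₁ _ ih₂ =>
    simp only [freeVars, Set.union_empty_iff] at hc
    exact ⟨.sync hα (h₁.toSTerm (rnf_par.1 hQ).1 hc.1) (ih₂ (rnf_par.1 hQ).2 hc.2).1,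
      fun _ _ h => by cases h⟩
  | rel _ hα ih => exact ⟨.rel (ih (rnf_rel.1 hQ) hc).1 hα, fun _ _ h => by cases h⟩
  | fix _ ih =>
    have := (ih (rnf_unfold hQ hc) (freeVars_unfold_eq_empty hc)).1
    rw [toSTerm_unfold] at this
    exact ⟨.fix this, fun _ _ h => by cases h⟩

theorem Step.toSTerm {α : Act B} {Q Q' : RTerm B V} (h : Step α Q Q') (hQ : Q.RNF)
    (hc : Q.freeVars = ∅) : STerm.Step α Q.toSTerm Q'.toSTerm :=
  h.elim (fun h => (h.toSTerm_aux hQ hc).1) fun h => h.toSTerm hQ hc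

theorem TimeStep.toSTerm_read {X : Set B} {μ : TAct B} {Q Q' : RTerm B V}
    (h : TimeStep X Q Q') (ih : STerm.TimeStep X Q.toSTerm Q'.toSTerm) (hQ : (read μ Q).RNF)
    (hμ : ∀ α, μ = .urgent α → α ∉ withTau X) :
    STerm.TimeStep X (read μ Q).toSTerm (read (.urgent μ.act) Q').toSTerm := by
  by_cases hP : Q.ReadGuarded
  · rw [toSTerm, toSTerm, STerm.addRead_of_readGuarded _ (readGuarded_toSTerm.2 hP),
      STerm.addRead_of_readGuarded _ (readGuarded_toSTerm.2 (h.readGuarded hP))]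
    have : ({.urgent μ.act} : Set (TAct B)) = makeUrgent {μ} := by simp [makeUrgent]
    rw [this]
    refine .read ih ?_
    ext α
    simp only [Set.mem_inter_iff, Set.mem_empty_iff_false, iff_false, not_and]
    exact fun h => hμ α (Eq.symm h)
  · obtain ⟨ν, P, rfl⟩ := (rnf_read.1 hQ).1.resolve_left hP
    obtain ⟨M, R, e⟩ := STerm.exists_addRead_eq ν P.toSTerm
    have e : (read ν P).toSTerm = .read M R := e
    rw [e] at ih
    rw [toSTerm, e, toSTerm]
    generalize Q'.toSTerm = S at ih
    cases ih with
    | read ih hX =>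
      rw [STerm.addRead, STerm.addRead, ← makeUrgent_insertAct]
      refine .read ih ?_
      ext α
      simp only [Set.mem_inter_iff, Set.mem_empty_iff_false, iff_false, not_and]
      intro h hα
      rcases mem_urgentActs_insertAct.1 h with h | h
      · exact hμ α h.symm hα
      · have : α ∈ urgentActs M ∩ withTau X := ⟨h, hα⟩
        simp [hX] at this

theorem TimeStep.toSTerm {X : Set B} {Q Q' : RTerm B V} (h : TimeStep X Q Q') (hQ : Q.RNF)
    (hc : Q.freeVars = ∅) : STerm.TimeStep X Q.toSTerm Q'.toSTerm := by
  induction h with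
  | nil => exact .nil _
  | prefLazy => exact .prefLazy _ _ _
  | prefUrgent _ h => exact .prefUrgent _ h
  | readLazy α h ih => exact h.toSTerm_read (ih (rnf_read.1 hQ).2 hc) hQ (by simp)
  | readUrgent h hα ih => exact h.toSTerm_read (ih (rnf_read.1 hQ).2 hc) hQ (by simpa using hα)
  | sum _ _ ih₁ ih₂ =>
    simp only [freeVars, Set.union_empty_iff] at hc
    exact .sum (ih₁ (rnf_sum.1 hQ).2.1 hc.1) (ih₂ (rnf_sum.1 hQ).2.2 hc.2)
  | rel _ ih => exact .rel (ih (rnf_rel.1 hQ) hc)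
  | fix _ ih =>
    have := ih (rnf_unfold hQ hc) (freeVars_unfold_eq_empty hc)
    rw [toSTerm_unfold] at this
    exact .fix this
  | par _ _ hX ih₁ ih₂ =>
    simp only [freeVars, Set.union_empty_iff] at hc
    exact .par (ih₁ (rnf_par.1 hQ).1 hc.1) (ih₂ (rnf_par.1 hQ).2 hc.2) hX

/-- The translation keeps the head operator, so its transitions can be read backwards operator by
operator; a read set is the only place where several prefixes have been collapsed. -/
theorem exists_step_of_toSTerm {α : Act B} {R R' : STerm B V} (h : STerm.Step α R R')
    {Q : RTerm B V} (e : Q.toSTerm = R) (hQ : Q.RNF) (hc : Q.freeVars = ∅) :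
    ∃ Q', Step α Q Q' ∧ Q'.toSTerm = R' := by
  induction h generalizing Q with
  | pref P h =>
    cases Q <;> try cases e
    case read => exact absurd e (toSTerm_read_ne (by simp))
    case pref.refl => exact ⟨_, Or.inl (.pref _ h), rfl⟩
  | read₁ R hν hα =>
    obtain ⟨Q₀, -, -, -, hr, -⟩ := exists_of_toSTerm_eq_read hQ e
    exact ⟨Q, Or.inr ((hr _).2 ⟨_, hν, hα⟩), e⟩
  | read₂ M _ ih =>
    obtain ⟨Q₀, e₀, hr, hf, -, ho, hg, -⟩ := exists_of_toSTerm_eq_read hQ e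
    obtain ⟨Q', h, e'⟩ := ih e₀ hr (hf.trans hc)
    -- The term below the chain is read-guarded, so its transition is ordinary and discards the
    -- entire chain.
    exact ⟨Q', Or.inl (ho _ _ (h.resolve_right fun h => h.not_readGuarded hg)), e'⟩
  | sumL _ _ ih =>
    cases Q <;> try cases e
    case read => exact absurd e (toSTerm_read_ne (by simp))
    case sum.refl =>
      simp only [freeVars, Set.union_empty_iff] at hc
      rw [rnf_sum] at hQ
      obtain ⟨P', h, e'⟩ := ih rfl hQ.2.1 hc.1
      exact ⟨P', Or.inl (.sumL _ (h.resolve_right fun h => h.not_readGuarded hQ.1.1)), e'⟩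
  | sumR _ _ ih =>
    cases Q <;> try cases e
    case read => exact absurd e (toSTerm_read_ne (by simp))
    case sum.refl =>
      simp only [freeVars, Set.union_empty_iff] at hc
      rw [rnf_sum] at hQ
      obtain ⟨Q', h, e'⟩ := ih rfl hQ.2.2 hc.2
      exact ⟨Q', Or.inl (.sumR _ (h.resolve_right fun h => h.not_readGuarded hQ.1.2)), e'⟩
  | parL _ hα _ ih =>
    cases Q <;> try cases e
    case read => exact absurd e (toSTerm_read_ne (by simp))
    case par.refl =>
      simp only [freeVars, Set.union_empty_iff] at hc
      obtain ⟨P', h, rfl⟩ := ih rfl (rnf_par.1 hQ).1 hc.1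
      exact ⟨_, h.imp (.parL _ hα) (.parL _ hα), rfl⟩
  | parR _ hα _ ih =>
    cases Q <;> try cases e
    case read => exact absurd e (toSTerm_read_ne (by simp))
    case par.refl =>
      simp only [freeVars, Set.union_empty_iff] at hc
      obtain ⟨P', h, rfl⟩ := ih rfl (rnf_par.1 hQ).2 hc.2
      exact ⟨_, h.imp (.parR _ hα) (.parR _ hα), rfl⟩
  | sync hα _ _ ih₁ ih₂ =>
    cases Q <;> try cases e
    case read => exact absurd e (toSTerm_read_ne (by simp))
    case par.refl =>
      simp only [freeVars, Set.union_empty_iff] at hc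
      obtain ⟨P', h₁, rfl⟩ := ih₁ rfl (rnf_par.1 hQ).1 hc.1
      obtain ⟨Q', h₂, rfl⟩ := ih₂ rfl (rnf_par.1 hQ).2 hc.2
      refine ⟨par _ P' Q', ?_, rfl⟩
      rcases h₁ with h₁ | h₁ <;> rcases h₂ with h₂ | h₂
      · exact Or.inl (.sync hα h₁ h₂)
      · exact Or.inl (.syncL hα h₁ h₂)
      · exact Or.inl (.syncR hα h₁ h₂)
      · exact Or.inr (.sync hα h₁ h₂)
  | rel _ hα ih =>
    cases Q <;> try cases e
    case read => exact absurd e (toSTerm_read_ne (by simp))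
    case rel.refl =>
      obtain ⟨Q', h, rfl⟩ := ih rfl (rnf_rel.1 hQ) hc
      exact ⟨_, h.imp (.rel · hα) (.rel · hα), rfl⟩
  | fix _ ih =>
    cases Q <;> try cases e
    case read => exact absurd e (toSTerm_read_ne (by simp))
    case fix.refl =>
      obtain ⟨Q', h, rfl⟩ := ih (toSTerm_unfold _ _) (rnf_unfold hQ hc)
        (freeVars_unfold_eq_empty hc)
      exact ⟨_, h.imp .fix .fix, rfl⟩

theorem exists_timeStep_of_toSTerm {X : Set B} {R R' : STerm B V} (h : STerm.TimeStep X R R')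
    {Q : RTerm B V} (e : Q.toSTerm = R) (hQ : Q.RNF) (hc : Q.freeVars = ∅) :
    ∃ Q', TimeStep X Q Q' ∧ Q'.toSTerm = R' := by
  induction h generalizing Q with
  | nil X =>
    cases Q <;> try cases e
    case read => exact absurd e (toSTerm_read_ne (by simp))
    case nil.refl => exact ⟨_, .nil X, rfl⟩
  | prefLazy X α P =>
    cases Q <;> try cases e
    case read => exact absurd e (toSTerm_read_ne (by simp))
    case pref.refl => exact ⟨_, .prefLazy X α _, rfl⟩
  | prefUrgent _ h =>
    cases Q <;> try cases e
    case read => exact absurd e (toSTerm_read_ne (by simp))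
    case pref.refl => exact ⟨_, .prefUrgent _ h, rfl⟩
  | read _ hX ih =>
    obtain ⟨Q₀, e₀, hr, hf, -, -, -, ht⟩ := exists_of_toSTerm_eq_read hQ e
    obtain ⟨Q', h, rfl⟩ := ih e₀ hr (hf.trans hc)
    exact ht _ _ h hX
  | sum _ _ ih₁ ih₂ =>
    cases Q <;> try cases e
    case read => exact absurd e (toSTerm_read_ne (by simp))
    case sum.refl =>
      simp only [freeVars, Set.union_empty_iff] at hc
      obtain ⟨P', h₁, rfl⟩ := ih₁ rfl (rnf_sum.1 hQ).2.1 hc.1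
      obtain ⟨Q', h₂, rfl⟩ := ih₂ rfl (rnf_sum.1 hQ).2.2 hc.2
      exact ⟨_, .sum h₁ h₂, rfl⟩
  | rel _ ih =>
    cases Q <;> try cases e
    case read => exact absurd e (toSTerm_read_ne (by simp))
    case rel.refl =>
      obtain ⟨Q', h, rfl⟩ := ih rfl (rnf_rel.1 hQ) hc
      exact ⟨_, .rel h, rfl⟩
  | fix _ ih =>
    cases Q <;> try cases e
    case read => exact absurd e (toSTerm_read_ne (by simp))
    case fix.refl =>
      obtain ⟨Q', h, rfl⟩ := ih (toSTerm_unfold _ _) (rnf_unfold hQ hc)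
        (freeVars_unfold_eq_empty hc)
      exact ⟨_, .fix h, rfl⟩
  | par _ _ hX ih₁ ih₂ =>
    cases Q <;> try cases e
    case read => exact absurd e (toSTerm_read_ne (by simp))
    case par.refl =>
      simp only [freeVars, Set.union_empty_iff] at hc
      obtain ⟨P', h₁, rfl⟩ := ih₁ rfl (rnf_par.1 hQ).1 hc.1
      obtain ⟨Q', h₂, rfl⟩ := ih₂ rfl (rnf_par.1 hQ).2 hc.2
      exact ⟨_, .par h₁ h₂ hX, rfl⟩

theorem OrdStep.freeVars_eq_empty {α : Act B} {Q Q' : RTerm B V} (h : OrdStep α Q Q')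
    (hc : Q.freeVars = ∅) : Q'.freeVars = ∅ :=
  Set.subset_empty_iff.1 (hc ▸ h.freeVars_subset)

theorem ReadStep.freeVars_eq_empty {α : Act B} {Q Q' : RTerm B V} (h : ReadStep α Q Q')
    (hc : Q.freeVars = ∅) : Q'.freeVars = ∅ :=
  Set.subset_empty_iff.1 (hc ▸ h.freeVars_subset)

theorem TimeStep.freeVars_eq_empty {X : Set B} {Q Q' : RTerm B V} (h : TimeStep X Q Q')
    (hc : Q.freeVars = ∅) : Q'.freeVars = ∅ :=
  Set.subset_empty_iff.1 (hc ▸ h.freeVars_subset)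

/-- A closed term in read normal form is timed bisimilar to its translation. -/
theorem isTimedBisimulation_toSTerm (B : Type u) (V : Type v) [DecidableEq V] :
    IsTimedBisimulation (lts B V) (STerm.lts B V)
      fun Q R => Q.RNF ∧ Q.freeVars = ∅ ∧ Q.toSTerm = R := by
  have hact : ∀ {α : Act B} {Q Q' : RTerm B V}, Step α Q Q' → Q.RNF → Q.freeVars = ∅ →
      Q'.RNF ∧ Q'.freeVars = ∅ := fun h hQ hc =>
    h.elim (fun h => ⟨h.rnf hQ hc, h.freeVars_eq_empty hc⟩)
      fun h => ⟨h.rnf hQ hc, h.freeVars_eq_empty hc⟩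
  constructor
  · rintro Q _ ⟨hQ, hc, rfl⟩ α Q' h
    exact ⟨_, Step.toSTerm h hQ hc, (hact h hQ hc).1, (hact h hQ hc).2, rfl⟩
  · rintro Q _ ⟨hQ, hc, rfl⟩ α R' h
    obtain ⟨Q', h, e⟩ := exists_step_of_toSTerm h rfl hQ hc
    exact ⟨Q', h, (hact h hQ hc).1, (hact h hQ hc).2, e⟩
  · rintro Q _ ⟨hQ, hc, rfl⟩ X Q' h
    exact ⟨_, TimeStep.toSTerm h hQ hc, TimeStep.rnf h hQ hc,
      TimeStep.freeVars_eq_empty h hc, rfl⟩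
  · rintro Q _ ⟨hQ, hc, rfl⟩ X R' h
    obtain ⟨Q', h, e⟩ := exists_timeStep_of_toSTerm h rfl hQ hc
    exact ⟨Q', h, h.rnf hQ hc, h.freeVars_eq_empty hc, e⟩

end RTerm
/-! Visible actions and refusal sets -/

theorem some_mem_visible {a : B} {X : Set B} : some a ∈ visible X ↔ a ∈ X := by
  simp [visible]

theorem none_notMem_visible {X : Set B} : (none : Act B) ∉ visible X := by
  simp [visible]

theorem some_mem_withTau {a : B} {X : Set B} : some a ∈ withTau X ↔ a ∈ X := by
  simp [withTau, visible]

theorem none_mem_withTau {X : Set B} : (none : Act B) ∈ withTau X := by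
  simp [withTau]

theorem withTau_mono {X Y : Set B} (h : X ⊆ Y) : withTau X ⊆ withTau Y := by
  rintro (_ | a) ha
  · exact none_mem_withTau
  · exact some_mem_withTau.2 (h (some_mem_withTau.1 ha))

theorem Relabelling.mem_refusal {Φ : Relabelling B} {X : Set B} {a : B} :
    a ∈ Φ.refusal X ↔ Φ.toFun (some a) ∈ withTau X := Iff.rfl

open Classical in
/-- The relabelling function `Φ`, except that `c` is left unchanged. -/
noncomputable def Relabelling.keep (Φ : Relabelling B) (c : B) : Relabelling B where
  toFun := Function.update Φ.toFun (some c) (some c)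
  map_tau := by simp [Φ.map_tau]
  finite_base := by
    -- Away from c the preimage of an action can change only by losing c, so an action other than c
    -- in the new exceptional set was already in the old one.
    refine (Φ.finite_base.insert (some c)).subset ?_
    rintro α ⟨⟨β, hβ⟩, hα⟩
    by_cases hαc : α = some c
    · exact Or.inl hαc
    have hβc : β ≠ some c := by
      rintro rfl
      simp only [Set.mem_preimage, Function.update_self, Set.mem_singleton_iff] at hβ
      exact hαc hβ.symm
    simp only [Set.mem_preimage, Function.update_of_ne hβc] at hβ
    refine Or.inr ⟨⟨β, hβ⟩, fun h => hα ?_⟩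
    ext γ
    have hγ : Φ.toFun γ = α ↔ γ = α := by
      simpa using Set.ext_iff.1 h γ
    by_cases hγc : γ = some c
    · subst hγc
      simp [eq_comm]
    · simpa [Function.update_of_ne hγc] using hγ

theorem Relabelling.keep_self (Φ : Relabelling B) (c : B) :
    (Φ.keep c).toFun (some c) = some c := by
  simp [keep]

theorem Relabelling.keep_of_ne (Φ : Relabelling B) {c : B} {α : Act B} (h : α ≠ some c) :
    (Φ.keep c).toFun α = Φ.toFun α := by
  simp [keep, h]

open Classical in
/-- The relabelling function that maps `c` to `α` and leaves all other actions unchanged. -/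
noncomputable def renameAct (c : B) (α : Act B) : Relabelling B where
  toFun := Function.update id (some c) α
  map_tau := by simp
  finite_base := by
    refine ((Set.finite_singleton α).insert (some c)).subset ?_
    rintro β ⟨-, hβ⟩
    by_contra h
    simp only [Set.mem_insert_iff, Set.mem_singleton_iff, not_or] at h
    refine hβ ?_
    ext γ
    by_cases hγ : γ = some c
    · subst hγ
      simp [Ne.symm h.1, Ne.symm h.2]
    · simp [hγ]

theorem renameAct_self (c : B) (α : Act B) : (renameAct c α).toFun (some c) = α := by
  simp [renameAct]

theorem renameAct_of_ne {c : B} {α β : Act B} (h : β ≠ some c) :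
    (renameAct c α).toFun β = β := by
  simp [renameAct, h]

/-- The timed action `μ` with its action replaced by `c`. -/
def TAct.withAct (μ : TAct B) (c : B) : TAct B :=
  match μ with
  | .lazy _ => .lazy (some c)
  | .urgent _ => .urgent (some c)

theorem TAct.act_withAct (μ : TAct B) (c : B) : (μ.withAct c).act = some c := by
  cases μ <;> rfl

/-! ### Fresh actions -/

namespace RTerm

variable {V : Type v}

/-- The action `c` is performed neither by the term nor by its derivatives: it is not the action
of a prefix, and no other action is relabelled to it. -/
def Fresh (c : B) : RTerm B V → Prop
  | nil => True
  | var _ => True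
  | pref μ P => μ.act ≠ some c ∧ P.Fresh c
  | read μ Q => μ.act ≠ some c ∧ Q.Fresh c
  | sum Q₁ Q₂ => Q₁.Fresh c ∧ Q₂.Fresh c
  | par _ Q₁ Q₂ => Q₁.Fresh c ∧ Q₂.Fresh c
  | rel Q Φ => (∀ α, Φ.toFun α = some c → α = some c) ∧ Q.Fresh c
  | fix _ Q => Q.Fresh c

/-- Each prefix excludes at most one action. A relabelling excludes c only if some other action is
mapped to c, and such c lie in the exceptional set, whose finiteness is part of being a relabelling
function. -/
theorem finite_not_fresh (Q : RTerm B V) : {c : B | ¬ Q.Fresh c}.Finite := by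
  have hact : ∀ μ : TAct B, {c : B | μ.act = some c}.Finite := by
    intro μ
    refine Set.Subsingleton.finite ?_
    intro a ha b hb
    exact Option.some_injective _ (ha.symm.trans hb)
  induction Q with
  | nil => simp [Fresh]
  | var => simp [Fresh]
  | pref μ P ih =>
    refine ((hact μ).union ih).subset fun c hc => ?_
    simp only [Fresh, Set.mem_ofPred_eq, Set.mem_union] at hc ⊢
    tauto
  | read μ P ih =>
    refine ((hact μ).union ih).subset fun c hc => ?_
    simp only [Fresh, Set.mem_ofPred_eq, Set.mem_union] at hc ⊢
    tauto
  | sum P Q ihP ihQ =>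
    refine (ihP.union ihQ).subset fun c hc => ?_
    simp only [Fresh, Set.mem_ofPred_eq, Set.mem_union] at hc ⊢
    tauto
  | par A P Q ihP ihQ =>
    refine (ihP.union ihQ).subset fun c hc => ?_
    simp only [Fresh, Set.mem_ofPred_eq, Set.mem_union] at hc ⊢
    tauto
  | fix x Q ih => exact ih
  | rel Q Φ ih =>
    have := Φ.finite_base.preimage (Option.some_injective B).injOn
    refine (this.union ih).subset fun c hc => ?_
    by_cases h : Q.Fresh c
    · left
      simp only [Fresh, Set.mem_ofPred_eq, h, and_true, not_forall] at hc
      obtain ⟨α, hα, hαc⟩ := hc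
      refine ⟨⟨α, hα⟩, fun h => hαc ?_⟩
      have : α ∈ Φ.toFun ⁻¹' {some c} := hα
      rw [h] at this
      exact this
    · exact Or.inr h

theorem exists_fresh [Infinite B] (Q : RTerm B V) : ∃ c, Q.Fresh c := by
  obtain ⟨c, hc⟩ := (finite_not_fresh Q).infinite_compl.nonempty
  exact ⟨c, not_not.1 hc⟩

variable [DecidableEq V]

theorem TimeStep.mono {X Y : Set B} {Q Q' : RTerm B V} (h : TimeStep X Q Q') (hY : Y ⊆ X) :
    TimeStep Y Q Q' := by
  induction h generalizing Y with
  | nil => exact .nil _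
  | prefLazy => exact .prefLazy _ _ _
  | prefUrgent _ h => exact .prefUrgent _ fun h' => h (withTau_mono hY h')
  | readLazy α _ ih => exact .readLazy α (ih hY)
  | readUrgent _ h ih => exact .readUrgent (ih hY) fun h' => h (withTau_mono hY h')
  | sum _ _ ih₁ ih₂ => exact .sum (ih₁ hY) (ih₂ hY)
  | rel _ ih => exact .rel (ih fun a ha => withTau_mono hY ha)
  | fix _ ih => exact .fix (ih hY)
  | par h₁ h₂ hX => exact .par h₁ h₂ (hY.trans hX)

/-! Bisimulations that distinguish ordinary and reading transitions -/

/-- `ρ` is a timed bisimulation that respects the kind of the action transitions. -/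
structure IsReadBisimulation (ρ : RTerm B V → RTerm B V → Prop) : Prop where
  ord_forth : ∀ {P Q}, ρ P Q → ∀ {α P₁}, OrdStep α P P₁ → ∃ Q₁, OrdStep α Q Q₁ ∧ ρ P₁ Q₁
  ord_back : ∀ {P Q}, ρ P Q → ∀ {α Q₁}, OrdStep α Q Q₁ → ∃ P₁, OrdStep α P P₁ ∧ ρ P₁ Q₁
  read_forth : ∀ {P Q}, ρ P Q → ∀ {α P₁}, ReadStep α P P₁ → ∃ Q₁, ReadStep α Q Q₁ ∧ ρ P₁ Q₁
  read_back : ∀ {P Q}, ρ P Q → ∀ {α Q₁}, ReadStep α Q Q₁ → ∃ P₁, ReadStep α P P₁ ∧ ρ P₁ Q₁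
  time_forth : ∀ {P Q}, ρ P Q → ∀ {X P₁}, TimeStep X P P₁ → ∃ Q₁, TimeStep X Q Q₁ ∧ ρ P₁ Q₁
  time_back : ∀ {P Q}, ρ P Q → ∀ {X Q₁}, TimeStep X Q Q₁ → ∃ P₁, TimeStep X P P₁ ∧ ρ P₁ Q₁

/-- Timed bisimilarity that respects the kind of the action transitions. -/
def ReadBisimilar (P Q : RTerm B V) : Prop := ∃ ρ, IsReadBisimulation ρ ∧ ρ P Q

theorem isReadBisimulation_readBisimilar :
    IsReadBisimulation (ReadBisimilar (B := B) (V := V)) where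
  ord_forth := fun ⟨ρ, hρ, h⟩ _ _ hs =>
    let ⟨Q', h₁, h₂⟩ := hρ.ord_forth h hs; ⟨Q', h₁, ρ, hρ, h₂⟩
  ord_back := fun ⟨ρ, hρ, h⟩ _ _ hs =>
    let ⟨Q', h₁, h₂⟩ := hρ.ord_back h hs; ⟨Q', h₁, ρ, hρ, h₂⟩
  read_forth := fun ⟨ρ, hρ, h⟩ _ _ hs =>
    let ⟨Q', h₁, h₂⟩ := hρ.read_forth h hs; ⟨Q', h₁, ρ, hρ, h₂⟩
  read_back := fun ⟨ρ, hρ, h⟩ _ _ hs =>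
    let ⟨Q', h₁, h₂⟩ := hρ.read_back h hs; ⟨Q', h₁, ρ, hρ, h₂⟩
  time_forth := fun ⟨ρ, hρ, h⟩ _ _ hs =>
    let ⟨Q', h₁, h₂⟩ := hρ.time_forth h hs; ⟨Q', h₁, ρ, hρ, h₂⟩
  time_back := fun ⟨ρ, hρ, h⟩ _ _ hs =>
    let ⟨Q', h₁, h₂⟩ := hρ.time_back h hs; ⟨Q', h₁, ρ, hρ, h₂⟩

theorem ReadBisimilar.refl (Q : RTerm B V) : ReadBisimilar Q Q := by
  refine ⟨Eq, ⟨?_, ?_, ?_, ?_, ?_, ?_⟩, rfl⟩ <;> rintro P _ rfl _ P' h <;> exact ⟨P', h, rfl⟩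

theorem ReadBisimilar.trans {P Q R : RTerm B V} (h₁ : ReadBisimilar P Q)
    (h₂ : ReadBisimilar Q R) : ReadBisimilar P R := by
  have key := isReadBisimulation_readBisimilar (B := B) (V := V)
  refine ⟨fun P R => ∃ Q, ReadBisimilar P Q ∧ ReadBisimilar Q R, ⟨?_, ?_, ?_, ?_, ?_, ?_⟩,
    Q, h₁, h₂⟩ <;> rintro P R ⟨Q, h₁, h₂⟩ _ P' h
  · obtain ⟨Q', h, h₁⟩ := key.ord_forth h₁ h
    obtain ⟨R', h, h₂⟩ := key.ord_forth h₂ h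
    exact ⟨R', h, Q', h₁, h₂⟩
  · obtain ⟨Q', h, h₂⟩ := key.ord_back h₂ h
    obtain ⟨R', h, h₁⟩ := key.ord_back h₁ h
    exact ⟨R', h, Q', h₁, h₂⟩
  · obtain ⟨Q', h, h₁⟩ := key.read_forth h₁ h
    obtain ⟨R', h, h₂⟩ := key.read_forth h₂ h
    exact ⟨R', h, Q', h₁, h₂⟩
  · obtain ⟨Q', h, h₂⟩ := key.read_back h₂ h
    obtain ⟨R', h, h₁⟩ := key.read_back h₁ h
    exact ⟨R', h, Q', h₁, h₂⟩
  · obtain ⟨Q', h, h₁⟩ := key.time_forth h₁ h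
    obtain ⟨R', h, h₂⟩ := key.time_forth h₂ h
    exact ⟨R', h, Q', h₁, h₂⟩
  · obtain ⟨Q', h, h₂⟩ := key.time_back h₂ h
    obtain ⟨R', h, h₁⟩ := key.time_back h₁ h
    exact ⟨R', h, Q', h₁, h₂⟩

/-- The closure of bisimilarity under contexts built from action prefixes, read prefixes,
parallel compositions and relabellings. -/
inductive ReadBisimilarContext : RTerm B V → RTerm B V → Prop
  | base {P Q : RTerm B V} : ReadBisimilar P Q → ReadBisimilarContext P Q
  | pref (μ : TAct B) {P Q : RTerm B V} : ReadBisimilarContext P Q →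
      ReadBisimilarContext (pref μ P) (pref μ Q)
  | read (μ : TAct B) {P Q : RTerm B V} : ReadBisimilarContext P Q →
      ReadBisimilarContext (read μ P) (read μ Q)
  | par (A : Set B) {P₁ P₂ Q₁ Q₂ : RTerm B V} : ReadBisimilarContext P₁ Q₁ →
      ReadBisimilarContext P₂ Q₂ → ReadBisimilarContext (par A P₁ P₂) (par A Q₁ Q₂)
  | rel (Φ : Relabelling B) {P Q : RTerm B V} : ReadBisimilarContext P Q →
      ReadBisimilarContext (rel P Φ) (rel Q Φ)

/-- Comes before the ordinary case, which needs it where an ordinary transition synchronises with a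
reading one. -/
theorem ReadBisimilarContext.read_forth {P Q : RTerm B V} (h : ReadBisimilarContext P Q)
    {α : Act B} {P' : RTerm B V} (hs : ReadStep α P P') :
    ∃ Q', ReadStep α Q Q' ∧ ReadBisimilarContext P' Q' := by
  induction h generalizing α P' with
  | base h =>
    obtain ⟨Q', h₁, h₂⟩ := isReadBisimulation_readBisimilar.read_forth h hs
    exact ⟨Q', h₁, .base h₂⟩
  | pref => cases hs
  | read μ h ih =>
    cases hs with
    | read₁ _ hα => exact ⟨_, .read₁ _ hα, .read μ h⟩
    | read₂ _ hs =>
      obtain ⟨Q', h₁, h₂⟩ := ih hs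
      exact ⟨_, .read₂ μ h₁, .read μ h₂⟩
  | par A k₁ k₂ ih₁ ih₂ =>
    cases hs with
    | parL _ hα hs =>
      obtain ⟨Q', h₁, h₂⟩ := ih₁ hs
      exact ⟨_, .parL _ hα h₁, .par A h₂ k₂⟩
    | parR _ hα hs =>
      obtain ⟨Q', h₁, h₂⟩ := ih₂ hs
      exact ⟨_, .parR _ hα h₁, .par A k₁ h₂⟩
    | sync hα hs hs' =>
      obtain ⟨Q', h₁, h₂⟩ := ih₁ hs
      obtain ⟨Q'', h₃, h₄⟩ := ih₂ hs'
      exact ⟨_, .sync hα h₁ h₃, .par A h₂ h₄⟩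
  | rel Φ _ ih =>
    cases hs with
    | rel hs hα =>
      obtain ⟨Q', h₁, h₂⟩ := ih hs
      exact ⟨_, .rel h₁ hα, .rel Φ h₂⟩

/-- The kind of a transition has to be matched here: below a read prefix an ordinary transition
discards the prefix, whereas a reading one keeps it. -/
theorem ReadBisimilarContext.ord_forth {P Q : RTerm B V} (h : ReadBisimilarContext P Q)
    {α : Act B} {P' : RTerm B V} (hs : OrdStep α P P') :
    ∃ Q', OrdStep α Q Q' ∧ ReadBisimilarContext P' Q' := by
  induction h generalizing α P' with
  | base h =>
    obtain ⟨Q', h₁, h₂⟩ := isReadBisimulation_readBisimilar.ord_forth h hs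
    exact ⟨Q', h₁, .base h₂⟩
  | pref μ h =>
    cases hs with
    | pref _ hα => exact ⟨_, .pref _ hα, h⟩
  | read μ h ih =>
    cases hs with
    | read _ hs =>
      obtain ⟨Q', h₁, h₂⟩ := ih hs
      exact ⟨_, .read μ h₁, h₂⟩
  | par A k₁ k₂ ih₁ ih₂ =>
    cases hs with
    | parL _ hα hs =>
      obtain ⟨Q', h₁, h₂⟩ := ih₁ hs
      exact ⟨_, .parL _ hα h₁, .par A h₂ k₂⟩
    | parR _ hα hs =>
      obtain ⟨Q', h₁, h₂⟩ := ih₂ hs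
      exact ⟨_, .parR _ hα h₁, .par A k₁ h₂⟩
    | sync hα hs hs' =>
      obtain ⟨Q', h₁, h₂⟩ := ih₁ hs
      obtain ⟨Q'', h₃, h₄⟩ := ih₂ hs'
      exact ⟨_, .sync hα h₁ h₃, .par A h₂ h₄⟩
    | syncL hα hs hs' =>
      obtain ⟨Q', h₁, h₂⟩ := ih₁ hs
      obtain ⟨Q'', h₃, h₄⟩ := k₂.read_forth hs'
      exact ⟨_, .syncL hα h₁ h₃, .par A h₂ h₄⟩
    | syncR hα hs hs' =>
      obtain ⟨Q', h₁, h₂⟩ := k₁.read_forth hs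
      obtain ⟨Q'', h₃, h₄⟩ := ih₂ hs'
      exact ⟨_, .syncR hα h₁ h₃, .par A h₂ h₄⟩
  | rel Φ _ ih =>
    cases hs with
    | rel hs hα =>
      obtain ⟨Q', h₁, h₂⟩ := ih hs
      exact ⟨_, .rel h₁ hα, .rel Φ h₂⟩

theorem ReadBisimilarContext.time_forth {P Q : RTerm B V} (h : ReadBisimilarContext P Q)
    {X : Set B} {P' : RTerm B V} (hs : TimeStep X P P') :
    ∃ Q', TimeStep X Q Q' ∧ ReadBisimilarContext P' Q' := by
  induction h generalizing X P' with
  | base h =>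
    obtain ⟨Q', h₁, h₂⟩ := isReadBisimulation_readBisimilar.time_forth h hs
    exact ⟨Q', h₁, .base h₂⟩
  | pref μ h =>
    cases hs with
    | prefLazy _ α => exact ⟨_, .prefLazy _ _ _, .pref _ h⟩
    | prefUrgent _ hα => exact ⟨_, .prefUrgent _ hα, .pref _ h⟩
  | read μ h ih =>
    obtain ⟨P₁, rfl, hs, hX⟩ := timeStep_read.1 hs
    obtain ⟨Q', h₁, h₂⟩ := ih hs
    exact ⟨_, timeStep_read.2 ⟨Q', rfl, h₁, hX⟩, .read _ h₂⟩
  | par A k₁ k₂ ih₁ ih₂ =>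
    cases hs with
    | par hs hs' hX =>
      obtain ⟨Q', h₁, h₂⟩ := ih₁ hs
      obtain ⟨Q'', h₃, h₄⟩ := ih₂ hs'
      exact ⟨_, .par h₁ h₃ hX, .par A h₂ h₄⟩
  | rel Φ _ ih =>
    cases hs with
    | rel hs =>
      obtain ⟨Q', h₁, h₂⟩ := ih hs
      exact ⟨_, .rel h₁, .rel Φ h₂⟩

theorem ReadBisimilar.symm {P Q : RTerm B V} (h : ReadBisimilar P Q) : ReadBisimilar Q P := by
  obtain ⟨ρ, hρ, h⟩ := h
  exact ⟨fun Q P => ρ P Q, ⟨hρ.ord_back, hρ.ord_forth, hρ.read_back, hρ.read_forth,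
    hρ.time_back, hρ.time_forth⟩, h⟩

theorem ReadBisimilarContext.symm {P Q : RTerm B V} (h : ReadBisimilarContext P Q) :
    ReadBisimilarContext Q P := by
  induction h with
  | base h => exact .base h.symm
  | pref μ _ ih => exact .pref μ ih
  | read μ _ ih => exact .read μ ih
  | par A _ _ ih₁ ih₂ => exact .par A ih₁ ih₂
  | rel Φ _ ih => exact .rel Φ ih

/-- The closure is symmetric, so the forward conditions give the backward ones. Choice and recursion
need no congruence property, since those subterms are never rewritten. -/
theorem ReadBisimilarContext.readBisimilar {P Q : RTerm B V} (h : ReadBisimilarContext P Q) :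
    ReadBisimilar P Q := by
  refine ⟨_, ⟨fun h _ _ => h.ord_forth, fun h _ _ hs => ?_, fun h _ _ => h.read_forth,
    fun h _ _ hs => ?_, fun h _ _ => h.time_forth, fun h _ _ hs => ?_⟩, h⟩
  · exact (h.symm.ord_forth hs).imp fun _ => And.imp_right symm
  · exact (h.symm.read_forth hs).imp fun _ => And.imp_right symm
  · exact (h.symm.time_forth hs).imp fun _ => And.imp_right symm

theorem ReadBisimilar.pref (μ : TAct B) {P Q : RTerm B V} (h : ReadBisimilar P Q) :
    ReadBisimilar (pref μ P) (pref μ Q) :=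
  (ReadBisimilarContext.pref μ (.base h)).readBisimilar

theorem ReadBisimilar.read (μ : TAct B) {P Q : RTerm B V} (h : ReadBisimilar P Q) :
    ReadBisimilar (read μ P) (read μ Q) :=
  (ReadBisimilarContext.read μ (.base h)).readBisimilar

theorem ReadBisimilar.par (A : Set B) {P₁ P₂ Q₁ Q₂ : RTerm B V} (h₁ : ReadBisimilar P₁ Q₁)
    (h₂ : ReadBisimilar P₂ Q₂) : ReadBisimilar (par A P₁ P₂) (par A Q₁ Q₂) :=
  (ReadBisimilarContext.par A (.base h₁) (.base h₂)).readBisimilar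

theorem ReadBisimilar.rel (Φ : Relabelling B) {P Q : RTerm B V} (h : ReadBisimilar P Q) :
    ReadBisimilar (rel P Φ) (rel Q Φ) :=
  (ReadBisimilarContext.rel Φ (.base h)).readBisimilar

end RTerm
-- Erasing reads and blocks of a fresh action
theorem mem_visible_singleton {α : Act B} {c : B} : α ∈ visible {c} ↔ α = some c := by
  simp [visible]

theorem mem_visible_congr {α : Act B} {c : B} {A A' : Set B} (hα : α ≠ some c)
    (h : ∀ b, b ≠ c → (b ∈ A ↔ b ∈ A')) : α ∈ visible A ↔ α ∈ visible A' := by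
  cases α with
  | none => simp [none_notMem_visible]
  | some a => simpa [some_mem_visible] using h a (by simpa using hα)

theorem mem_visible_insert {α : Act B} {c : B} {A : Set B} (hα : α ≠ some c) :
    α ∈ visible A ↔ α ∈ visible (insert c A) :=
  mem_visible_congr hα fun b hb => by simp [hb]

theorem notMem_withTau_insert {α : Act B} {c : B} {X : Set B} (hα : α ≠ some c)
    (h : α ∉ withTau X) : α ∉ withTau (insert c X) := by
  cases α with
  | none => exact fun _ => h none_mem_withTau
  | some a => simp_all [some_mem_withTau]

/-- The refusal condition of a parallel composition is pointwise and monotone. This allows c to be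
treated separately from all other actions. -/
theorem mem_par_refusal {A A' X₁ X₂ Y₁ Y₂ : Set B} {a : B} (hA : a ∈ A ↔ a ∈ A')
    (h₁ : a ∈ X₁ → a ∈ Y₁) (h₂ : a ∈ X₂ → a ∈ Y₂)
    (h : a ∈ (A ∩ (X₁ ∪ X₂)) ∪ ((X₁ ∩ X₂) \ A)) :
    a ∈ (A' ∩ (Y₁ ∪ Y₂)) ∪ ((Y₁ ∩ Y₂) \ A') := by
  simp only [Set.mem_union, Set.mem_inter_iff, Set.mem_sdiff] at *
  tauto

namespace RTerm

variable {V : Type v}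

/-- `Erases c b Q R`: the action `c` is fresh for `Q`, and `Q` results from `R` by erasing read
prefixes of `c` and parallel compositions that block `c`. For `b = false`, nothing is erased at
the root. -/
inductive Erases (c : B) : Bool → RTerm B V → RTerm B V → Prop
  | nil : Erases c false nil nil
  | var (x : V) : Erases c false (var x) (var x)
  | pref {μ : TAct B} {P P' : RTerm B V} : μ.act ≠ some c → Erases c true P P' →
      Erases c false (pref μ P) (pref μ P')
  | read {μ : TAct B} {P P' : RTerm B V} : μ.act ≠ some c → Erases c true P P' →
      Erases c false (read μ P) (read μ P')
  | sum {P P' Q Q' : RTerm B V} : Erases c true P P' → Erases c true Q Q' →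
      Erases c false (sum P Q) (sum P' Q')
  | par {A A' : Set B} {P P' Q Q' : RTerm B V} : (∀ b, b ≠ c → (b ∈ A ↔ b ∈ A')) →
      Erases c true P P' → Erases c true Q Q' → Erases c false (par A P Q) (par A' P' Q')
  | rel {Φ : Relabelling B} {P P' : RTerm B V} : (∀ α, Φ.toFun α = some c → α = some c) →
      Erases c true P P' → Erases c false (rel P Φ) (rel P' (Φ.keep c))
  | fix (x : V) {P P' : RTerm B V} : Erases c true P P' → Erases c false (fix x P) (fix x P')
  | root {P P' : RTerm B V} : Erases c false P P' → Erases c true P P'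
  | eraseRead {μ : TAct B} {P P' : RTerm B V} : μ.act = some c → Erases c true P P' →
      Erases c true P (read μ P')
  | eraseBlock {P P' : RTerm B V} : Erases c true P P' → Erases c true P (par {c} P' .nil)

/-- `Wrapped c P Q`: `Q` results from `P` by adding read prefixes of `c` and parallel
compositions that block `c` at the root. -/
inductive Wrapped (c : B) (P : RTerm B V) : RTerm B V → Prop
  | refl : Wrapped c P P
  | read {μ : TAct B} {Q : RTerm B V} : μ.act = some c → Wrapped c P Q → Wrapped c P (read μ Q)
  | block {Q : RTerm B V} : Wrapped c P Q → Wrapped c P (par {c} Q nil)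

/-- Separates the erasures at the root, so that `Q` and `R₀` have the same head operator and a
transition of `Q` can be followed in `R₀`. -/
theorem Erases.exists_root {c : B} {b : Bool} {Q R : RTerm B V} (h : Erases c b Q R) :
    ∃ R₀, Erases c false Q R₀ ∧ Wrapped c R₀ R := by
  induction h with
  | root h => exact ⟨_, h, .refl⟩
  | eraseRead hμ _ ih => exact ih.imp fun _ => And.imp_right (.read hμ)
  | eraseBlock _ ih => exact ih.imp fun _ => And.imp_right .block
  | nil => exact ⟨_, .nil, .refl⟩
  | var x => exact ⟨_, .var x, .refl⟩
  | pref hμ h => exact ⟨_, .pref hμ h, .refl⟩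
  | read hμ h => exact ⟨_, .read hμ h, .refl⟩
  | sum h₁ h₂ => exact ⟨_, .sum h₁ h₂, .refl⟩
  | par hA h₁ h₂ => exact ⟨_, .par hA h₁ h₂, .refl⟩
  | rel hΦ h => exact ⟨_, .rel hΦ h, .refl⟩
  | fix x h => exact ⟨_, .fix x h, .refl⟩

theorem Erases.wrapped {c : B} {Q R R₀ : RTerm B V} (hw : Wrapped c R₀ R)
    (h : Erases c true Q R₀) : Erases c true Q R := by
  induction hw with
  | refl => exact h
  | read hμ _ ih => exact .eraseRead hμ ih
  | block _ ih => exact .eraseBlock ih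

variable [DecidableEq V]

theorem Wrapped.readStep {c : B} {R₀ R R₀' : RTerm B V} (hw : Wrapped c R₀ R) {α : Act B}
    (hα : α ≠ some c) (h : ReadStep α R₀ R₀') : ∃ R', ReadStep α R R' ∧ Wrapped c R₀' R' := by
  induction hw with
  | refl => exact ⟨_, h, .refl⟩
  | read hμ _ ih =>
    obtain ⟨R', h, hw⟩ := ih
    exact ⟨_, .read₂ _ h, .read hμ hw⟩
  | block _ ih =>
    obtain ⟨R', h, hw⟩ := ih
    exact ⟨_, .parL _ (mem_visible_singleton.not.2 hα) h, .block hw⟩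

theorem Wrapped.ordStep {c : B} {R₀ R R₀' : RTerm B V} (hw : Wrapped c R₀ R) {α : Act B}
    (hα : α ≠ some c) (h : OrdStep α R₀ R₀') : ∃ R', OrdStep α R R' ∧ Wrapped c R₀' R' := by
  induction hw with
  | refl => exact ⟨_, h, .refl⟩
  | read hμ _ ih =>
    obtain ⟨R', h, hw⟩ := ih
    exact ⟨_, .read _ h, hw⟩
  | block _ ih =>
    obtain ⟨R', h, hw⟩ := ih
    exact ⟨_, .parL _ (mem_visible_singleton.not.2 hα) h, .block hw⟩

/-- The added prefixes may be urgent, whence c must not be refused. The blocks impose nothing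
further, as nil refuses every set. -/
theorem Wrapped.timeStep {c : B} {R₀ R R₀' : RTerm B V} (hw : Wrapped c R₀ R) {X : Set B}
    (hX : c ∉ X) (h : TimeStep X R₀ R₀') : ∃ R', TimeStep X R R' ∧ Wrapped c R₀' R' := by
  induction hw with
  | refl => exact ⟨_, h, .refl⟩
  | @read μ _ hμ _ ih =>
    obtain ⟨R', h, hw⟩ := ih
    refine ⟨_, timeStep_read.2 ⟨R', rfl, h, ?_⟩, .read hμ hw⟩
    rintro α rfl
    change α = some c at hμ
    rwa [hμ, some_mem_withTau]
  | block _ ih =>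
    obtain ⟨R', h, hw⟩ := ih
    refine ⟨_, .par h (.nil X) ?_, .block hw⟩
    intro a ha
    exact Or.inr ⟨⟨ha, ha⟩, fun h => hX (h ▸ ha)⟩

theorem Erases.subst {c : B} {b : Bool} {Q R S S' : RTerm B V} (x : V) (h : Erases c b Q R)
    (hS : Erases c true S S') : Erases c true (subst x S Q) (subst x S' R) := by
  induction h with
  | nil => exact .root .nil
  | var y =>
    by_cases hy : y = x
    · simpa [RTerm.subst, hy] using hS
    · simpa [RTerm.subst, hy] using .root (.var y)
  | pref hμ _ ih => exact .root (.pref hμ ih)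
  | read hμ _ ih => exact .root (.read hμ ih)
  | sum _ _ ih₁ ih₂ => exact .root (.sum ih₁ ih₂)
  | par hA _ _ ih₁ ih₂ => exact .root (.par hA ih₁ ih₂)
  | rel hΦ _ ih => exact .root (.rel hΦ ih)
  | fix y h ih =>
    by_cases hy : y = x
    · simpa [RTerm.subst, hy] using .root (.fix x h)
    · simpa [RTerm.subst, hy] using .root (.fix y ih)
  | root _ ih => exact ih
  | eraseRead hμ _ ih => exact .eraseRead hμ ih
  | eraseBlock _ ih => exact .eraseBlock ih

theorem Erases.unfold {c : B} {Q R : RTerm B V} (x : V) (h : Erases c true Q R) :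
    Erases c true (RTerm.subst x (.fix x Q) Q) (RTerm.subst x (.fix x R) R) :=
  h.subst x (.root (.fix x h))

theorem Erases.readStep_forth {c : B} {Q R Q' : RTerm B V} {α : Act B} (hs : ReadStep α Q Q')
    (h : Erases c true Q R) : α ≠ some c ∧ ∃ R', ReadStep α R R' ∧ Erases c true Q' R' := by
  induction hs generalizing R
  all_goals
    obtain ⟨R₀, h₀, hw⟩ := h.exists_root
    clear h
    -- It suffices to match the transition below the wrapping: its action is not c, so it passes
    -- through all added prefixes and blocks.
    refine (fun ⟨h₁, R', h₂, h₃⟩ =>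
      let ⟨R'', h₄, h₅⟩ := hw.readStep h₁ h₂; ⟨h₁, R'', h₄, h₃.wrapped h₅⟩ :
        (_ ≠ some c ∧ ∃ R', ReadStep _ R₀ R' ∧ Erases c true _ R') → _) ?_
    clear hw
  case read₁ hα =>
    cases h₀ with
    | read hμ h => exact ⟨hα ▸ hμ, _, .read₁ _ hα, .root (.read hμ h)⟩
  case read₂ ih =>
    cases h₀ with
    | read hμ h =>
      obtain ⟨h₁, R', h₂, h₃⟩ := ih h
      exact ⟨h₁, _, .read₂ _ h₂, .root (.read hμ h₃)⟩
  case sumL ih =>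
    cases h₀ with
    | sum h k =>
      obtain ⟨h₁, R', h₂, h₃⟩ := ih h
      exact ⟨h₁, _, .sumL _ h₂, .root (.sum h₃ k)⟩
  case sumR ih =>
    cases h₀ with
    | sum k h =>
      obtain ⟨h₁, R', h₂, h₃⟩ := ih h
      exact ⟨h₁, _, .sumR _ h₂, .root (.sum k h₃)⟩
  case parL hα _ ih =>
    cases h₀ with
    | par hA h k =>
      obtain ⟨h₁, R', h₂, h₃⟩ := ih h
      exact ⟨h₁, _, .parL _ ((mem_visible_congr h₁ hA).not.1 hα) h₂, .root (.par hA h₃ k)⟩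
  case parR hα _ ih =>
    cases h₀ with
    | par hA k h =>
      obtain ⟨h₁, R', h₂, h₃⟩ := ih h
      exact ⟨h₁, _, .parR _ ((mem_visible_congr h₁ hA).not.1 hα) h₂, .root (.par hA k h₃)⟩
  case sync hα _ _ ih₁ ih₂ =>
    cases h₀ with
    | par hA h k =>
      obtain ⟨h₁, R', h₂, h₃⟩ := ih₁ h
      obtain ⟨-, R'', h₄, h₅⟩ := ih₂ k
      exact ⟨h₁, _, .sync ((mem_visible_congr h₁ hA).1 hα) h₂ h₄, .root (.par hA h₃ h₅)⟩
  case rel hα ih =>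
    cases h₀ with
    | rel hΦ h =>
      obtain ⟨h₁, R', h₂, h₃⟩ := ih h
      exact ⟨fun e => h₁ (hΦ _ (hα.trans e)), _,
        .rel h₂ ((Relabelling.keep_of_ne _ h₁).trans hα), .root (.rel hΦ h₃)⟩
  case fix ih =>
    cases h₀ with
    | fix x h =>
      obtain ⟨h₁, R', h₂, h₃⟩ := ih (h.unfold _)
      exact ⟨h₁, R', .fix h₂, h₃⟩

theorem Erases.ordStep_forth {c : B} {Q R Q' : RTerm B V} {α : Act B} (hs : OrdStep α Q Q')
    (h : Erases c true Q R) : α ≠ some c ∧ ∃ R', OrdStep α R R' ∧ Erases c true Q' R' := by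
  induction hs generalizing R
  all_goals
    obtain ⟨R₀, h₀, hw⟩ := h.exists_root
    clear h
    refine (fun ⟨h₁, R', h₂, h₃⟩ =>
      let ⟨R'', h₄, h₅⟩ := hw.ordStep h₁ h₂; ⟨h₁, R'', h₄, h₃.wrapped h₅⟩ :
        (_ ≠ some c ∧ ∃ R', OrdStep _ R₀ R' ∧ Erases c true _ R') → _) ?_
    clear hw
  case pref hα =>
    cases h₀ with
    | pref hμ h => exact ⟨hα ▸ hμ, _, .pref _ hα, h⟩
  case read ih =>
    cases h₀ with
    | read hμ h =>
      obtain ⟨h₁, R', h₂, h₃⟩ := ih h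
      exact ⟨h₁, _, .read _ h₂, h₃⟩
  case sumL ih =>
    cases h₀ with
    | sum h k =>
      obtain ⟨h₁, R', h₂, h₃⟩ := ih h
      exact ⟨h₁, _, .sumL _ h₂, h₃⟩
  case sumR ih =>
    cases h₀ with
    | sum k h =>
      obtain ⟨h₁, R', h₂, h₃⟩ := ih h
      exact ⟨h₁, _, .sumR _ h₂, h₃⟩
  case parL hα _ ih =>
    cases h₀ with
    | par hA h k =>
      obtain ⟨h₁, R', h₂, h₃⟩ := ih h
      exact ⟨h₁, _, .parL _ ((mem_visible_congr h₁ hA).not.1 hα) h₂, .root (.par hA h₃ k)⟩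
  case parR hα _ ih =>
    cases h₀ with
    | par hA k h =>
      obtain ⟨h₁, R', h₂, h₃⟩ := ih h
      exact ⟨h₁, _, .parR _ ((mem_visible_congr h₁ hA).not.1 hα) h₂, .root (.par hA k h₃)⟩
  case sync hα _ _ ih₁ ih₂ =>
    cases h₀ with
    | par hA h k =>
      obtain ⟨h₁, R', h₂, h₃⟩ := ih₁ h
      obtain ⟨-, R'', h₄, h₅⟩ := ih₂ k
      exact ⟨h₁, _, .sync ((mem_visible_congr h₁ hA).1 hα) h₂ h₄, .root (.par hA h₃ h₅)⟩
  case syncL hα _ hs ih =>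
    cases h₀ with
    | par hA h k =>
      obtain ⟨h₁, R', h₂, h₃⟩ := ih h
      obtain ⟨-, R'', h₄, h₅⟩ := Erases.readStep_forth hs k
      exact ⟨h₁, _, .syncL ((mem_visible_congr h₁ hA).1 hα) h₂ h₄, .root (.par hA h₃ h₅)⟩
  case syncR hα hs _ ih =>
    cases h₀ with
    | par hA h k =>
      obtain ⟨h₁, R', h₂, h₃⟩ := Erases.readStep_forth hs h
      obtain ⟨-, R'', h₄, h₅⟩ := ih k
      exact ⟨h₁, _, .syncR ((mem_visible_congr h₁ hA).1 hα) h₂ h₄, .root (.par hA h₃ h₅)⟩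
  case rel hα ih =>
    cases h₀ with
    | rel hΦ h =>
      obtain ⟨h₁, R', h₂, h₃⟩ := ih h
      exact ⟨fun e => h₁ (hΦ _ (hα.trans e)), _,
        .rel h₂ ((Relabelling.keep_of_ne _ h₁).trans hα), .root (.rel hΦ h₃)⟩
  case fix ih =>
    cases h₀ with
    | fix x h =>
      obtain ⟨h₁, R', h₂, h₃⟩ := ih (h.unfold _)
      exact ⟨h₁, R', .fix h₂, h₃⟩

end RTerm

theorem Relabelling.mem_refusal_keep {Φ : Relabelling B} {c a : B} {X : Set B} (ha : a ≠ c) :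
    a ∈ (Φ.keep c).refusal X ↔ a ∈ Φ.refusal X := by
  rw [mem_refusal, mem_refusal, keep_of_ne _ (by simpa using ha)]

theorem Relabelling.self_mem_refusal_keep {Φ : Relabelling B} {c : B} {X : Set B} :
    c ∈ (Φ.keep c).refusal X ↔ c ∈ X := by
  rw [mem_refusal, keep_self, some_mem_withTau]

theorem Relabelling.mem_refusal_of_ne {Φ : Relabelling B} {c a : B} {X Y : Set B}
    (hΦ : ∀ α, Φ.toFun α = some c → α = some c) (hXY : X ⊆ insert c Y) (ha : a ≠ c)
    (h : a ∈ Φ.refusal X) : a ∈ Φ.refusal Y := by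
  rw [mem_refusal] at h ⊢
  cases e : Φ.toFun (some a) with
  | none => exact none_mem_withTau
  | some b =>
    rw [e, some_mem_withTau] at h
    refine some_mem_withTau.2 ((hXY h).resolve_left ?_)
    rintro rfl
    exact ha (Option.some_injective _ (hΦ _ e))

theorem Relabelling.refusal_mono (Φ : Relabelling B) {X Y : Set B} (h : X ⊆ Y) :
    Φ.refusal X ⊆ Φ.refusal Y := fun _ ha => withTau_mono h ha

namespace RTerm

variable {V : Type v} [DecidableEq V]

/-- The erased reads in `R` may be urgent and unblocked, so refusal of c is not guaranteed;
`Blocked.timeStep` restores it for blocked terms. -/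
theorem Erases.timeStep_forth {c : B} {Q R Q' : RTerm B V} {X : Set B} (hs : TimeStep X Q Q')
    (h : Erases c true Q R) : ∃ R', TimeStep (X \ {c}) R R' ∧ Erases c true Q' R' := by
  induction hs generalizing R
  all_goals
    obtain ⟨R₀, h₀, hw⟩ := h.exists_root
    clear h
    refine (fun ⟨R', h₂, h₃⟩ =>
      let ⟨R'', h₄, h₅⟩ := hw.timeStep (by simp) h₂; ⟨R'', h₄, h₃.wrapped h₅⟩ :
        (∃ R', TimeStep (_ \ {c}) R₀ R' ∧ Erases c true _ R') → _) ?_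
    clear hw
  case nil => cases h₀; exact ⟨_, .nil _, .root .nil⟩
  case prefLazy =>
    cases h₀ with
    | pref hμ h => exact ⟨_, .prefLazy _ _ _, .root (.pref hμ h)⟩
  case prefUrgent hα =>
    cases h₀ with
    | pref hμ h =>
      exact ⟨_, .prefUrgent _ fun h => hα (withTau_mono Set.sdiff_subset h), .root (.pref hμ h)⟩
  case readLazy ih =>
    cases h₀ with
    | read hμ h =>
      obtain ⟨R', h₁, h₂⟩ := ih h
      exact ⟨_, .readLazy _ h₁, .root (.read hμ h₂)⟩
  case readUrgent hα ih =>
    cases h₀ with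
    | read hμ h =>
      obtain ⟨R', h₁, h₂⟩ := ih h
      exact ⟨_, .readUrgent h₁ fun h => hα (withTau_mono Set.sdiff_subset h),
        .root (.read hμ h₂)⟩
  case sum ih₁ ih₂ =>
    cases h₀ with
    | sum h k =>
      obtain ⟨R', h₁, h₂⟩ := ih₁ h
      obtain ⟨R'', h₃, h₄⟩ := ih₂ k
      exact ⟨_, .sum h₁ h₃, .root (.sum h₂ h₄)⟩
  case par hX ih₁ ih₂ =>
    cases h₀ with
    | par hA h k =>
      obtain ⟨R', h₁, h₂⟩ := ih₁ h
      obtain ⟨R'', h₃, h₄⟩ := ih₂ k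
      refine ⟨_, .par h₁ h₃ ?_, .root (.par hA h₂ h₄)⟩
      rintro a ⟨ha, hac⟩
      exact mem_par_refusal (hA a hac) (⟨·, hac⟩) (⟨·, hac⟩) (hX ha)
  case rel ih =>
    cases h₀ with
    | rel hΦ h =>
      obtain ⟨R', h₁, h₂⟩ := ih h
      refine ⟨_, .rel (h₁.mono ?_), .root (.rel hΦ h₂)⟩
      intro a ha
      have hac : a ≠ c := by
        rintro rfl
        exact (Relabelling.self_mem_refusal_keep.1 ha).2 rfl
      exact ⟨Relabelling.refusal_mono _ Set.sdiff_subset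
        ((Relabelling.mem_refusal_keep hac).1 ha), hac⟩
  case fix ih =>
    cases h₀ with
    | fix x h =>
      obtain ⟨R', h₁, h₂⟩ := ih (h.unfold _)
      exact ⟨R', .fix h₁, h₂⟩

theorem Erases.readStep_back {c : B} {Q R R' : RTerm B V} {α : Act B}
    (hs : ReadStep α R R') (h : Erases c true Q R) (hα : α ≠ some c) :
    ∃ Q', ReadStep α Q Q' ∧ Erases c true Q' R' := by
  induction hs generalizing Q with
  | read₁ _ hμ =>
    cases h with
    | root h =>
      cases h with
      | read hμ' h => exact ⟨_, .read₁ _ hμ, .root (.read hμ' h)⟩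
    | eraseRead hμ' _ => exact absurd (hμ.symm.trans hμ') hα
  | read₂ μ _ ih =>
    cases h with
    | root h =>
      cases h with
      | read hμ h =>
        obtain ⟨Q', h₁, h₂⟩ := ih h hα
        exact ⟨_, .read₂ _ h₁, .root (.read hμ h₂)⟩
    | eraseRead hμ h =>
      obtain ⟨Q', h₁, h₂⟩ := ih h hα
      exact ⟨_, h₁, .eraseRead hμ h₂⟩
  | sumL _ _ ih =>
    cases h with
    | root h =>
      cases h with
      | sum h k =>
        obtain ⟨Q', h₁, h₂⟩ := ih h hα
        exact ⟨_, .sumL _ h₁, .root (.sum h₂ k)⟩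
  | sumR _ _ ih =>
    cases h with
    | root h =>
      cases h with
      | sum k h =>
        obtain ⟨Q', h₁, h₂⟩ := ih h hα
        exact ⟨_, .sumR _ h₁, .root (.sum k h₂)⟩
  | parL _ hA' _ ih =>
    cases h with
    | root h =>
      cases h with
      | par hA h k =>
        obtain ⟨Q', h₁, h₂⟩ := ih h hα
        exact ⟨_, .parL _ ((mem_visible_congr hα hA).not.2 hA') h₁, .root (.par hA h₂ k)⟩
    | eraseBlock h =>
      obtain ⟨Q', h₁, h₂⟩ := ih h hα
      exact ⟨_, h₁, .eraseBlock h₂⟩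
  | parR _ hA' hs ih =>
    cases h with
    | root h =>
      cases h with
      | par hA k h =>
        obtain ⟨Q', h₁, h₂⟩ := ih h hα
        exact ⟨_, .parR _ ((mem_visible_congr hα hA).not.2 hA') h₁, .root (.par hA k h₂)⟩
    | eraseBlock => cases hs
  | sync hA' _ hs ih₁ ih₂ =>
    cases h with
    | root h =>
      cases h with
      | par hA h k =>
        obtain ⟨Q', h₁, h₂⟩ := ih₁ h hα
        obtain ⟨Q'', h₃, h₄⟩ := ih₂ k hα
        exact ⟨_, .sync ((mem_visible_congr hα hA).2 hA') h₁ h₃, .root (.par hA h₂ h₄)⟩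
    | eraseBlock => cases hs
  | @rel β _ _ _ _ _ hβ ih =>
    cases h with
    | root h =>
      cases h with
      | rel hΦ h =>
        have hα' : β ≠ some c := by
          rintro rfl
          exact hα (hβ.symm.trans (Relabelling.keep_self _ _))
        obtain ⟨Q', h₁, h₂⟩ := ih h hα'
        exact ⟨_, .rel h₁ ((Relabelling.keep_of_ne _ hα').symm.trans hβ), .root (.rel hΦ h₂)⟩
  | fix _ ih =>
    cases h with
    | root h =>
      cases h with
      | fix _ h =>
        obtain ⟨Q', h₁, h₂⟩ := ih (h.unfold _) hα
        exact ⟨_, .fix h₁, h₂⟩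

theorem Erases.ordStep_back {c : B} {Q R R' : RTerm B V} {α : Act B}
    (hs : OrdStep α R R') (h : Erases c true Q R) (hα : α ≠ some c) :
    ∃ Q', OrdStep α Q Q' ∧ Erases c true Q' R' := by
  induction hs generalizing Q with
  | pref _ hμ =>
    cases h with
    | root h =>
      cases h with
      | pref hμ' h => exact ⟨_, .pref _ hμ, h⟩
  | read μ _ ih =>
    cases h with
    | root h =>
      cases h with
      | read hμ h =>
        obtain ⟨Q', h₁, h₂⟩ := ih h hα
        exact ⟨_, .read _ h₁, h₂⟩
    | eraseRead hμ h => exact ih h hα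
  | sumL _ _ ih =>
    cases h with
    | root h =>
      cases h with
      | sum h k =>
        obtain ⟨Q', h₁, h₂⟩ := ih h hα
        exact ⟨_, .sumL _ h₁, h₂⟩
  | sumR _ _ ih =>
    cases h with
    | root h =>
      cases h with
      | sum k h =>
        obtain ⟨Q', h₁, h₂⟩ := ih h hα
        exact ⟨_, .sumR _ h₁, h₂⟩
  | parL _ hA' _ ih =>
    cases h with
    | root h =>
      cases h with
      | par hA h k =>
        obtain ⟨Q', h₁, h₂⟩ := ih h hα
        exact ⟨_, .parL _ ((mem_visible_congr hα hA).not.2 hA') h₁, .root (.par hA h₂ k)⟩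
    | eraseBlock h =>
      obtain ⟨Q', h₁, h₂⟩ := ih h hα
      exact ⟨_, h₁, .eraseBlock h₂⟩
  | parR _ hA' hs ih =>
    cases h with
    | root h =>
      cases h with
      | par hA k h =>
        obtain ⟨Q', h₁, h₂⟩ := ih h hα
        exact ⟨_, .parR _ ((mem_visible_congr hα hA).not.2 hA') h₁, .root (.par hA k h₂)⟩
    | eraseBlock => cases hs
  | sync hA' _ hs ih₁ ih₂ =>
    cases h with
    | root h =>
      cases h with
      | par hA h k =>
        obtain ⟨Q', h₁, h₂⟩ := ih₁ h hα
        obtain ⟨Q'', h₃, h₄⟩ := ih₂ k hα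
        exact ⟨_, .sync ((mem_visible_congr hα hA).2 hA') h₁ h₃, .root (.par hA h₂ h₄)⟩
    | eraseBlock => cases hs
  | syncL hA' _ hs ih =>
    cases h with
    | root h =>
      cases h with
      | par hA h k =>
        obtain ⟨Q', h₁, h₂⟩ := ih h hα
        obtain ⟨Q'', h₃, h₄⟩ := Erases.readStep_back hs k hα
        exact ⟨_, .syncL ((mem_visible_congr hα hA).2 hA') h₁ h₃, .root (.par hA h₂ h₄)⟩
    | eraseBlock => cases hs
  | syncR hA' hs' hs ih =>
    cases h with
    | root h =>
      cases h with
      | par hA h k =>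
        obtain ⟨Q', h₁, h₂⟩ := Erases.readStep_back hs' h hα
        obtain ⟨Q'', h₃, h₄⟩ := ih k hα
        exact ⟨_, .syncR ((mem_visible_congr hα hA).2 hA') h₁ h₃, .root (.par hA h₂ h₄)⟩
    | eraseBlock => cases hs
  | @rel β _ _ _ _ _ hβ ih =>
    cases h with
    | root h =>
      cases h with
      | rel hΦ h =>
        have hα' : β ≠ some c := by
          rintro rfl
          exact hα (hβ.symm.trans (Relabelling.keep_self _ _))
        obtain ⟨Q', h₁, h₂⟩ := ih h hα'
        exact ⟨_, .rel h₁ ((Relabelling.keep_of_ne _ hα').symm.trans hβ), .root (.rel hΦ h₂)⟩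
  | fix _ ih =>
    cases h with
    | root h =>
      cases h with
      | fix _ h =>
        obtain ⟨Q', h₁, h₂⟩ := ih (h.unfold _) hα
        exact ⟨_, .fix h₁, h₂⟩

theorem insert_subset_refusal {Φ : Relabelling B} {c : B} {X : Set B}
    (hΦ : ∀ α, Φ.toFun α = some c → α = some c) :
    (Φ.refusal (insert c X)) ⊆ insert c ((Φ.keep c).refusal X) := by
  intro a ha
  by_cases hac : a = c
  · exact Or.inl hac
  · exact Or.inr ((Relabelling.mem_refusal_keep hac).2
      (Relabelling.mem_refusal_of_ne hΦ subset_rfl hac ha))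

/-- Since c is fresh for `Q`, it can be added to the refusal set whether or not `R` refuses it. -/
theorem Erases.timeStep_back {c : B} {Q R R' : RTerm B V} {X : Set B}
    (hs : TimeStep X R R') (h : Erases c true Q R) :
    ∃ Q', TimeStep (insert c X) Q Q' ∧ Erases c true Q' R' := by
  induction hs generalizing Q with
  | nil =>
    cases h with
    | root h => cases h; exact ⟨_, .nil _, .root .nil⟩
  | prefLazy =>
    cases h with
    | root h =>
      cases h with
      | pref hμ h => exact ⟨_, .prefLazy _ _ _, .root (.pref hμ h)⟩
  | prefUrgent _ hα =>
    cases h with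
    | root h =>
      cases h with
      | pref hμ h =>
        exact ⟨_, .prefUrgent _ (notMem_withTau_insert hμ hα), .root (.pref hμ h)⟩
  | readLazy α _ ih =>
    cases h with
    | root h =>
      cases h with
      | read hμ h =>
        obtain ⟨Q', h₁, h₂⟩ := ih h
        exact ⟨_, .readLazy _ h₁, .root (.read hμ h₂)⟩
    | eraseRead hμ h =>
      obtain ⟨Q', h₁, h₂⟩ := ih h
      exact ⟨_, h₁, .eraseRead hμ h₂⟩
  | readUrgent _ hα ih =>
    cases h with
    | root h =>
      cases h with
      | read hμ h =>
        obtain ⟨Q', h₁, h₂⟩ := ih h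
        exact ⟨_, .readUrgent h₁ (notMem_withTau_insert hμ hα), .root (.read hμ h₂)⟩
    | eraseRead hμ h =>
      obtain ⟨Q', h₁, h₂⟩ := ih h
      exact ⟨_, h₁, .eraseRead hμ h₂⟩
  | sum _ _ ih₁ ih₂ =>
    cases h with
    | root h =>
      cases h with
      | sum h k =>
        obtain ⟨Q', h₁, h₂⟩ := ih₁ h
        obtain ⟨Q'', h₃, h₄⟩ := ih₂ k
        exact ⟨_, .sum h₁ h₃, .root (.sum h₂ h₄)⟩
  | rel _ ih =>
    cases h with
    | root h =>
      cases h with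
      | rel hΦ h =>
        obtain ⟨Q', h₁, h₂⟩ := ih h
        exact ⟨_, .rel (h₁.mono (insert_subset_refusal hΦ)), .root (.rel hΦ h₂)⟩
  | fix _ ih =>
    cases h with
    | root h =>
      cases h with
      | fix _ h =>
        obtain ⟨Q', h₁, h₂⟩ := ih (h.unfold _)
        exact ⟨_, .fix h₁, h₂⟩
  | par _ hs hX ih₁ ih₂ =>
    cases h with
    | root h =>
      cases h with
      | par hA h k =>
        obtain ⟨Q', h₁, h₂⟩ := ih₁ h
        obtain ⟨Q'', h₃, h₄⟩ := ih₂ k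
        refine ⟨_, .par h₁ h₃ ?_, .root (.par hA h₂ h₄)⟩
        intro a ha
        by_cases hac : a = c
        · simp [hac, em]
        · exact mem_par_refusal (hA a hac).symm Or.inr Or.inr (hX (ha.resolve_left hac))
    | eraseBlock h =>
      cases hs
      obtain ⟨Q', h₁, h₂⟩ := ih₁ h
      refine ⟨_, h₁.mono ?_, .eraseBlock h₂⟩
      intro a ha
      by_cases hac : a = c
      · exact Or.inl hac
      · rcases hX (ha.resolve_left hac) with h | h
        · exact absurd h.1 hac
        · exact Or.inr h.1.1

/-! ### Blocking an action -/

/-- A sufficient condition for a term never to perform `c`, whatever the meaning of its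
variables. -/
def Blocked (c : B) : RTerm B V → Prop
  | nil => True
  | var _ => False
  | pref μ P => μ.act ≠ some c ∧ P.Blocked c
  | read μ Q => μ.act ≠ some c ∧ Q.Blocked c
  | sum Q₁ Q₂ => Q₁.Blocked c ∧ Q₂.Blocked c
  | par A Q₁ Q₂ => (c ∈ A ∧ (Q₁.Blocked c ∨ Q₂.Blocked c)) ∨ (Q₁.Blocked c ∧ Q₂.Blocked c)
  | rel Q Φ => (∀ α, Φ.toFun α = some c → α = some c) ∧ Q.Blocked c
  | fix _ Q => Q.Blocked c

/-- No condition on `S` is needed: a variable is not itself blocked, so it can occur only in a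
parallel component whose partner blocks c by synchronisation. -/
theorem Blocked.subst {c : B} {Q : RTerm B V} (x : V) (S : RTerm B V) (h : Q.Blocked c) :
    (subst x S Q).Blocked c := by
  induction Q with
  | nil => exact h
  | var => exact h.elim
  | pref μ P ih => exact ⟨h.1, ih h.2⟩
  | read μ P ih => exact ⟨h.1, ih h.2⟩
  | sum P Q ihP ihQ => exact ⟨ihP h.1, ihQ h.2⟩
  | par A P Q ihP ihQ => exact h.imp (And.imp_right (Or.imp ihP ihQ)) (And.imp ihP ihQ)
  | rel Q Φ ih => exact ⟨h.1, ih h.2⟩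
  | fix y Q ih =>
    by_cases hy : y = x
    · simpa [RTerm.subst, hy] using h
    · simp only [RTerm.subst, hy, if_false]
      exact ih h

theorem Blocked.unfold {c : B} {x : V} {Q : RTerm B V} (h : (RTerm.fix x Q).Blocked c) :
    (RTerm.subst x (.fix x Q) Q).Blocked c :=
  Blocked.subst (Q := Q) x _ h

theorem ne_some_of_notMem_visible {α : Act B} {A : Set B} {c : B} (hα : α ∉ visible A)
    (hc : c ∈ A) : α ≠ some c := by
  rintro rfl
  exact hα (some_mem_visible.2 hc)

theorem Blocked.readStep {c : B} {α : Act B} {R R' : RTerm B V} (hs : ReadStep α R R')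
    (h : R.Blocked c) : α ≠ some c ∧ R'.Blocked c := by
  induction hs with
  | read₁ _ hμ => exact ⟨hμ ▸ h.1, h⟩
  | read₂ _ _ ih => exact ⟨(ih h.2).1, h.1, (ih h.2).2⟩
  | sumL _ _ ih => exact ⟨(ih h.1).1, (ih h.1).2, h.2⟩
  | sumR _ _ ih => exact ⟨(ih h.2).1, h.1, (ih h.2).2⟩
  | parL _ hA _ ih =>
    have := ne_some_of_notMem_visible (c := c) hA
    simp only [Blocked] at *
    tauto
  | parR _ hA _ ih =>
    have := ne_some_of_notMem_visible (c := c) hA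
    simp only [Blocked] at *
    tauto
  | sync hA _ _ ih₁ ih₂ =>
    simp only [Blocked] at *
    tauto
  | rel _ hβ ih => exact ⟨fun e => (ih h.2).1 (h.1 _ (hβ.trans e)), h.1, (ih h.2).2⟩
  | fix _ ih => exact ih h.unfold

theorem Blocked.ordStep {c : B} {α : Act B} {R R' : RTerm B V} (hs : OrdStep α R R')
    (h : R.Blocked c) : α ≠ some c ∧ R'.Blocked c := by
  induction hs with
  | pref _ hμ => exact ⟨hμ ▸ h.1, h.2⟩
  | read _ _ ih => exact ih h.2
  | sumL _ _ ih => exact ih h.1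
  | sumR _ _ ih => exact ih h.2
  | parL _ hA _ ih =>
    have := ne_some_of_notMem_visible (c := c) hA
    simp only [Blocked] at *
    tauto
  | parR _ hA _ ih =>
    have := ne_some_of_notMem_visible (c := c) hA
    simp only [Blocked] at *
    tauto
  | sync hA _ _ ih₁ ih₂ =>
    simp only [Blocked] at *
    tauto
  | syncL hA _ hs ih =>
    have := Blocked.readStep (c := c) hs
    simp only [Blocked] at *
    tauto
  | syncR hA hs _ ih =>
    have := Blocked.readStep (c := c) hs
    simp only [Blocked] at *
    tauto
  | rel _ hβ ih => exact ⟨fun e => (ih h.2).1 (h.1 _ (hβ.trans e)), h.1, (ih h.2).2⟩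
  | fix _ ih => exact ih h.unfold

/-- In a composition synchronising on c, one blocked component suffices to refuse c; the other may
keep an urgent c. -/
theorem Blocked.timeStep {c : B} {X : Set B} {R R' : RTerm B V} (hs : TimeStep X R R')
    (h : R.Blocked c) : TimeStep (insert c X) R R' ∧ R'.Blocked c := by
  induction hs with
  | nil => exact ⟨.nil _, h⟩
  | prefLazy => exact ⟨.prefLazy _ _ _, h⟩
  | prefUrgent _ hα => exact ⟨.prefUrgent _ (notMem_withTau_insert h.1 hα), h⟩
  | readLazy α _ ih => exact ⟨.readLazy _ (ih h.2).1, h.1, (ih h.2).2⟩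
  | readUrgent _ hα ih =>
    exact ⟨.readUrgent (ih h.2).1 (notMem_withTau_insert h.1 hα), h.1, (ih h.2).2⟩
  | sum _ _ ih₁ ih₂ =>
    exact ⟨.sum (ih₁ h.1).1 (ih₂ h.2).1, (ih₁ h.1).2, (ih₂ h.2).2⟩
  | @rel X Φ Q _ _ ih =>
    refine ⟨.rel ((ih h.2).1.mono fun a ha => ?_), h.1, (ih h.2).2⟩
    by_cases hac : a = c
    · exact Or.inl hac
    · exact Or.inr (Relabelling.mem_refusal_of_ne h.1 subset_rfl hac ha)
  | fix _ ih => exact ⟨.fix (ih h.unfold).1, (ih h.unfold).2⟩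
  | par hs₁ hs₂ hX ih₁ ih₂ =>
    rcases h with ⟨hA, h | h⟩ | ⟨h₁, h₂⟩
    · refine ⟨.par (ih₁ h).1 hs₂ ?_, Or.inl ⟨hA, Or.inl (ih₁ h).2⟩⟩
      rintro a (rfl | ha)
      · exact Or.inl ⟨hA, Or.inl (Or.inl rfl)⟩
      · exact mem_par_refusal Iff.rfl Or.inr id (hX ha)
    · refine ⟨.par hs₁ (ih₂ h).1 ?_, Or.inl ⟨hA, Or.inr (ih₂ h).2⟩⟩
      rintro a (rfl | ha)
      · exact Or.inl ⟨hA, Or.inr (Or.inl rfl)⟩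
      · exact mem_par_refusal Iff.rfl id Or.inr (hX ha)
    · refine ⟨.par (ih₁ h₁).1 (ih₂ h₂).1 ?_, Or.inr ⟨(ih₁ h₁).2, (ih₂ h₂).2⟩⟩
      rintro a (rfl | ha)
      · simp [em]
      · exact mem_par_refusal Iff.rfl Or.inr Or.inr (hX ha)

/-! ### Terms that additionally offer a fresh read -/

/-- `Marked c t s Q R`: the action `c` is fresh for `Q`, and `R` behaves like `Q`, except that
it offers `c` as a reading action with the timing of `t` in case `s = true`. -/
inductive Marked (c : B) (t : TAct B) : Bool → RTerm B V → RTerm B V → Prop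
  | dead {Q R : RTerm B V} : Erases c true Q R → R.Blocked c → Marked c t false Q R
  | live {Q R : RTerm B V} : Erases c true Q R → R.Blocked c → Marked c t true Q (read t R)
  | par {s₁ s₂ : Bool} (A : Set B) {Q₁ Q₂ R₁ R₂ : RTerm B V} : Marked c t s₁ Q₁ R₁ →
      Marked c t s₂ Q₂ R₂ → Marked c t (s₁ && s₂) (par A Q₁ Q₂) (par (insert c A) R₁ R₂)
  | rel {s : Bool} {Φ : Relabelling B} {Q R : RTerm B V} :
      (∀ α, Φ.toFun α = some c → α = some c) → Marked c t s Q R →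
      Marked c t s (rel Q Φ) (rel R (Φ.keep c))
  | unfoldL {s : Bool} {x : V} {Q R : RTerm B V} : Marked c t s (RTerm.subst x (fix x Q) Q) R →
      Marked c t s (fix x Q) R
  | unfoldR {s : Bool} {x : V} {Q R : RTerm B V} : Marked c t s Q (RTerm.subst x (fix x R) R) →
      Marked c t s Q (fix x R)

theorem Marked.readStep_forth {c : B} {t : TAct B} {s : Bool} {Q R Q' : RTerm B V} {α : Act B}
    (h : Marked c t s Q R) (hs : ReadStep α Q Q') :
    α ≠ some c ∧ ∃ R', ReadStep α R R' ∧ Marked c t s Q' R' := by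
  induction h generalizing α Q' with
  | dead hE hB =>
    obtain ⟨hα, R', h, hE⟩ := Erases.readStep_forth hs hE
    exact ⟨hα, R', h, .dead hE (hB.readStep h).2⟩
  | live hE hB =>
    obtain ⟨hα, R', h, hE⟩ := Erases.readStep_forth hs hE
    exact ⟨hα, _, .read₂ _ h, .live hE (hB.readStep h).2⟩
  | par A k₁ k₂ ih₁ ih₂ =>
    cases hs with
    | parL _ hA hs =>
      obtain ⟨hα, R', h, k⟩ := ih₁ hs
      exact ⟨hα, _, .parL _ ((mem_visible_insert hα).not.1 hA) h, .par A k k₂⟩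
    | parR _ hA hs =>
      obtain ⟨hα, R', h, k⟩ := ih₂ hs
      exact ⟨hα, _, .parR _ ((mem_visible_insert hα).not.1 hA) h, .par A k₁ k⟩
    | sync hA hs hs' =>
      obtain ⟨hα, R', h, k⟩ := ih₁ hs
      obtain ⟨-, R'', h', k'⟩ := ih₂ hs'
      exact ⟨hα, _, .sync ((mem_visible_insert hα).1 hA) h h', .par A k k'⟩
  | rel hΦ _ ih =>
    cases hs with
    | rel hs hβ =>
      obtain ⟨hα, R', h, k⟩ := ih hs
      exact ⟨fun e => hα (hΦ _ (hβ.trans e)), _,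
        .rel h ((Relabelling.keep_of_ne _ hα).trans hβ), .rel hΦ k⟩
  | unfoldL _ ih =>
    cases hs with
    | fix hs => exact ih hs
  | unfoldR _ ih =>
    obtain ⟨hα, R', h, k⟩ := ih hs
    exact ⟨hα, R', .fix h, k⟩

/-- An ordinary transition kills the offer of c. In a parallel composition the partner may remain
live, but the conjunction of the flags is false, since synchronisation on c needs both sides. -/
theorem Marked.ordStep_forth {c : B} {t : TAct B} {s : Bool} {Q R Q' : RTerm B V} {α : Act B}
    (h : Marked c t s Q R) (hs : OrdStep α Q Q') :
    α ≠ some c ∧ ∃ R', OrdStep α R R' ∧ Marked c t false Q' R' := by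
  induction h generalizing α Q' with
  | dead hE hB =>
    obtain ⟨hα, R', h, hE⟩ := Erases.ordStep_forth hs hE
    exact ⟨hα, R', h, .dead hE (hB.ordStep h).2⟩
  | live hE hB =>
    obtain ⟨hα, R', h, hE⟩ := Erases.ordStep_forth hs hE
    exact ⟨hα, _, .read _ h, .dead hE (hB.ordStep h).2⟩
  | par A k₁ k₂ ih₁ ih₂ =>
    cases hs with
    | parL _ hA hs =>
      obtain ⟨hα, R', h, k⟩ := ih₁ hs
      exact ⟨hα, _, .parL _ ((mem_visible_insert hα).not.1 hA) h, .par A k k₂⟩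
    | parR _ hA hs =>
      obtain ⟨hα, R', h, k⟩ := ih₂ hs
      exact ⟨hα, _, .parR _ ((mem_visible_insert hα).not.1 hA) h,
        Bool.and_false _ ▸ Marked.par A k₁ k⟩
    | sync hA hs hs' =>
      obtain ⟨hα, R', h, k⟩ := ih₁ hs
      obtain ⟨-, R'', h', k'⟩ := ih₂ hs'
      exact ⟨hα, _, .sync ((mem_visible_insert hα).1 hA) h h', .par A k k'⟩
    | syncL hA hs hs' =>
      obtain ⟨hα, R', h, k⟩ := ih₁ hs
      obtain ⟨-, R'', h', k'⟩ := k₂.readStep_forth hs'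
      exact ⟨hα, _, .syncL ((mem_visible_insert hα).1 hA) h h', .par A k k'⟩
    | syncR hA hs hs' =>
      obtain ⟨hα, R', h, k⟩ := k₁.readStep_forth hs
      obtain ⟨-, R'', h', k'⟩ := ih₂ hs'
      exact ⟨hα, _, .syncR ((mem_visible_insert hα).1 hA) h h',
        Bool.and_false _ ▸ Marked.par A k k'⟩
  | rel hΦ _ ih =>
    cases hs with
    | rel hs hβ =>
      obtain ⟨hα, R', h, k⟩ := ih hs
      exact ⟨fun e => hα (hΦ _ (hβ.trans e)), _,
        .rel h ((Relabelling.keep_of_ne _ hα).trans hβ), .rel hΦ k⟩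
  | unfoldL _ ih =>
    cases hs with
    | fix hs => exact ih hs
  | unfoldR _ ih =>
    obtain ⟨hα, R', h, k⟩ := ih hs
    exact ⟨hα, R', .fix h, k⟩

/-- The only surplus transitions of `R` are reads of c. As c lies in every synchronisation set
passed, they require all leaves to be live. -/
theorem Marked.readStep_back {c : B} {t : TAct B} (ht : t.act = some c) {s : Bool}
    {Q R R' : RTerm B V} {α : Act B} (h : Marked c t s Q R) (hs : ReadStep α R R') :
    (α ≠ some c ∧ ∃ Q', ReadStep α Q Q' ∧ Marked c t s Q' R') ∨
      (α = some c ∧ s = true ∧ Marked c t s Q R') := by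
  induction h generalizing α R' with
  | dead hE hB =>
    obtain ⟨hα, hB⟩ := hB.readStep hs
    obtain ⟨Q', h, hE⟩ := hE.readStep_back hs hα
    exact Or.inl ⟨hα, Q', h, .dead hE hB⟩
  | live hE hB =>
    cases hs with
    | read₁ _ hα => exact Or.inr ⟨hα.symm.trans ht, rfl, .live hE hB⟩
    | read₂ _ hs =>
      obtain ⟨hα, hB⟩ := hB.readStep hs
      obtain ⟨Q', h, hE⟩ := hE.readStep_back hs hα
      exact Or.inl ⟨hα, Q', h, .live hE hB⟩
  | par A k₁ k₂ ih₁ ih₂ =>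
    have hc : some c ∈ visible (insert c A) := some_mem_visible.2 (Or.inl rfl)
    cases hs with
    | parL _ hA hs =>
      rcases ih₁ hs with ⟨hα, Q', h, k⟩ | ⟨rfl, -⟩
      · exact Or.inl ⟨hα, _, .parL _ ((mem_visible_insert hα).not.2 hA) h, .par A k k₂⟩
      · exact absurd hc hA
    | parR _ hA hs =>
      rcases ih₂ hs with ⟨hα, Q', h, k⟩ | ⟨rfl, -⟩
      · exact Or.inl ⟨hα, _, .parR _ ((mem_visible_insert hα).not.2 hA) h, .par A k₁ k⟩
      · exact absurd hc hA
    | sync hA hs hs' =>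
      rcases ih₁ hs with ⟨hα, Q', h, k⟩ | ⟨rfl, rfl, k⟩
      · rcases ih₂ hs' with ⟨-, Q'', h', k'⟩ | ⟨h', -⟩
        · exact Or.inl ⟨hα, _, .sync ((mem_visible_insert hα).2 hA) h h', .par A k k'⟩
        · exact absurd h' hα
      · rcases ih₂ hs' with ⟨h', -⟩ | ⟨-, rfl, k'⟩
        · exact absurd rfl h'
        · exact Or.inr ⟨rfl, rfl, .par A k k'⟩
  | rel hΦ _ ih =>
    cases hs with
    | rel hs hβ =>
      rcases ih hs with ⟨hα, Q', h, k⟩ | ⟨rfl, rfl, k⟩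
      · rw [Relabelling.keep_of_ne _ hα] at hβ
        exact Or.inl ⟨fun e => hα (hΦ _ (hβ.trans e)), _, .rel h hβ, .rel hΦ k⟩
      · rw [Relabelling.keep_self] at hβ
        exact Or.inr ⟨hβ.symm, rfl, .rel hΦ k⟩
  | unfoldL _ ih =>
    rcases ih hs with ⟨hα, Q', h, k⟩ | ⟨hα, e, k⟩
    · exact Or.inl ⟨hα, Q', .fix h, k⟩
    · exact Or.inr ⟨hα, e, .unfoldL k⟩
  | unfoldR _ ih =>
    cases hs with
    | fix hs => exact ih hs

theorem Marked.ordStep_back {c : B} {t : TAct B} (ht : t.act = some c) {s : Bool}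
    {Q R R' : RTerm B V} {α : Act B} (h : Marked c t s Q R) (hs : OrdStep α R R') :
    α ≠ some c ∧ ∃ Q', OrdStep α Q Q' ∧ Marked c t false Q' R' := by
  induction h generalizing α R' with
  | dead hE hB =>
    obtain ⟨hα, hB⟩ := hB.ordStep hs
    obtain ⟨Q', h, hE⟩ := hE.ordStep_back hs hα
    exact ⟨hα, Q', h, .dead hE hB⟩
  | live hE hB =>
    cases hs with
    | read _ hs =>
      obtain ⟨hα, hB⟩ := hB.ordStep hs
      obtain ⟨Q', h, hE⟩ := hE.ordStep_back hs hα
      exact ⟨hα, Q', h, .dead hE hB⟩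
  | par A k₁ k₂ ih₁ ih₂ =>
    cases hs with
    | parL _ hA hs =>
      obtain ⟨hα, Q', h, k⟩ := ih₁ hs
      exact ⟨hα, _, .parL _ ((mem_visible_insert hα).not.2 hA) h, .par A k k₂⟩
    | parR _ hA hs =>
      obtain ⟨hα, Q', h, k⟩ := ih₂ hs
      exact ⟨hα, _, .parR _ ((mem_visible_insert hα).not.2 hA) h,
        Bool.and_false _ ▸ Marked.par A k₁ k⟩
    | sync hA hs hs' =>
      obtain ⟨hα, Q', h, k⟩ := ih₁ hs
      obtain ⟨-, Q'', h', k'⟩ := ih₂ hs'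
      exact ⟨hα, _, .sync ((mem_visible_insert hα).2 hA) h h', .par A k k'⟩
    | syncL hA hs hs' =>
      obtain ⟨hα, Q', h, k⟩ := ih₁ hs
      rcases k₂.readStep_back ht hs' with ⟨-, Q'', h', k'⟩ | ⟨h', -⟩
      · exact ⟨hα, _, .syncL ((mem_visible_insert hα).2 hA) h h', .par A k k'⟩
      · exact absurd h' hα
    | syncR hA hs hs' =>
      obtain ⟨hα, Q'', h', k'⟩ := ih₂ hs'
      rcases k₁.readStep_back ht hs with ⟨-, Q', h, k⟩ | ⟨h, -⟩
      · exact ⟨hα, _, .syncR ((mem_visible_insert hα).2 hA) h h',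
          Bool.and_false _ ▸ Marked.par A k k'⟩
      · exact absurd h hα
  | rel hΦ _ ih =>
    cases hs with
    | rel hs hβ =>
      obtain ⟨hα, Q', h, k⟩ := ih hs
      rw [Relabelling.keep_of_ne _ hα] at hβ
      exact ⟨fun e => hα (hΦ _ (hβ.trans e)), _, .rel h hβ, .rel hΦ k⟩
  | unfoldL _ ih =>
    obtain ⟨hα, Q', h, k⟩ := ih hs
    exact ⟨hα, Q', .fix h, k⟩
  | unfoldR _ ih =>
    cases hs with
    | fix hs => exact ih hs

/-- All leaves read c at once. The target may differ from `R` because the transition unfolds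
recursions, which is why `Marked` admits unfolding on each side independently. -/
theorem Marked.exists_readStep {c : B} {t : TAct B} (ht : t.act = some c) {s : Bool}
    {Q R : RTerm B V} (h : Marked c t s Q R) (hs : s = true) :
    ∃ R', ReadStep (some c) R R' ∧ Marked c t s Q R' := by
  induction h with
  | dead => cases hs
  | live hE hB => exact ⟨_, .read₁ _ ht, .live hE hB⟩
  | par A k₁ k₂ ih₁ ih₂ =>
    rw [Bool.and_eq_true] at hs
    obtain ⟨R', h, k⟩ := ih₁ hs.1
    obtain ⟨R'', h', k'⟩ := ih₂ hs.2
    exact ⟨_, .sync (some_mem_visible.2 (Or.inl rfl)) h h', .par A k k'⟩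
  | rel hΦ _ ih =>
    obtain ⟨R', h, k⟩ := ih hs
    exact ⟨_, .rel h (Relabelling.keep_self _ _), .rel hΦ k⟩
  | unfoldL _ ih =>
    obtain ⟨R', h, k⟩ := ih hs
    exact ⟨R', h, .unfoldL k⟩
  | unfoldR _ ih =>
    obtain ⟨R', h, k⟩ := ih hs
    exact ⟨R', .fix h, k⟩

/-- `R` may refuse c unless c is on offer and urgent. Afterwards the offer is urgent in any case. -/
theorem Marked.timeStep_forth {c : B} {t : TAct B} (ht : t.act = some c) {s : Bool}
    {Q R Q' : RTerm B V} {X Y : Set B} (h : Marked c t s Q R) (hs : TimeStep X Q Q')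
    (hY : Y ⊆ insert c X) (hc : c ∈ Y → s = false ∨ t.IsLazy) :
    ∃ R', TimeStep Y R R' ∧ Marked c (.urgent (some c)) s Q' R' := by
  induction h generalizing X Y Q' with
  | dead hE hB =>
    obtain ⟨R', h, hE⟩ := Erases.timeStep_forth hs hE
    obtain ⟨h, hB⟩ := hB.timeStep h
    refine ⟨R', h.mono ?_, .dead hE hB⟩
    simpa using hY
  | live hE hB =>
    obtain ⟨R', h, hE⟩ := Erases.timeStep_forth hs hE
    obtain ⟨h, hB⟩ := hB.timeStep h
    refine ⟨_, timeStep_read.2 ⟨R', rfl, h.mono (by simpa using hY), ?_⟩,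
      ht ▸ .live hE hB⟩
    rintro α rfl
    change α = some c at ht
    rw [ht, some_mem_withTau]
    exact fun h => (hc h).elim (by simp) id
  | @par s₁ s₂ A _ _ _ _ k₁ k₂ ih₁ ih₂ =>
    cases hs with
    | @par _ X₁ X₂ _ _ _ _ _ hs₁ hs₂ hX =>
      -- Each component is made to refuse c whenever it can. If the offer is lazy or the conjunction
      -- of the flags is false, at least one component does, which suffices as c is synchronised.
      obtain ⟨R', h, k⟩ := ih₁ (Y := (X₁ \ {c}) ∪ {a | a = c ∧ (s₁ = false ∨ t.IsLazy)}) hs₁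
        (by
          rintro a (h | h)
          · exact Or.inr h.1
          · exact Or.inl h.1)
        (by
          rintro (h | h)
          · exact absurd rfl h.2
          · exact h.2)
      obtain ⟨R'', h', k'⟩ := ih₂ (Y := (X₂ \ {c}) ∪ {a | a = c ∧ (s₂ = false ∨ t.IsLazy)}) hs₂
        (by
          rintro a (h | h)
          · exact Or.inr h.1
          · exact Or.inl h.1)
        (by
          rintro (h | h)
          · exact absurd rfl h.2
          · exact h.2)
      refine ⟨_, .par h h' ?_, .par A k k'⟩
      intro a ha
      by_cases hac : a = c
      · subst hac
        have := hc ha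
        rw [Bool.and_eq_false_iff] at this
        refine Or.inl ⟨Or.inl rfl, ?_⟩
        rcases this with (h | h) | h
        · exact Or.inl (Or.inr ⟨rfl, Or.inl h⟩)
        · exact Or.inr (Or.inr ⟨rfl, Or.inl h⟩)
        · exact Or.inl (Or.inr ⟨rfl, Or.inr h⟩)
      · exact mem_par_refusal (by simp [hac]) (fun h => Or.inl ⟨h, hac⟩)
          (fun h => Or.inl ⟨h, hac⟩) (hX ((hY ha).resolve_left hac))
  | @rel _ Φ _ _ hΦ _ ih =>
    cases hs with
    | rel hs =>
      obtain ⟨R', h, k⟩ := ih (Y := (Φ.keep c).refusal Y) hs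
        (by
          intro a ha
          by_cases hac : a = c
          · exact Or.inl hac
          · exact Or.inr (Relabelling.mem_refusal_of_ne hΦ hY hac
              ((Relabelling.mem_refusal_keep hac).1 ha)))
        (fun h => hc (Relabelling.self_mem_refusal_keep.1 h))
      exact ⟨_, .rel h, .rel hΦ k⟩
  | unfoldL _ ih =>
    cases hs with
    | fix hs => exact ih hs hY hc
  | unfoldR _ ih =>
    obtain ⟨R', h, k⟩ := ih hs hY hc
    exact ⟨R', .fix h, k⟩

theorem Marked.timeStep_back {c : B} {t : TAct B} (ht : t.act = some c) {s : Bool}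
    {Q R R' : RTerm B V} {Y : Set B} (h : Marked c t s Q R) (hs : TimeStep Y R R') :
    (c ∈ Y → s = false ∨ t.IsLazy) ∧
      ∃ Q', TimeStep (insert c Y) Q Q' ∧ Marked c (.urgent (some c)) s Q' R' := by
  induction h generalizing Y R' with
  | dead hE hB =>
    obtain ⟨Q', h, hE⟩ := hE.timeStep_back hs
    exact ⟨fun _ => Or.inl rfl, Q', h, .dead hE (hB.timeStep hs).2⟩
  | live hE hB =>
    obtain ⟨R₁, rfl, hs, hμ⟩ := timeStep_read.1 hs
    obtain ⟨Q', h, hE⟩ := hE.timeStep_back hs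
    refine ⟨fun hc => Or.inr ?_, Q', h, ht ▸ .live hE (hB.timeStep hs).2⟩
    cases t with
    | lazy => trivial
    | urgent α =>
      change α = some c at ht
      exact absurd (ht ▸ some_mem_withTau.2 hc) (hμ α rfl)
  | @par s₁ s₂ A _ _ _ _ k₁ k₂ ih₁ ih₂ =>
    cases hs with
    | par hs₁ hs₂ hX =>
      obtain ⟨hc₁, Q', h, k⟩ := ih₁ hs₁
      obtain ⟨hc₂, Q'', h', k'⟩ := ih₂ hs₂
      refine ⟨fun hc => ?_, _, .par h h' ?_, .par A k k'⟩
      · rw [Bool.and_eq_false_iff]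
        rcases hX hc with ⟨-, h | h⟩ | ⟨⟨h, -⟩, -⟩
        · exact (hc₁ h).imp Or.inl id
        · exact (hc₂ h).imp Or.inr id
        · exact (hc₁ h).imp Or.inl id
      · intro a ha
        by_cases hac : a = c
        · simp [hac, em]
        · exact mem_par_refusal (by simp [hac]) Or.inr Or.inr (hX (ha.resolve_left hac))
  | rel hΦ _ ih =>
    cases hs with
    | rel hs =>
      obtain ⟨hc, Q', h, k⟩ := ih hs
      exact ⟨fun h => hc (Relabelling.self_mem_refusal_keep.2 h), _,
        .rel (h.mono (insert_subset_refusal hΦ)), .rel hΦ k⟩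
  | unfoldL _ ih =>
    obtain ⟨hc, Q', h, k⟩ := ih hs
    exact ⟨hc, Q', .fix h, k⟩
  | unfoldR _ ih =>
    cases hs with
    | fix hs => exact ih hs

end RTerm

/-! ### Renaming the fresh read -/

namespace RTerm

variable {V : Type v}

/-- Renaming c turns the surplus read of `R` into the read of μ. Refusals agree because c lies in
the refusal set passed to `R` exactly when the action of μ is refused or internal. -/
theorem Marked.readBisimilar [DecidableEq V] {c : B} {μ : TAct B} {Q R : RTerm B V}
    (h : Marked c (μ.withAct c) true Q R) :
    ReadBisimilar (RTerm.read μ Q) (RTerm.rel R (renameAct c μ.act)) := by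
  obtain ⟨α, hα⟩ : ∃ α, μ.act = α := ⟨_, rfl⟩
  rw [hα]
  have hren : ∀ {X : Set B} {a : B}, a ≠ c → (a ∈ (renameAct c α).refusal X ↔ a ∈ X) := by
    intro X a ha
    rw [Relabelling.mem_refusal, renameAct_of_ne (by simpa using ha), some_mem_withTau]
  have hren' : ∀ {X : Set B}, c ∈ (renameAct c α).refusal X ↔ α ∈ withTau X := by
    intro X
    rw [Relabelling.mem_refusal, renameAct_self]
  have hsub : ∀ {X : Set B}, (renameAct c α).refusal X ⊆ insert c X := by
    intro X a ha
    by_cases hac : a = c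
    · exact Or.inl hac
    · exact Or.inr ((hren hac).1 ha)
  have hsub' : ∀ {X : Set B}, X ⊆ insert c ((renameAct c α).refusal X) := by
    intro X a ha
    by_cases hac : a = c
    · exact Or.inl hac
    · exact Or.inr ((hren hac).2 ha)
  -- The first family describes the states in which the read prefix is present, the second those
  -- after it was discarded by an ordinary transition. The prefix is quantified, since time makes it
  -- urgent.
  let ρ : RTerm B V → RTerm B V → Prop := fun P S =>
    (∃ μ Q R, μ.act = α ∧ P = RTerm.read μ Q ∧ S = RTerm.rel R (renameAct c α) ∧
      Marked c (μ.withAct c) true Q R) ∨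
    ∃ t R, t.act = some c ∧ S = RTerm.rel R (renameAct c α) ∧ Marked c t false P R
  refine ⟨ρ, ⟨?_, ?_, ?_, ?_, ?_, ?_⟩, Or.inl ⟨μ, Q, R, hα, rfl, rfl, h⟩⟩
  · rintro P S (⟨μ, Q, R, hμ, rfl, rfl, h⟩ | ⟨t, R, ht, rfl, h⟩) β P' hs
    · cases hs with
      | read _ hs =>
        obtain ⟨hβ, R', hs, h⟩ := h.ordStep_forth hs
        exact ⟨_, .rel hs (renameAct_of_ne hβ), Or.inr ⟨_, R', μ.act_withAct c, rfl, h⟩⟩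
    · obtain ⟨hβ, R', hs, h⟩ := h.ordStep_forth hs
      exact ⟨_, .rel hs (renameAct_of_ne hβ), Or.inr ⟨_, R', ht, rfl, h⟩⟩
  · rintro P S (⟨μ, Q, R, hμ, rfl, rfl, h⟩ | ⟨t, R, ht, rfl, h⟩) β S' hs
    · cases hs with
      | rel hs hβ' =>
        obtain ⟨hβ, Q', hs, h⟩ := h.ordStep_back (μ.act_withAct c) hs
        rw [renameAct_of_ne hβ] at hβ'
        exact ⟨_, .read _ (hβ' ▸ hs), Or.inr ⟨_, _, μ.act_withAct c, rfl, h⟩⟩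
    · cases hs with
      | rel hs hβ' =>
        obtain ⟨hβ, Q', hs, h⟩ := h.ordStep_back ht hs
        rw [renameAct_of_ne hβ] at hβ'
        exact ⟨_, hβ' ▸ hs, Or.inr ⟨_, _, ht, rfl, h⟩⟩
  · rintro P S (⟨μ, Q, R, hμ, rfl, rfl, h⟩ | ⟨t, R, ht, rfl, h⟩) β P' hs
    · cases hs with
      | read₁ _ hβ =>
        obtain ⟨R', hs, h⟩ := h.exists_readStep (μ.act_withAct c) rfl
        exact ⟨_, .rel hs ((renameAct_self c α).trans (hμ.symm.trans hβ)),
          Or.inl ⟨μ, Q, R', hμ, rfl, rfl, h⟩⟩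
      | read₂ _ hs =>
        obtain ⟨hβ, R', hs, h⟩ := h.readStep_forth hs
        exact ⟨_, .rel hs (renameAct_of_ne hβ), Or.inl ⟨_, _, R', hμ, rfl, rfl, h⟩⟩
    · obtain ⟨hβ, R', hs, h⟩ := h.readStep_forth hs
      exact ⟨_, .rel hs (renameAct_of_ne hβ), Or.inr ⟨_, R', ht, rfl, h⟩⟩
  · rintro P S (⟨μ, Q, R, hμ, rfl, rfl, h⟩ | ⟨t, R, ht, rfl, h⟩) β S' hs
    · cases hs with
      | rel hs hβ' =>
        rcases h.readStep_back (μ.act_withAct c) hs with ⟨hβ, Q', hs, h⟩ | ⟨rfl, -, h⟩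
        · rw [renameAct_of_ne hβ] at hβ'
          exact ⟨_, .read₂ _ (hβ' ▸ hs), Or.inl ⟨_, _, _, hμ, rfl, rfl, h⟩⟩
        · rw [renameAct_self] at hβ'
          exact ⟨_, .read₁ _ (hμ.trans hβ'), Or.inl ⟨_, _, _, hμ, rfl, rfl, h⟩⟩
    · cases hs with
      | rel hs hβ' =>
        rcases h.readStep_back ht hs with ⟨hβ, Q', hs, h⟩ | ⟨-, hf, -⟩
        · rw [renameAct_of_ne hβ] at hβ'
          exact ⟨_, hβ' ▸ hs, Or.inr ⟨_, _, ht, rfl, h⟩⟩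
        · cases hf
  · rintro P S (⟨μ, Q, R, hμ, rfl, rfl, h⟩ | ⟨t, R, ht, rfl, h⟩) X P' hs
    · obtain ⟨Q', rfl, hs, hX⟩ := timeStep_read.1 hs
      obtain ⟨R', hs, h⟩ := h.timeStep_forth (μ.act_withAct c) hs hsub fun hc => by
        refine Or.inr ?_
        cases μ with
        | lazy => trivial
        | urgent β =>
          change β = α at hμ
          exact absurd (hren'.1 hc) (hμ ▸ hX β rfl)
      exact ⟨_, .rel hs, Or.inl ⟨.urgent μ.act, Q', R', hμ, rfl, rfl, h⟩⟩
    · obtain ⟨R', hs, h⟩ := h.timeStep_forth ht hs hsub fun _ => Or.inl rfl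
      exact ⟨_, .rel hs, Or.inr ⟨_, R', rfl, rfl, h⟩⟩
  · rintro P S (⟨μ, Q, R, hμ, rfl, rfl, h⟩ | ⟨t, R, ht, rfl, h⟩) X S' hs
    · cases hs with
      | rel hs =>
        obtain ⟨hc, Q', hs, h⟩ := h.timeStep_back (μ.act_withAct c) hs
        refine ⟨_, timeStep_read.2 ⟨Q', rfl, hs.mono hsub', ?_⟩,
          Or.inl ⟨.urgent μ.act, Q', _, hμ, rfl, rfl, h⟩⟩
        rintro β rfl hβ
        exact (hc (hren'.2 (hμ ▸ hβ))).elim (by simp) id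
    · cases hs with
      | rel hs =>
        obtain ⟨-, Q', hs, h⟩ := h.timeStep_back ht hs
        exact ⟨Q', hs.mono hsub', Or.inr ⟨_, _, rfl, rfl, h⟩⟩

/-! Distributing a read prefix -/

/-- The term in which the fresh action `c` is kept by all relabellings, and is blocked in all
processes substituted for variables. -/
noncomputable def protect (c : B) : RTerm B V → RTerm B V
  | nil => nil
  | var x => par {c} (var x) nil
  | pref μ P => pref μ (P.protect c)
  | read μ Q => read μ (Q.protect c)
  | sum Q₁ Q₂ => sum (Q₁.protect c) (Q₂.protect c)
  | par A Q₁ Q₂ => par A (Q₁.protect c) (Q₂.protect c)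
  | rel Q Φ => rel (Q.protect c) (Φ.keep c)
  | fix x Q => fix x (Q.protect c)

open Classical in
/-- Distributing the read prefix `t` of a fresh action `c` over parallel compositions,
relabellings and recursions. -/
noncomputable def distribute (c : B) (t : TAct B) : RTerm B V → RTerm B V
  | par A Q₁ Q₂ => par (insert c A) (Q₁.distribute c t) (Q₂.distribute c t)
  | rel Q Φ => rel (Q.distribute c t) (Φ.keep c)
  | fix x Q => if Q.ReadGuarded then read t (fix x (Q.protect c)) else fix x (Q.distribute c t)
  | nil => read t (protect c nil)
  | var x => read t (protect c (var x))
  | pref μ P => read t (protect c (pref μ P))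
  | read μ Q => read t (protect c (read μ Q))
  | sum Q₁ Q₂ => read t (protect c (sum Q₁ Q₂))

variable {c : B} {t : TAct B}

theorem freeVars_protect (Q : RTerm B V) : (Q.protect c).freeVars = Q.freeVars := by
  induction Q <;> simp_all [protect, freeVars]

theorem guarded_protect {x : V} {Q : RTerm B V} : (Q.protect c).Guarded x ↔ Q.Guarded x := by
  induction Q <;> simp_all [protect, Guarded]

/-- The shape of the block matters here: a parallel composition with nil contains no read prefix,
and properness allows unguarded variables directly below it. -/
theorem readGuarded_protect {Q : RTerm B V} : (Q.protect c).ReadGuarded ↔ Q.ReadGuarded := by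
  induction Q <;> simp_all [protect, ReadGuarded]

theorem xProper_protect {x : V} {Q : RTerm B V} : (Q.protect c).XProper x ↔ Q.XProper x := by
  induction Q <;> simp_all [protect, XProper, guarded_protect]

theorem isInitial_protect {Q : RTerm B V} : (Q.protect c).IsInitial ↔ Q.IsInitial := by
  induction Q <;> simp_all [protect, IsInitial]

theorem isTerm_protect {Q : RTerm B V} : (Q.protect c).IsTerm ↔ Q.IsTerm := by
  induction Q <;> simp_all [protect, IsTerm, isInitial_protect]

theorem guardedRec_protect {Q : RTerm B V} : (Q.protect c).GuardedRec ↔ Q.GuardedRec := by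
  induction Q <;> simp_all [protect, guardedRec_nil, guardedRec_var, guardedRec_pref,
    guardedRec_read, guardedRec_sum, guardedRec_par, guardedRec_rel, guardedRec_fix,
    guarded_protect]

theorem rnf_protect {Q : RTerm B V} (h : Q.RNF) : (Q.protect c).RNF := by
  induction Q with
  | read μ Q ih =>
    rw [rnf_read] at h
    refine rnf_read.2 ⟨h.1.imp readGuarded_protect.2 ?_, ih h.2⟩
    rintro ⟨ν, P, rfl⟩
    exact ⟨ν, _, rfl⟩
  | _ => simp_all [protect, rnf_nil, rnf_var, rnf_pref, rnf_sum, rnf_par, rnf_rel, rnf_fix,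
      readGuarded_protect, xProper_protect]

/-- Free and bound variables alike are put beside nil in a composition synchronising on c, so
unfolding cannot release c here. -/
theorem blocked_protect {Q : RTerm B V} (h : Q.Fresh c) : (Q.protect c).Blocked c := by
  induction Q with
  | rel Q Φ ih =>
    refine ⟨fun α hα => ?_, ih h.2⟩
    by_contra hαc
    rw [Relabelling.keep_of_ne _ hαc] at hα
    exact hαc (h.1 _ hα)
  | _ => simp_all [protect, Blocked, Fresh]

theorem erases_protect {Q : RTerm B V} (h : Q.Fresh c) : Erases c true Q (Q.protect c) := by
  induction Q with
  | nil => exact .root .nil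
  | var x => exact .eraseBlock (.root (.var x))
  | pref μ P ih => exact .root (.pref h.1 (ih h.2))
  | read μ P ih => exact .root (.read h.1 (ih h.2))
  | sum P Q ihP ihQ => exact .root (.sum (ihP h.1) (ihQ h.2))
  | par A P Q ihP ihQ => exact .root (.par (fun _ _ => Iff.rfl) (ihP h.1) (ihQ h.2))
  | rel Q Φ ih => exact .root (.rel h.1 (ih h.2))
  | fix x Q ih => exact .root (.fix x (ih h))

theorem freeVars_distribute (Q : RTerm B V) : (Q.distribute c t).freeVars = Q.freeVars := by
  induction Q with
  | fix x Q ih =>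
    by_cases h : Q.ReadGuarded <;> simp [distribute, h, freeVars, freeVars_protect, ih]
  | _ => simp_all [distribute, protect, freeVars, freeVars_protect]

theorem guarded_distribute {x : V} {Q : RTerm B V} :
    (Q.distribute c t).Guarded x ↔ Q.Guarded x := by
  induction Q with
  | fix y Q ih =>
    by_cases h : Q.ReadGuarded <;> simp [distribute, h, Guarded, guarded_protect, ih]
  | _ => simp_all [distribute, protect, Guarded, guarded_protect]

theorem isInitial_distribute {Q : RTerm B V} (ht : t.IsLazy) (h : Q.IsInitial) :
    (Q.distribute c t).IsInitial := by
  induction Q with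
  | fix y Q ih =>
    by_cases h' : Q.ReadGuarded <;>
      simp_all [distribute, IsInitial, isInitial_protect]
  | _ => simp_all [distribute, protect, IsInitial, isInitial_protect]

theorem isTerm_distribute {Q : RTerm B V} (h : Q.IsTerm) : (Q.distribute c t).IsTerm := by
  induction Q with
  | fix y Q ih =>
    by_cases h' : Q.ReadGuarded <;> simp_all [distribute, IsTerm, isTerm_protect]
  | _ => simp_all [distribute, protect, IsTerm, isTerm_protect, isInitial_protect]

theorem guardedRec_distribute {Q : RTerm B V} (h : Q.GuardedRec) :
    (Q.distribute c t).GuardedRec := by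
  induction Q with
  | par A P Q ihP ihQ =>
    rw [guardedRec_par] at h
    exact guardedRec_par.2 ⟨ihP h.1, ihQ h.2⟩
  | rel Q Φ ih => exact guardedRec_rel.2 (ih (guardedRec_rel.1 h))
  | fix y Q ih =>
    rw [distribute]
    split_ifs
    · exact guardedRec_read.2 (guardedRec_protect (Q := fix y Q).2 h)
    · rw [guardedRec_fix] at h
      exact guardedRec_fix.2 ⟨guarded_distribute.2 h.1, ih h.2⟩
  | _ => exact guardedRec_read.2 (guardedRec_protect.2 h)

/-- Guardedness is required because the leaves receive read prefixes, and a read prefix in front of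
an unguarded x is not x-proper. -/
theorem xProper_distribute {x : V} {Q : RTerm B V} (h : Q.XProper x) (hg : Q.Guarded x) :
    (Q.distribute c t).XProper x := by
  induction Q with
  | par A P Q ihP ihQ => exact ⟨ihP h.1 hg.1, ihQ h.2 hg.2⟩
  | rel Q Φ ih => exact ih h hg
  | fix y Q ih =>
    rw [distribute]
    split_ifs
    · exact ⟨guarded_protect (Q := fix y Q).2 hg, xProper_protect (Q := fix y Q).2 h⟩
    · exact h.imp id fun h => ⟨guarded_distribute.2 h.1, ih h.2 h.1⟩
  | _ => exact ⟨guarded_protect.2 hg, xProper_protect.2 h⟩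

/-- The two cases for recursion match the two cases of rec-properness. A read-guarded body keeps the
prefix outside, as inserting reads would destroy read-guardedness; otherwise the body is x-proper,
and distribution preserves this by guardedness. -/
theorem rnf_distribute {Q : RTerm B V} (h : Q.RNF) (hg : Q.GuardedRec) :
    (Q.distribute c t).RNF := by
  induction Q with
  | nil => exact rnf_read.2 ⟨Or.inl trivial, rnf_protect h⟩
  | var => exact rnf_read.2 ⟨Or.inl ⟨trivial, trivial⟩, rnf_protect h⟩
  | pref => exact rnf_read.2 ⟨Or.inl trivial, rnf_protect h⟩
  | read => exact rnf_read.2 ⟨Or.inr ⟨_, _, rfl⟩, rnf_protect h⟩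
  | sum => exact rnf_read.2 ⟨Or.inl (readGuarded_protect.2 (rnf_sum.1 h).1), rnf_protect h⟩
  | par A P Q ihP ihQ =>
    rw [guardedRec_par] at hg
    rw [rnf_par] at h
    exact rnf_par.2 ⟨ihP h.1 hg.1, ihQ h.2 hg.2⟩
  | rel Q Φ ih => exact rnf_rel.2 (ih (rnf_rel.1 h) (guardedRec_rel.1 hg))
  | fix y Q ih =>
    rw [distribute]
    split_ifs with hr
    · exact rnf_read.2 ⟨Or.inl (readGuarded_protect (Q := fix y Q).2 hr),
        rnf_protect (Q := fix y Q) h⟩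
    · rw [rnf_fix] at h
      rw [guardedRec_fix] at hg
      exact rnf_fix.2 ⟨Or.inr (xProper_distribute (h.1.resolve_left hr) hg.1), ih h.2 hg.2⟩

/-! ### Distribution yields a marked term -/

/-- `R` results from `Q` by distributing the read prefix `t` of the fresh action `c`, passing at
most `n` operators on each path. -/
inductive Distributed (c : B) (t : TAct B) : ℕ → RTerm B V → RTerm B V → Prop
  | leaf (n : ℕ) {Q R : RTerm B V} : Erases c true Q R → R.Blocked c →
      Distributed c t n Q (read t R)
  | par {n : ℕ} (A : Set B) {Q₁ Q₂ R₁ R₂ : RTerm B V} : Distributed c t n Q₁ R₁ →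
      Distributed c t n Q₂ R₂ → Distributed c t (n + 1) (par A Q₁ Q₂) (par (insert c A) R₁ R₂)
  | rel {n : ℕ} {Φ : Relabelling B} {Q R : RTerm B V} :
      (∀ α, Φ.toFun α = some c → α = some c) → Distributed c t n Q R →
      Distributed c t (n + 1) (rel Q Φ) (rel R (Φ.keep c))
  | fix {n : ℕ} (x : V) {Q R : RTerm B V} : Distributed c t n Q R →
      Distributed c t (n + 1) (fix x Q) (fix x R)

theorem Distributed.mono {n m : ℕ} (hnm : n ≤ m) {Q R : RTerm B V} (h : Distributed c t n Q R) :
    Distributed c t m Q R := by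
  induction h generalizing m with
  | leaf _ hE hB => exact .leaf m hE hB
  | par A _ _ ih₁ ih₂ =>
    cases m with
    | zero => omega
    | succ m => exact .par A (ih₁ (by omega)) (ih₂ (by omega))
  | rel hΦ _ ih =>
    cases m with
    | zero => omega
    | succ m => exact .rel hΦ (ih (by omega))
  | fix x _ ih =>
    cases m with
    | zero => omega
    | succ m => exact .fix x (ih (by omega))

theorem exists_distributed {Q : RTerm B V} (h : Q.Fresh c) :
    ∃ n, Distributed c t n Q (Q.distribute c t) := by
  induction Q with
  | par A P Q ihP ihQ =>
    obtain ⟨n, hP⟩ := ihP h.1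
    obtain ⟨m, hQ⟩ := ihQ h.2
    exact ⟨max n m + 1, .par A (hP.mono (le_max_left _ _)) (hQ.mono (le_max_right _ _))⟩
  | rel Q Φ ih =>
    obtain ⟨n, hQ⟩ := ih h.2
    exact ⟨n + 1, .rel h.1 hQ⟩
  | fix x Q ih =>
    obtain ⟨n, hQ⟩ := ih h
    rw [distribute]
    split_ifs
    · exact ⟨0, .leaf 0 (erases_protect (Q := fix x Q) h) (blocked_protect (Q := fix x Q) h)⟩
    · exact ⟨n + 1, .fix x hQ⟩
  | _ => exact ⟨0, .leaf 0 (erases_protect h) (blocked_protect h)⟩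

/-- Makes the distributed recursion admissible as the term substituted in its own unfolding. For
this purpose `Erases` lets synchronisation sets differ in c. -/
theorem Distributed.erases {n : ℕ} {Q R : RTerm B V} (ht : t.act = some c)
    (h : Distributed c t n Q R) : Erases c true Q R := by
  induction h with
  | leaf _ hE => exact .eraseRead ht hE
  | par A _ _ ih₁ ih₂ => exact .root (.par (fun b hb => by simp [hb]) ih₁ ih₂)
  | rel hΦ _ ih => exact .root (.rel hΦ ih)
  | fix x _ ih => exact .root (.fix x ih)

variable [DecidableEq V]

/-- All variables lie below leaves, where c is blocked. So the bound `n` is unaffected, and `S'` may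
contain arbitrary erasable reads of c. -/
theorem Distributed.subst {n : ℕ} {Q R S S' : RTerm B V} (x : V) (h : Distributed c t n Q R)
    (hS : Erases c true S S') : Distributed c t n (subst x S Q) (subst x S' R) := by
  induction h with
  | leaf n hE hB => exact .leaf n (hE.subst x hS) (hB.subst x S')
  | par A _ _ ih₁ ih₂ => exact .par A ih₁ ih₂
  | rel hΦ _ ih => exact .rel hΦ ih
  | fix y h ih =>
    by_cases hy : y = x
    · simpa [RTerm.subst, hy] using .fix x h
    · simpa [RTerm.subst, hy] using .fix y ih

/-- Induction on the number of operators passed, because unfolding a recursion enlarges the terms.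
It removes one operator from every path and, by `Distributed.subst`, adds none. -/
theorem Distributed.marked {n : ℕ} {Q R : RTerm B V} (ht : t.act = some c)
    (h : Distributed c t n Q R) : Marked c t true Q R := by
  induction n generalizing Q R with
  | zero =>
    cases h with
    | leaf _ hE hB => exact .live hE hB
  | succ n ih =>
    cases h with
    | leaf _ hE hB => exact .live hE hB
    | par A h₁ h₂ => exact .par A (ih h₁) (ih h₂)
    | rel hΦ h => exact .rel hΦ (ih h)
    | fix x h => exact .unfoldL (.unfoldR (ih (h.subst x (.root (.fix x (h.erases ht))))))

theorem readBisimilar_distribute {μ : TAct B} {Q : RTerm B V} (h : Q.Fresh c) :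
    ReadBisimilar (RTerm.read μ Q)
      (RTerm.rel (Q.distribute c (μ.withAct c)) (renameAct c μ.act)) := by
  obtain ⟨n, h⟩ := exists_distributed (t := μ.withAct c) h
  exact (h.marked (μ.act_withAct c)).readBisimilar

/-! ### Normalisation of processes -/

/-- Processes whose choices and recursions are in read normal form can be brought into read
normal form. -/
theorem exists_rnf [Infinite B] (Q : RTerm B V) (hQ : Q.IsProc)
    (h : ∀ S ∈ Q.subterms, S.IsChoice ∨ S.IsRecursion → S.RNF) :
    ∃ Q', Q'.RNF ∧ Q'.IsProc ∧ (Q.IsInitial → Q'.IsInitial) ∧ ReadBisimilar Q Q' := by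
  induction Q with
  | nil => exact ⟨_, rnf_nil, hQ, id, .refl _⟩
  | var x => exact ⟨_, rnf_var x, hQ, id, .refl _⟩
  | sum P Q =>
    exact ⟨_, h _ (mem_subterms_self _) (Or.inl ⟨_, _, rfl⟩), hQ, id, .refl _⟩
  | fix x Q =>
    exact ⟨_, h _ (mem_subterms_self _) (Or.inr ⟨_, _, rfl⟩), hQ, id, .refl _⟩
  | pref μ P ih =>
    obtain ⟨hT, hG, hc⟩ := hQ
    obtain ⟨P', h₁, ⟨h₂, h₃, h₄⟩, h₅, h₆⟩ :=
      ih ⟨hT.isTerm, guardedRec_pref.1 hG, hc⟩ fun S hS => h S (Or.inr hS)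
    exact ⟨pref μ P', rnf_pref.2 h₁, ⟨h₅ hT, guardedRec_pref.2 h₃, h₄⟩,
      fun hi => ⟨hi.1, h₅ hi.2⟩, h₆.pref μ⟩
  | par A P Q ihP ihQ =>
    obtain ⟨hT, hG, hc⟩ := hQ
    rw [guardedRec_par] at hG
    simp only [freeVars, Set.union_empty_iff] at hc
    obtain ⟨P', h₁, ⟨h₂, h₃, h₄⟩, h₅, h₆⟩ :=
      ihP ⟨hT.1, hG.1, hc.1⟩ fun S hS => h S (Or.inl (Or.inr hS))
    obtain ⟨Q', k₁, ⟨k₂, k₃, k₄⟩, k₅, k₆⟩ :=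
      ihQ ⟨hT.2, hG.2, hc.2⟩ fun S hS => h S (Or.inr hS)
    exact ⟨par A P' Q', rnf_par.2 ⟨h₁, k₁⟩, ⟨⟨h₂, k₂⟩, guardedRec_par.2 ⟨h₃, k₃⟩,
      by simp [freeVars, h₄, k₄]⟩, fun hi => ⟨h₅ hi.1, k₅ hi.2⟩, h₆.par A k₆⟩
  | rel Q Φ ih =>
    obtain ⟨hT, hG, hc⟩ := hQ
    obtain ⟨Q', h₁, ⟨h₂, h₃, h₄⟩, h₅, h₆⟩ :=
      ih ⟨hT, guardedRec_rel.1 hG, hc⟩ fun S hS => h S (Or.inr hS)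
    exact ⟨rel Q' Φ, rnf_rel.2 h₁, ⟨h₂, guardedRec_rel.2 h₃, h₄⟩, h₅, h₆.rel Φ⟩
  | read μ Q ih =>
    obtain ⟨hT, hG, hc⟩ := hQ
    obtain ⟨Q', h₁, ⟨h₂, h₃, h₄⟩, h₅, h₆⟩ :=
      ih ⟨hT, guardedRec_read.1 hG, hc⟩ fun S hS => h S (Or.inr hS)
    -- Freshness is required for the normalised body `Q'`, which may contain actions introduced by
    -- earlier distributions.
    obtain ⟨c, hF⟩ := exists_fresh Q'
    refine ⟨_, rnf_rel.2 (rnf_distribute h₁ h₃), ⟨isTerm_distribute (Q := Q') h₂,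
      guardedRec_rel.2 (guardedRec_distribute h₃), (freeVars_distribute Q').trans h₄⟩,
      fun hi => isInitial_distribute (Q := Q') ?_ (h₅ hi.2),
      (h₆.read μ).trans (readBisimilar_distribute hF)⟩
    cases μ with
    | lazy => trivial
    | urgent => exact hi.1.elim

theorem ReadBisimilar.timedBisimilar {P Q : RTerm B V} {R : STerm B V}
    (h₁ : ReadBisimilar P Q) (h₂ : TimedBisimilar (lts B V) (STerm.lts B V) Q R) :
    TimedBisimilar (lts B V) (STerm.lts B V) P R := by
  obtain ⟨σ, hσ, h₁⟩ := h₁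
  obtain ⟨ρ, hρ, h₂⟩ := h₂
  refine ⟨fun P R => ∃ Q, σ P Q ∧ ρ Q R, ⟨?_, ?_, ?_, ?_⟩, Q, h₁, h₂⟩
  · rintro P R ⟨Q, h₁, h₂⟩ α P' (h | h)
    · obtain ⟨Q', h, h₁⟩ := hσ.ord_forth h₁ h
      obtain ⟨R', h, h₂⟩ := hρ.act_forth _ _ h₂ α Q' (Or.inl h)
      exact ⟨R', h, Q', h₁, h₂⟩
    · obtain ⟨Q', h, h₁⟩ := hσ.read_forth h₁ h
      obtain ⟨R', h, h₂⟩ := hρ.act_forth _ _ h₂ α Q' (Or.inr h)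
      exact ⟨R', h, Q', h₁, h₂⟩
  · rintro P R ⟨Q, h₁, h₂⟩ α R' h
    obtain ⟨Q', h | h, h₂⟩ := hρ.act_back _ _ h₂ α R' h
    · obtain ⟨P', h, h₁⟩ := hσ.ord_back h₁ h
      exact ⟨P', Or.inl h, Q', h₁, h₂⟩
    · obtain ⟨P', h, h₁⟩ := hσ.read_back h₁ h
      exact ⟨P', Or.inr h, Q', h₁, h₂⟩
  · rintro P R ⟨Q, h₁, h₂⟩ X P' h
    obtain ⟨Q', h, h₁⟩ := hσ.time_forth h₁ h
    obtain ⟨R', h, h₂⟩ := hρ.time_forth _ _ h₂ X Q' h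
    exact ⟨R', h, Q', h₁, h₂⟩
  · rintro P R ⟨Q, h₁, h₂⟩ X R' h
    obtain ⟨Q', h, h₂⟩ := hρ.time_back _ _ h₂ X R' h
    obtain ⟨P', h, h₁⟩ := hσ.time_back h₁ h
    exact ⟨P', h, Q', h₁, h₂⟩

end RTerm

end PAFAS

theorem theorem5 {B : Type*} {V : Type*} [Infinite B] [DecidableEq V]
    (Q : PAFAS.RTerm B V) (hQ : Q.IsProc)
    (hRNF : ∀ S ∈ Q.subterms, S.IsChoice ∨ S.IsRecursion → S.RNF) :
    ∃ R : PAFAS.STerm B V, R.IsProc ∧ R.Proper ∧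
      PAFAS.TimedBisimilar (PAFAS.RTerm.lts B V) (PAFAS.STerm.lts B V) Q R := by
  obtain ⟨Q', h₁, h₂, -, h₃⟩ := Q.exists_rnf hQ hRNF
  exact ⟨Q'.toSTerm, PAFAS.RTerm.isProc_toSTerm h₂, PAFAS.RTerm.proper_toSTerm h₁,
    h₃.timedBisimilar ⟨_, PAFAS.RTerm.isTimedBisimulation_toSTerm B V, h₁, h₂.2.2, rfl⟩⟩
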